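/- **Conventions.** For a field $K\supseteq\mathbb Q$ let $\mathfrak f_{n,r}(K)=V_1(K)\oplus\dots\oplus V_r(K)$ be the free $r$-step nilpotent Lie algebra over $K$ on $n$ generators $x_1,\dots,x_n$, with $V_1(K)=\operatorname{span}_K\{x_i\}$, so that $\mathfrak f_{n,r}(K)=K\otimes_{\mathbb Q}\mathfrak f_{n,r}(\mathbb Q)$. A subspace $E$ of $\mathfrak f_{n,r}(K)$ is *rational* if it is spanned by $E\cap\mathfrak f_{n,r}(\mathbb Q)$; then $E^{\mathbb R}\subseteq\mathfrak f_{n,r}(\mathbb R)$ is the real span of $E\cap\mathfrak f_{n,r}(\mathbb Q)$. A Galois group $G=\mathrm{Gal}(K/\mathbb Q)$ acts on $\mathfrak f_{n,r}(K)$ through the first factor of the tensor product, and $E_G(w)=\operatorname{span}_K\{g\cdot w: g\in G\}$, which is rational. A matrix $A\in M_n(\mathbb Z)$ induces the endomorphism $f^A$ with $x_j\mapsto\sum_i A_{ij}x_i$. An automorphism of a real Lie algebra $\mathfrak n$ is *Anosov* if, in some basis of $\mathfrak n$ with rational structure constants, it is given by a matrix in $GL_m(\mathbb Z)$ without complex eigenvalues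 of modulus one; $\mathfrak n$ is *Anosov* if it has an Anosov automorphism. *Cyclic type.* Let $K/\mathbb Q$ be a cyclic Galois extension of degree $n$ with group $G$, and let $z_1,\dots,z_n$ be a basis of $V_1(K)$ that $G$ permutes cyclically. Call $w\in\mathfrak f_{n,r}(K)$ a *weight vector* if it is a $K$-linear combination of iterated brackets of the $z_j$ whose vectors of letter counts are all congruent modulo $\mathbb Z(1,\dots,1)$. An ideal of $\mathfrak f_{n,r}(\mathbb R)$ is *of type $C_n$ defined over $\mathbb R$* (relative to $z$) if, for some set $W$ of weight vectors, it is generated by the subspaces $E_G(w)^{\mathbb R}$, $w\in W$; here the rational structure of $\mathfrak f_{n,r}(\mathbb R)$ may be the one defined by any set of $n$ generators. Let $\mathfrak j_{n,r}$ be the ideal generated by all iterated brackets of $z_1,\dots,z_n$ in which all letters occur equally often; it is rational. **Theorem.** Let $\overline f$ be a semisimple Anosov automorphism of a real $r$-step nilpotent Lie algebra $\mathfrak n$, let $p_1\in\mathbb Z[x]$ be the characteristic polynomial of the automorphism of $\mathfrak n/[\mathfrak n,\mathfrak n]$ induced by $\overline f$, and let $n=\deg p_1$. Suppose that $p_1$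 is irreducible. 1. If $n$ is prime and the Galois group of $p_1$ is cyclic, then $\mathfrak n\cong\mathfrak f_{n,r}(\mathbb R)/\mathfrak i$ for some ideal $\mathfrak i$ of type $C_n$ defined over $\mathbb R$. Conversely, if $n$ is any prime, $r$ is any natural number, and $\mathfrak i$ is an ideal of $\mathfrak f_{n,r}(\mathbb R)$ of type $C_n$ defined over $\mathbb R$, relative to $z$, which contains $\mathfrak j_{n,r}^{\mathbb R}$ (formed with the same $z$ and the same rational structure), then $\mathfrak f_{n,r}(\mathbb R)/\mathfrak i$ is Anosov. 2. Suppose that the Galois group of $p_1$ is isomorphic to the symmetric group $S_n$. (a) If $r=2$, then $\mathfrak n\cong\mathfrak f_{n,2}(\mathbb R)$. (b) Let $r=3$, let $K$ be the splitting field of $p_1$, let $A\in M_n(\mathbb Z)$ have characteristic polynomial $p_1$, and let $z_1,\dots,z_n$ be a basis of $V_1(K)$ of eigenvectors of $f^A$. Put $$F_1=\operatorname{span}_K\{[[z_i,z_j],z_i],\,[[z_i,z_j],z_j]: j<i\},\qquad F_2=\operatorname{span}_K\{[[z_i,z_j],z_k],\,[[z_k,z_j],z_i]: j<i<k\}.$$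 Then $\mathfrak n\cong\mathfrak f_{n,3}(\mathbb R)/\mathfrak i$, where $\mathfrak i$ is one of the five ideals $0$, $F_1^{\mathbb R}$, $F_2^{\mathbb R}$, $(F_1\oplus F_{2a})^{\mathbb R}$, $F_{2a}^{\mathbb R}$, and $F_{2a}$ is a summand in some decomposition $F_2=F_{2a}\oplus F_{2b}$ into rational $f^A$-invariant subspaces, each of dimension $\binom n3$. -/

import Mathlib

open Polynomial
open scoped TensorProduct

noncomputable section

namespace AnosovLie

/-! ### Anosov Lie algebras -/

section Anosov

variable {𝔫 : Type*} [LieRing 𝔫] [LieAlgebra ℝ 𝔫]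

/-- An Anosov automorphism of a real Lie algebra: there is a (finite) basis with rational structure
constants in which the automorphism is represented by a matrix in `GL_m(ℤ)`, and that matrix is
hyperbolic, i.e. it has no complex eigenvalue of modulus one. -/
def IsAnosovAut (f : 𝔫 ≃ₗ⁅ℝ⁆ 𝔫) : Prop :=
  ∃ (m : ℕ) (b : Module.Basis (Fin m) ℝ 𝔫) (M : Matrix.GeneralLinearGroup (Fin m) ℤ),
    (∀ i j k, ∃ q : ℚ, b.repr ⁅b i, b j⁆ k = (q : ℝ)) ∧
    LinearMap.toMatrix b b ((f : 𝔫 →ₗ⁅ℝ⁆ 𝔫) : 𝔫 →ₗ[ℝ] 𝔫) =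
      (M : Matrix (Fin m) (Fin m) ℤ).map (Int.cast : ℤ → ℝ) ∧
    ∀ μ : ℂ, ((M : Matrix (Fin m) (Fin m) ℤ).map (Int.cast : ℤ → ℂ)).charpoly.IsRoot μ → ‖μ‖ ≠ 1

variable (𝔫) in
/-- A real Lie algebra is Anosov if it admits an Anosov automorphism. -/
def IsAnosov : Prop := ∃ f : 𝔫 ≃ₗ⁅ℝ⁆ 𝔫, IsAnosovAut f

variable (𝔫) in
/-- `𝔫` is exactly `r`-step nilpotent (Mathlib's series starts with `𝔫` itself at index `0`). -/
def IsStepNilpotent (r : ℕ) : Prop :=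
  LieModule.lowerCentralSeries ℝ 𝔫 𝔫 r = ⊥ ∧
    ∀ s < r, LieModule.lowerCentralSeries ℝ 𝔫 𝔫 s ≠ ⊥

theorem lcs_le_comap {R L : Type*} [CommRing R] [LieRing L] [LieAlgebra R L] (f : L →ₗ⁅R⁆ L)
    (k : ℕ) :
    (LieModule.lowerCentralSeries R L L k).toSubmodule ≤
      (LieModule.lowerCentralSeries R L L k).toSubmodule.comap (f : L →ₗ[R] L) := by
  intro x hx
  exact LieIdeal.map_lowerCentralSeries_le k (LieIdeal.mem_map hx)

/-- The automorphism of the vector space `𝔫 / [𝔫, 𝔫]` induced by an automorphism of `𝔫`. -/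
def abMap (f : 𝔫 ≃ₗ⁅ℝ⁆ 𝔫) :
    (𝔫 ⧸ (LieModule.lowerCentralSeries ℝ 𝔫 𝔫 1).toSubmodule) →ₗ[ℝ]
      (𝔫 ⧸ (LieModule.lowerCentralSeries ℝ 𝔫 𝔫 1).toSubmodule) :=
  Submodule.mapQ _ _ ((f : 𝔫 →ₗ⁅ℝ⁆ 𝔫) : 𝔫 →ₗ[ℝ] 𝔫) (lcs_le_comap (f : 𝔫 →ₗ⁅ℝ⁆ 𝔫) 1)

/-- `p ∈ ℤ[X]` is the first polynomial `p₁` associated to the automorphism `f` of `𝔫`.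
If `f` lifts to an automorphism of the free nilpotent Lie algebra `V₁ ⊕ ⋯ ⊕ V_r` preserving `V₁`,
along a projection onto `𝔫` whose kernel lies in the commutator ideal, then this projection
identifies the action of the lift on `V₁` with the action of `f` on `𝔫 / [𝔫, 𝔫]`; so `p₁` is the
characteristic polynomial of the latter. -/
def IsFirstPoly [FiniteDimensional ℝ 𝔫] (f : 𝔫 ≃ₗ⁅ℝ⁆ 𝔫) (p : ℤ[X]) : Prop :=
  p.map (Int.castRingHom ℝ) = (abMap f).charpoly

end Anosov

/-! ### Free nilpotent Lie algebras, with their rational structure -/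

section Free

/-- The lower central series term that is divided out of the free Lie algebra over `ℚ`. -/
abbrev freeTail (n r : ℕ) : LieIdeal ℚ (FreeLieAlgebra ℚ (Fin n)) :=
  LieModule.lowerCentralSeries ℚ (FreeLieAlgebra ℚ (Fin n)) (FreeLieAlgebra ℚ (Fin n)) r

/-- The free `r`-step nilpotent Lie algebra on `n` generators over `ℚ`. -/
abbrev FreeNilQ (n r : ℕ) : Type := FreeLieAlgebra ℚ (Fin n) ⧸ freeTail n r

/-- The free `r`-step nilpotent Lie algebra on `n` generators over an extension `K` of `ℚ`, presented
as the extension of scalars of its rational form (the `ℚ`-span of a Hall basis). -/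
abbrev FreeNil (K : Type*) [Field K] [Algebra ℚ K] (n r : ℕ) : Type _ := K ⊗[ℚ] FreeNilQ n r

variable {n r : ℕ}

/-- The standard generators over `ℚ`. -/
def genQ (n r : ℕ) (i : Fin n) : FreeNilQ n r :=
  LieSubmodule.Quotient.mk (FreeLieAlgebra.of ℚ i)

/-- The endomorphism of the free nilpotent Lie algebra over `ℚ` with `x_j ↦ ∑ i, A i j x_i`. -/
def matEndQ (r : ℕ) (A : Matrix (Fin n) (Fin n) ℤ) : FreeNilQ n r →ₗ[ℚ] FreeNilQ n r :=
  Submodule.mapQ (freeTail n r).toSubmodule (freeTail n r).toSubmodule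
    ((FreeLieAlgebra.lift ℚ fun j => ∑ i, (A i j : ℚ) • FreeLieAlgebra.of ℚ i :
      FreeLieAlgebra ℚ (Fin n) →ₗ⁅ℚ⁆ FreeLieAlgebra ℚ (Fin n)) :
      FreeLieAlgebra ℚ (Fin n) →ₗ[ℚ] FreeLieAlgebra ℚ (Fin n))
    (lcs_le_comap _ r)

section overK

variable (K : Type*) [Field K] [Algebra ℚ K]

/-- The standard generators over `K`. -/
def gen (n r : ℕ) (i : Fin n) : FreeNil K n r := (1 : K) ⊗ₜ[ℚ] genQ n r i

/-- The first step `V₁(K)`, spanned by the standard generators. -/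
def stepOne (n r : ℕ) : Submodule K (FreeNil K n r) := Submodule.span K (Set.range (gen K n r))

/-- The map `f^A` over `K` induced by an integer matrix `A`. -/
def matEnd (r : ℕ) (A : Matrix (Fin n) (Fin n) ℤ) : FreeNil K n r →ₗ[K] FreeNil K n r :=
  (matEndQ r A).baseChange K

variable {K}

/-- The Galois action on the free nilpotent Lie algebra over `K`: a field automorphism acts on the
coordinates with respect to a rational (Hall) basis. -/
def galAct (g : K ≃ₐ[ℚ] K) : FreeNil K n r →ₗ[ℚ] FreeNil K n r :=
  LinearMap.rTensor (FreeNilQ n r) g.toLinearMap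

/-- `E_G^K(w)`: the `K`-span of the orbit of `w` under the Galois group `G` of `K / ℚ`. -/
def orbitSpan (w : FreeNil K n r) : Submodule K (FreeNil K n r) :=
  Submodule.span K (Set.range fun g : K ≃ₐ[ℚ] K => galAct g w)

/-- The rational points of a subspace. -/
def ratPart (E : Submodule K (FreeNil K n r)) : Submodule ℚ (FreeNilQ n r) :=
  (E.restrictScalars ℚ).comap (TensorProduct.mk ℚ K (FreeNilQ n r) 1)

/-- A subspace is rational if it is spanned by its rational points. -/
def IsRational (E : Submodule K (FreeNil K n r)) : Prop := (ratPart E).baseChange K = E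

/-- The correspondence `E ↦ E^ℝ` from rational subspaces over `K` to rational subspaces over `ℝ`:
take the real span of the rational points. -/
def toReal (E : Submodule K (FreeNil K n r)) : Submodule ℝ (FreeNil ℝ n r) :=
  (ratPart E).baseChange ℝ

end overK

/-! ### Iterated brackets -/

/-- The iterated bracket of the elements `z_j` of shape `t`. -/
def bracketEval {L : Type*} [LieRing L] (z : Fin n → L) : FreeMagma (Fin n) → L
  | .of j => z j
  | .mul s t => ⁅bracketEval z s, bracketEval z t⁆

/-- The number of occurrences of the letter `j` in an iterated bracket. -/
def letterCount (j : Fin n) : FreeMagma (Fin n) → ℕ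
  | .of i => if i = j then 1 else 0
  | .mul s t => letterCount j s + letterCount j t

variable {K : Type*} [Field K] [Algebra ℚ K]

/-- The ideal `𝔧_{n,r}` relative to `z`: generated by the iterated brackets in which all the letters
`z_j` occur equally often. (Hall basis elements with given letter counts span all iterated brackets
with these letter counts, so it is enough, and the same, to use the Hall basis elements.) -/
def jIdeal (z : Fin n → FreeNil K n r) : LieIdeal K (FreeNil K n r) :=
  LieSubmodule.lieSpan K (FreeNil K n r)
    {w | ∃ t : FreeMagma (Fin n), (∃ k : ℕ, ∀ j, letterCount j t = k) ∧ w = bracketEval z t}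

/-! ### Ideals of cyclic type -/

/-- `K / ℚ` is a cyclic extension of degree `n`, and `z` is a set of generators in `V₁(K)` which the
Galois group `G ≅ C_n` permutes cyclically. -/
structure IsCyclicFrame (z : Fin n → FreeNil K n r) : Prop where
  isGalois : IsGalois ℚ K
  finrank_eq : Module.finrank ℚ K = n
  linearIndependent : LinearIndependent K z
  span_eq : Submodule.span K (Set.range z) = stepOne K n r
  cyclic : ∃ σ : K ≃ₐ[ℚ] K, (∀ g : K ≃ₐ[ℚ] K, g ∈ Subgroup.zpowers σ) ∧
    ∀ j, galAct σ (z j) = z (finRotate n j)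

/-- `w` is a weight vector relative to `z`: a linear combination of iterated brackets of the `z_j`
whose vectors of letter counts are all congruent modulo `(1, …, 1)`. Equivalently, `w` is an
eigenvector of all diagonal automorphisms `z_j ↦ α_j z_j` with `α_1 ⋯ α_n = 1`. -/
def IsWeightVector (z : Fin n → FreeNil K n r) (w : FreeNil K n r) : Prop :=
  ∃ d : Fin n → ℤ, w ∈ Submodule.span K
    {u | ∃ t : FreeMagma (Fin n), (∃ k : ℤ, ∀ j, (letterCount j t : ℤ) = d j + k) ∧
      u = bracketEval z t}

/-- `I` is an ideal of `𝔣_{n,r}(ℝ)` of type `C_n` defined over `ℝ`, relative to the cyclic frame `z`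
in `𝔣_{n,r}(K)` and the rational structure on `𝔣_{n,r}(ℝ)` transported from the standard one by the
automorphism `φ` (i.e. defined by the generating set `φ x_1, …, φ x_n`): it is the ideal generated
by subspaces `(E_G^K(w))^ℝ` with weight vectors `w`. -/
def IsCyclicTypeIdealFor (φ : FreeNil ℝ n r ≃ₗ⁅ℝ⁆ FreeNil ℝ n r) (z : Fin n → FreeNil K n r)
    (I : LieIdeal ℝ (FreeNil ℝ n r)) : Prop :=
  IsCyclicFrame z ∧ ∃ W : Set (FreeNil K n r), (∀ w ∈ W, IsWeightVector z w) ∧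
    I = LieSubmodule.lieSpan ℝ (FreeNil ℝ n r)
      (⋃ w ∈ W, φ '' (toReal (orbitSpan w) : Set (FreeNil ℝ n r)))

/-- `I` is an ideal of type `C_n` defined over `ℝ`. -/
def IsCyclicTypeIdeal (I : LieIdeal ℝ (FreeNil ℝ n r)) : Prop :=
  ∃ (K : Type) (_ : Field K) (_ : Algebra ℚ K) (φ : FreeNil ℝ n r ≃ₗ⁅ℝ⁆ FreeNil ℝ n r)
    (z : Fin n → FreeNil K n r), IsCyclicTypeIdealFor φ z I

/-! ### The subspaces `F₁`, `F₂`, `F_{2a}` of the third step -/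

/-- `z` is a basis of `V₁(K)` that consists of eigenvectors of `f^A`. -/
structure IsEigenFrame (A : Matrix (Fin n) (Fin n) ℤ) (z : Fin n → FreeNil K n r) : Prop where
  linearIndependent : LinearIndependent K z
  span_eq : Submodule.span K (Set.range z) = stepOne K n r
  eigen : ∀ j, ∃ α : K, matEnd K r A (z j) = α • z j

/-- `F₁(K)`: the span of the brackets `[[z_i, z_j], z_i]` and `[[z_i, z_j], z_j]`, `j < i`. -/
def F1 (z : Fin n → FreeNil K n r) : Submodule K (FreeNil K n r) :=
  Submodule.span K {w | ∃ i j, j < i ∧ (w = ⁅⁅z i, z j⁆, z i⁆ ∨ w = ⁅⁅z i, z j⁆, z j⁆)}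

/-- `F₂(K)`: the span of the brackets `[[z_i, z_j], z_k]` and `[[z_k, z_j], z_i]`, `j < i < k`. -/
def F2 (z : Fin n → FreeNil K n r) : Submodule K (FreeNil K n r) :=
  Submodule.span K {w | ∃ i j k, j < i ∧ i < k ∧ (w = ⁅⁅z i, z j⁆, z k⁆ ∨ w = ⁅⁅z k, z j⁆, z i⁆)}

/-- A rational subspace, invariant under `f^A`. -/
def IsRationalInvariant (A : Matrix (Fin n) (Fin n) ℤ) (E : Submodule K (FreeNil K n r)) : Prop :=
  IsRational E ∧ ∀ x ∈ E, matEnd K r A x ∈ E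

/-- `E` is a summand `F_{2a}` of `F₂(K)`: there is a decomposition `F₂ = E ⊕ E'` into rational
invariant subspaces, each of dimension `n choose 3`. -/
def IsF2a (A : Matrix (Fin n) (Fin n) ℤ) (z : Fin n → FreeNil K n r)
    (E : Submodule K (FreeNil K n r)) : Prop :=
  ∃ E' : Submodule K (FreeNil K n r), IsRationalInvariant A E ∧ IsRationalInvariant A E' ∧
    E ⊓ E' = ⊥ ∧ E ⊔ E' = F2 z ∧
    Module.finrank K E = n.choose 3 ∧ Module.finrank K E' = n.choose 3

/-- The ideal of `𝔣_{n,r}(ℝ)` that corresponds to a rational subspace over `K`. -/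
def realIdeal (E : Submodule K (FreeNil K n r)) : LieIdeal ℝ (FreeNil ℝ n r) :=
  LieSubmodule.lieSpan ℝ (FreeNil ℝ n r) (toReal E : Set (FreeNil ℝ n r))

end Free

/-- The rational polynomial of an integer polynomial. -/
abbrev ratPoly (p : ℤ[X]) : ℚ[X] := p.map (Int.castRingHom ℚ)

end AnosovLie

end

/-!
Let `g` be a semisimple automorphism of a rational nilpotent Lie algebra `N` whose action on `N /
[N, N]` has an irreducible characteristic polynomial `p`, and let `A` be an integer matrix with
characteristic polynomial `p`. The polynomial `minpoly g` is squarefree and divisible by `p`, so the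
abelianization can be lifted to a subspace of `N` on which `g` acts like `A`. Hence `N` is the
quotient of a free nilpotent Lie algebra by a rational ideal `J` that is invariant under `f^A` and
contained in the commutator ideal (`exists_equivariant_surjection`). The rational span of the basis
in the definition of an Anosov automorphism is such an `N`, and there `p` is the polynomial of a
hyperbolic unit (`exists_presentation`).

Over the splitting field `K` the first step has a basis `z` of eigenvectors of `f^A`, which the
Galois group permutes up to scalars, with eigenvalues the roots `α` of `p`. The iterated brackets of
the `z j` are eigenvectors whose eigenvalues are monomials in the `α j`, and by Lagrange
interpolation (`mem_iSup_inf_span`) the invariant ideal `J` is spanned by its eigenvectors.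
Everything depends on the fact that two monomials agree only if their exponents differ by a constant
vector (`RelationsTrivial`). For a cyclic group of prime order this follows from the irreducibility
of the cyclotomic polynomial (`pow_eq_pow_of_cyclic`), for the symmetric group by applying a
transposition to a relation (`pow_eq_pow_of_symmetric`): in both cases a nontrivial relation would
make a power of some root a rational unit, thus `1` or `-1`, against hyperbolicity.

In the cyclic case this says that the eigenvectors are weight vectors, and as the ideal is rational,
Galois descent (`isRational_of_galAct_mem`) shows that it is generated by the real forms of the
spans of their orbits. In the symmetric case the Galois group acts transitively on each type of
bracket. So `J` has no eigenvectors in the second step, it contains `F₁` or lies in `F₂`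
(`le_F2_or_F1_le`), and if its intersection with `F₂` is neither `0` nor `F₂`, this intersection
contains exactly one line in each of the `n.choose 3` at most two-dimensional eigenspaces of `F₂`
(`finrank_of_le_F2`); the complement exists because `f^A` is semisimple.

For the converse, by `isAnosov_quotient` it is enough to find an endomorphism of the rational free
nilpotent Lie algebra that preserves the ideal and is annihilated, modulo the ideal, by the
polynomial of a hyperbolic unit. If `n` is odd, Dirichlet's theorem provides a unit of infinite
order in `K`; the diagonal map whose entries on `z` are the conjugates of its square descends to the
rational numbers (`exists_diagonal_lieHom`), has determinant one and so preserves the orbits of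
weight vectors. As `K` is totally real, an eigenvalue of absolute value one squares to `1`, which by
the triviality of relations happens only on brackets with all letters equally frequent, that is in
`𝔧`. If `n = 2`, an imaginary quadratic field has no such unit; but then `𝔧` is the commutator
ideal, and the ideal is either the commutator ideal or everything, which is preserved by every
integer matrix.
-/

open Polynomial
open scoped TensorProduct

noncomputable section

namespace AnosovLie

/-! ### Generators of nilpotent Lie algebras -/

section Generators

open LieModule

variable {R L : Type*} [CommRing R] [LieRing L] [LieAlgebra R L]

theorem lie_mem_lcs_add {a b : ℕ} {x y : L} (hx : x ∈ lowerCentralSeries R L L a)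
    (hy : y ∈ lowerCentralSeries R L L b) : ⁅x, y⁆ ∈ lowerCentralSeries R L L (a + b + 1) := by
  induction a generalizing b x y with
  | zero =>
    rw [Nat.zero_add, lowerCentralSeries_succ]
    exact LieSubmodule.lie_mem_lie (LieSubmodule.mem_top x) hy
  | succ a ih =>
    have hx' : x ∈ (⁅(⊤ : LieIdeal R L), lowerCentralSeries R L L a⁆ : LieIdeal R L) := by
      rwa [← lowerCentralSeries_succ]
    rw [← LieSubmodule.mem_toSubmodule, LieSubmodule.lieIdeal_oper_eq_linear_span'] at hx'
    induction hx' using Submodule.span_induction with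
    | mem w hw =>
      obtain ⟨u, -, v, hv, rfl⟩ := hw
      rw [lie_lie]
      have h1 : ⁅u, ⁅v, y⁆⁆ ∈ lowerCentralSeries R L L (a + 1 + b + 1) := by
        have := LieSubmodule.lie_mem_lie (LieSubmodule.mem_top (R := R) (L := L) u) (ih hv hy)
        rw [← lowerCentralSeries_succ] at this
        convert this using 2; omega
      have h2 : ⁅v, ⁅u, y⁆⁆ ∈ lowerCentralSeries R L L (a + 1 + b + 1) := by
        have h3 := LieSubmodule.lie_mem_lie (LieSubmodule.mem_top (R := R) (L := L) u) hy
        rw [← lowerCentralSeries_succ] at h3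
        have := ih hv h3
        convert this using 2; omega
      exact sub_mem h1 h2
    | zero => simp
    | add u v hu hv h1 h2 =>
      rw [add_lie]
      rw [← LieSubmodule.lieIdeal_oper_eq_linear_span', LieSubmodule.mem_toSubmodule,
        ← lowerCentralSeries_succ] at hu hv
      exact add_mem (h1 hu) (h2 hv)
    | smul c u hu h1 =>
      rw [smul_lie]
      rw [← LieSubmodule.lieIdeal_oper_eq_linear_span', LieSubmodule.mem_toSubmodule,
        ← lowerCentralSeries_succ] at hu
      exact SMulMemClass.smul_mem c (h1 hu)

/-- The span of the right-normed brackets `[z_{i₀}, [z_{i₁}, …, z_{i_k}]]` of length `k + 1`. -/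
def normedSpan (R : Type*) {L ι : Type*} [CommRing R] [LieRing L] [LieAlgebra R L] (z : ι → L) :
    ℕ → Submodule R L
  | 0 => Submodule.span R (Set.range z)
  | k + 1 => ⨆ i, (normedSpan R z k).map (LieModule.toEnd R L L (z i))

variable {ι : Type*} {z : ι → L}

theorem lie_mem_normedSpan {k : ℕ} {x y : L} (hx : x ∈ Submodule.span R (Set.range z))
    (hy : y ∈ normedSpan R z k) : ⁅x, y⁆ ∈ normedSpan R z (k + 1) := by
  induction hx using Submodule.span_induction with
  | mem w hw =>
    obtain ⟨i, rfl⟩ := hw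
    exact Submodule.mem_iSup_of_mem i ⟨y, hy, rfl⟩
  | zero => simp
  | add u v _ _ h1 h2 => rw [add_lie]; exact add_mem h1 h2
  | smul c u _ h1 => rw [smul_lie]; exact Submodule.smul_mem _ c h1

theorem fg_normedSpan [Finite ι] (z : ι → L) (k : ℕ) : (normedSpan R z k).FG := by
  induction k with
  | zero => exact Submodule.fg_span (Set.finite_range z)
  | succ k ih => exact Submodule.fg_iSup _ fun i => ih.map _

/-- If `z` generates `L` modulo `[L, L]`, the brackets of length `k + 1` span the `k`-th term of the
lower central series modulo the next one. -/
theorem lcs_le_normedSpan_sup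
    (hz : Submodule.span R (Set.range z) ⊔ (lowerCentralSeries R L L 1).toSubmodule = ⊤) (k : ℕ) :
    (lowerCentralSeries R L L k).toSubmodule ≤
      normedSpan R z k ⊔ (lowerCentralSeries R L L (k + 1)).toSubmodule := by
  induction k with
  | zero => rw [normedSpan, Nat.zero_add, hz]; exact le_top
  | succ k ih =>
    rw [lowerCentralSeries_succ, LieSubmodule.lieIdeal_oper_eq_linear_span', Submodule.span_le]
    rintro _ ⟨x, -, y, hy, rfl⟩
    obtain ⟨v, hv, u, hu, rfl⟩ := Submodule.mem_sup.1 (hz ▸ Submodule.mem_top (x := x))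
    obtain ⟨w, hw, t, ht, rfl⟩ := Submodule.mem_sup.1 (ih hy)
    rw [add_lie, lie_add v, add_assoc ⁅v, w⁆]
    refine Submodule.add_mem_sup (lie_mem_normedSpan hv hw) (add_mem ?_ ?_)
    · have := LieSubmodule.lie_mem_lie (LieSubmodule.mem_top (R := R) (L := L) v) ht
      rwa [← lowerCentralSeries_succ] at this
    · have := lie_mem_lcs_add hu hy
      rwa [show 1 + k + 1 = k + 1 + 1 by omega] at this

theorem eq_top_of_generators {r : ℕ} (hr : lowerCentralSeries R L L r = ⊥)
    (hz : Submodule.span R (Set.range z) ⊔ (lowerCentralSeries R L L 1).toSubmodule = ⊤)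
    (E : Submodule R L) (hE : ∀ k, normedSpan R z k ≤ E) : E = ⊤ := by
  have key : ∀ d, (lowerCentralSeries R L L (r - d)).toSubmodule ≤ E := by
    intro d
    induction d with
    | zero => simp [hr]
    | succ d ih =>
      rcases Nat.lt_or_ge d r with h | h
      · refine (lcs_le_normedSpan_sup hz _).trans (sup_le (hE _) ?_)
        rwa [show r - (d + 1) + 1 = r - d by omega]
      · rwa [show r - (d + 1) = r - d by omega]
  have := key r
  rw [Nat.sub_self, lowerCentralSeries_zero] at this
  exact top_le_iff.1 this

theorem lieSubalgebra_eq_top {r : ℕ} (hr : lowerCentralSeries R L L r = ⊥)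
    (hz : Submodule.span R (Set.range z) ⊔ (lowerCentralSeries R L L 1).toSubmodule = ⊤)
    (H : LieSubalgebra R L) (hH : ∀ i, z i ∈ H) : H = ⊤ := by
  rw [← LieSubalgebra.toSubmodule_inj]
  refine eq_top_of_generators hr hz _ fun k => ?_
  induction k with
  | zero => rw [normedSpan, Submodule.span_le]; rintro _ ⟨i, rfl⟩; exact hH i
  | succ k ih =>
    refine iSup_le fun i => ?_
    rintro _ ⟨y, hy, rfl⟩
    exact H.lie_mem (hH i) (ih hy)

theorem finite_of_generators [Finite ι] {r : ℕ} (hr : lowerCentralSeries R L L r = ⊥)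
    (hz : Submodule.span R (Set.range z) ⊔ (lowerCentralSeries R L L 1).toSubmodule = ⊤) :
    Module.Finite R L := by
  refine ⟨?_⟩
  have key : ∀ d ≤ r, ∃ F : Submodule R L, F.FG ∧
      F ⊔ (lowerCentralSeries R L L d).toSubmodule = ⊤ := by
    intro d
    induction d with
    | zero => intro _; exact ⟨⊥, Submodule.fg_bot, by simp⟩
    | succ d ih =>
      intro h
      obtain ⟨F, hF, h2⟩ := ih (by omega)
      refine ⟨F ⊔ normedSpan R z d, hF.sup (fg_normedSpan z d), top_le_iff.1 ?_⟩
      rw [← h2, sup_assoc]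
      exact sup_le_sup le_rfl (lcs_le_normedSpan_sup hz d)
  obtain ⟨F, hF, h⟩ := key r le_rfl
  rw [hr] at h
  have : F = ⊤ := by simpa using h
  exact this ▸ hF

variable {n : ℕ}

theorem lie_mem_span_bracketEval (z : Fin n → L) {x y : L}
    (hx : x ∈ Submodule.span R (Set.range (bracketEval z)))
    (hy : y ∈ Submodule.span R (Set.range (bracketEval z))) :
    ⁅x, y⁆ ∈ Submodule.span R (Set.range (bracketEval z)) := by
  induction hx, hy using Submodule.span_induction₂ with
  | mem_mem x y hx hy =>
    obtain ⟨s, rfl⟩ := hx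
    obtain ⟨t, rfl⟩ := hy
    exact Submodule.subset_span ⟨s * t, rfl⟩
  | zero_left => simp
  | zero_right => simp
  | add_left x y w _ _ _ h1 h2 => rw [add_lie]; exact add_mem h1 h2
  | add_right x y w _ _ _ h1 h2 => rw [lie_add]; exact add_mem h1 h2
  | smul_left c x y _ _ h => rw [smul_lie]; exact Submodule.smul_mem _ c h
  | smul_right c x y _ _ h => rw [lie_smul]; exact Submodule.smul_mem _ c h

theorem span_bracketEval_eq_top {r : ℕ} {z : Fin n → L}
    (hr : lowerCentralSeries R L L r = ⊥)
    (hz : Submodule.span R (Set.range z) ⊔ (lowerCentralSeries R L L 1).toSubmodule = ⊤) :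
    Submodule.span R (Set.range (bracketEval z)) = ⊤ := by
  have := lieSubalgebra_eq_top hr hz
    { Submodule.span R (Set.range (bracketEval z)) with
      lie_mem' := fun hx hy => lie_mem_span_bracketEval z hx hy }
    (fun i => Submodule.subset_span ⟨FreeMagma.of i, rfl⟩)
  exact congrArg LieSubalgebra.toSubmodule this

theorem map_bracketEval {L' : Type*} [LieRing L'] [LieAlgebra R L'] (f : L →ₗ⁅R⁆ L')
    (z : Fin n → L) (t : FreeMagma (Fin n)) :
    f (bracketEval z t) = bracketEval (fun i => f (z i)) t := by
  induction t with
  | ih1 i => rfl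
  | ih2 s t hs ht =>
    change f ⁅bracketEval z s, bracketEval z t⁆ = _
    rw [LieHom.map_lie, hs, ht]
    rfl

/-- Rescaling the letters rescales an iterated bracket by the corresponding monomial. -/
theorem bracketEval_smul (a : Fin n → R) (z : Fin n → L) (t : FreeMagma (Fin n)) :
    bracketEval (fun i => a i • z i) t = (∏ j, a j ^ letterCount j t) • bracketEval z t := by
  induction t with
  | ih1 i =>
    change a i • z i = (∏ j, a j ^ (if i = j then 1 else 0)) • z i
    simp [Finset.prod_ite_eq]
  | ih2 s t hs ht =>
    change ⁅bracketEval _ s, bracketEval _ t⁆ =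
      (∏ j, a j ^ (letterCount j s + letterCount j t)) • ⁅bracketEval z s, bracketEval z t⁆
    rw [hs, ht, smul_lie, lie_smul, smul_smul]
    simp only [pow_add, Finset.prod_mul_distrib]

theorem letterCount_of (i j : Fin n) : letterCount j (FreeMagma.of i) = if i = j then 1 else 0 := rfl

theorem letterCount_mul (j : Fin n) (s t : FreeMagma (Fin n)) :
    letterCount j (s * t) = letterCount j s + letterCount j t := rfl

end Generators

/-! ### The free nilpotent Lie algebra over the rationals -/

section FreeNilQ

open LieModule

variable {n r : ℕ}

theorem freeLieAlgebra_span_sup_eq_top (n : ℕ) :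
    Submodule.span ℚ (Set.range (FreeLieAlgebra.of ℚ : Fin n → FreeLieAlgebra ℚ (Fin n))) ⊔
      (lowerCentralSeries ℚ (FreeLieAlgebra ℚ (Fin n)) (FreeLieAlgebra ℚ (Fin n)) 1).toSubmodule =
      ⊤ := by
  set E := Submodule.span ℚ (Set.range (FreeLieAlgebra.of ℚ : Fin n → FreeLieAlgebra ℚ (Fin n))) ⊔
      (lowerCentralSeries ℚ (FreeLieAlgebra ℚ (Fin n)) (FreeLieAlgebra ℚ (Fin n)) 1).toSubmodule
    with hE
  let H : LieSubalgebra ℚ (FreeLieAlgebra ℚ (Fin n)) :=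
    { E with
      lie_mem' := fun {x y} _ _ => Submodule.mem_sup_right <| by
        rw [lowerCentralSeries_succ]
        exact LieSubmodule.lie_mem_lie (LieSubmodule.mem_top x) (LieSubmodule.mem_top y) }
  have hof : ∀ i, FreeLieAlgebra.of ℚ i ∈ H := fun i =>
    Submodule.mem_sup_left (Submodule.subset_span ⟨i, rfl⟩)
  let F : FreeLieAlgebra ℚ (Fin n) →ₗ⁅ℚ⁆ H :=
    FreeLieAlgebra.lift ℚ fun i => ⟨FreeLieAlgebra.of ℚ i, hof i⟩
  have hF : H.incl.comp F = LieHom.id := by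
    refine FreeLieAlgebra.hom_ext fun i => ?_
    simp [F]
  rw [eq_top_iff]
  intro x _
  have : (F x : FreeLieAlgebra ℚ (Fin n)) = x := congrArg (fun f => f x) hF
  exact this ▸ (F x).2

/-- The projection from the free Lie algebra, as a homomorphism of Lie algebras. -/
def freeProj (n r : ℕ) : FreeLieAlgebra ℚ (Fin n) →ₗ⁅ℚ⁆ FreeNilQ n r :=
  { LieSubmodule.Quotient.mk' (freeTail n r) with
    map_lie' := fun {_ _} => rfl }

theorem freeProj_of (i : Fin n) : freeProj n r (FreeLieAlgebra.of ℚ i) = genQ n r i := rfl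

theorem freeProj_surjective : Function.Surjective (freeProj n r) :=
  LieSubmodule.Quotient.surjective_mk' _

theorem freeProj_eq_zero {x : FreeLieAlgebra ℚ (Fin n)} : freeProj n r x = 0 ↔ x ∈ freeTail n r :=
  LieSubmodule.Quotient.mk_eq_zero'

theorem lcs_freeNilQ : lowerCentralSeries ℚ (FreeNilQ n r) (FreeNilQ n r) r = ⊥ := by
  rw [← LieIdeal.lowerCentralSeries_map_eq r (freeProj_surjective (n := n) (r := r)), eq_bot_iff,
    LieIdeal.map_le_iff_le_comap]
  intro x hx
  rw [LieIdeal.mem_comap, LieSubmodule.mem_bot]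
  exact freeProj_eq_zero.2 hx

theorem span_genQ_sup : Submodule.span ℚ (Set.range (genQ n r)) ⊔
    (lowerCentralSeries ℚ (FreeNilQ n r) (FreeNilQ n r) 1).toSubmodule = ⊤ := by
  have h := congrArg (Submodule.map (freeProj n r : FreeLieAlgebra ℚ (Fin n) →ₗ[ℚ] FreeNilQ n r))
    (freeLieAlgebra_span_sup_eq_top n)
  rw [Submodule.map_top, LinearMap.range_eq_top.2 freeProj_surjective, Submodule.map_sup,
    Submodule.map_span, ← Set.range_comp] at h
  rw [eq_top_iff, ← h]
  refine sup_le_sup le_rfl ?_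
  rintro _ ⟨x, hx, rfl⟩
  exact LieIdeal.map_lowerCentralSeries_le 1 (LieIdeal.mem_map hx)

instance : Module.Finite ℚ (FreeNilQ n r) := finite_of_generators lcs_freeNilQ span_genQ_sup

/-- The homomorphism from the free `r`-step nilpotent Lie algebra with given values on the
generators. -/
def freeNilLift {N : Type*} [LieRing N] [LieAlgebra ℚ N] (hN : lowerCentralSeries ℚ N N r = ⊥)
    (v : Fin n → N) : FreeNilQ n r →ₗ⁅ℚ⁆ N :=
  { (freeTail n r).toSubmodule.liftQ (FreeLieAlgebra.lift ℚ v : FreeLieAlgebra ℚ (Fin n) →ₗ[ℚ] N)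
      (by
        intro x hx
        have := LieIdeal.map_lowerCentralSeries_le r
          (LieIdeal.mem_map (f := FreeLieAlgebra.lift ℚ v) hx)
        rw [hN] at this
        exact (LieSubmodule.mem_bot _).1 this) with
    map_lie' := by
      intro x y
      obtain ⟨x, rfl⟩ := freeProj_surjective x
      obtain ⟨y, rfl⟩ := freeProj_surjective y
      exact LieHom.map_lie (FreeLieAlgebra.lift ℚ v) x y }

theorem freeNilLift_genQ {N : Type*} [LieRing N] [LieAlgebra ℚ N]
    (hN : lowerCentralSeries ℚ N N r = ⊥) (v : Fin n → N) (i : Fin n) :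
    freeNilLift hN v (genQ n r i) = v i :=
  FreeLieAlgebra.lift_of_apply v i

theorem freeNilQ_hom_ext {N : Type*} [LieRing N] [LieAlgebra ℚ N] {f g : FreeNilQ n r →ₗ⁅ℚ⁆ N}
    (h : ∀ i, f (genQ n r i) = g (genQ n r i)) : f = g := by
  have : f.comp (freeProj n r) = g.comp (freeProj n r) := FreeLieAlgebra.hom_ext h
  ext x
  obtain ⟨x, rfl⟩ := freeProj_surjective x
  exact congrArg (fun f => f x) this

/-- The map `matEndQ` as a homomorphism of Lie algebras. -/
def matHomQ (r : ℕ) (A : Matrix (Fin n) (Fin n) ℤ) : FreeNilQ n r →ₗ⁅ℚ⁆ FreeNilQ n r :=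
  { matEndQ r A with
    map_lie' := by
      intro x y
      obtain ⟨x, rfl⟩ := freeProj_surjective x
      obtain ⟨y, rfl⟩ := freeProj_surjective y
      exact congrArg (freeProj n r) (LieHom.map_lie
        (FreeLieAlgebra.lift ℚ fun j => ∑ i, (A i j : ℚ) • FreeLieAlgebra.of ℚ i) x y) }

theorem matHomQ_apply (A : Matrix (Fin n) (Fin n) ℤ) (x : FreeNilQ n r) :
    matHomQ r A x = matEndQ r A x := rfl

theorem matEndQ_genQ (A : Matrix (Fin n) (Fin n) ℤ) (j : Fin n) :
    matEndQ r A (genQ n r j) = ∑ i, (A i j : ℚ) • genQ n r i := by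
  have h : matEndQ r A (genQ n r j) = freeProj n r ((FreeLieAlgebra.lift ℚ fun j =>
      ∑ i, (A i j : ℚ) • FreeLieAlgebra.of ℚ i) (FreeLieAlgebra.of ℚ j)) := rfl
  rw [h, FreeLieAlgebra.lift_of_apply, map_sum]
  simp only [map_smul, freeProj_of]

end FreeNilQ

/-! ### Extension of scalars of subspaces -/

section BaseChange

variable {K V : Type*} [Field K] [Algebra ℚ K] [AddCommGroup V] [Module ℚ V]

theorem ker_baseChange {V' : Type*} [AddCommGroup V'] [Module ℚ V'] (f : V →ₗ[ℚ] V') :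
    LinearMap.ker (f.baseChange K) = (LinearMap.ker f).baseChange K :=
  Module.Flat.ker_lTensor_eq K K f

theorem one_tmul_mem_baseChange {U : Submodule ℚ V} {v : V} :
    (1 : K) ⊗ₜ[ℚ] v ∈ U.baseChange K ↔ v ∈ U := by
  refine ⟨fun h => ?_, fun h => Submodule.tmul_mem_baseChange_of_mem 1 h⟩
  by_contra hv
  obtain ⟨f, hf, hU⟩ := Submodule.exists_le_ker_of_notMem hv
  have h1 := Submodule.baseChange_mono K hU h
  rw [← ker_baseChange, LinearMap.mem_ker, LinearMap.baseChange_tmul] at h1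
  have h2 := congrArg (TensorProduct.rid ℚ K) h1
  rw [TensorProduct.rid_tmul, map_zero] at h2
  rcases smul_eq_zero.1 h2 with h3 | h3
  · exact hf h3
  · exact one_ne_zero h3

theorem one_tmul_injective : Function.Injective fun v : V => (1 : K) ⊗ₜ[ℚ] v := by
  intro v w h
  have : (1 : K) ⊗ₜ[ℚ] (v - w) ∈ (⊥ : Submodule ℚ V).baseChange K := by
    rw [TensorProduct.tmul_sub, sub_eq_zero.2 h]; exact zero_mem _
  exact sub_eq_zero.1 ((Submodule.mem_bot ℚ).1 (one_tmul_mem_baseChange.1 this))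

theorem baseChange_le_iff {U : Submodule ℚ V} {E : Submodule K (K ⊗[ℚ] V)} :
    U.baseChange K ≤ E ↔ ∀ v ∈ U, (1 : K) ⊗ₜ[ℚ] v ∈ E := by
  rw [Submodule.baseChange_eq_span, Submodule.span_le]
  exact ⟨fun h v hv => h ⟨v, hv, rfl⟩, fun h => by rintro _ ⟨v, hv, rfl⟩; exact h v hv⟩

theorem baseChange_le_baseChange {U U' : Submodule ℚ V} :
    U.baseChange K ≤ U'.baseChange K ↔ U ≤ U' :=
  baseChange_le_iff.trans (forall₂_congr fun _ _ => one_tmul_mem_baseChange)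

theorem baseChange_iSup {ι : Sort*} (U : ι → Submodule ℚ V) :
    (⨆ i, U i).baseChange K = ⨆ i, (U i).baseChange K := by
  refine le_antisymm (baseChange_le_iff.2 fun v hv => ?_)
    (iSup_le fun i => Submodule.baseChange_mono K (le_iSup U i))
  have : (⨆ i, U i) ≤ ((⨆ i, (U i).baseChange K).restrictScalars ℚ).comap
      (TensorProduct.mk ℚ K V 1) :=
    iSup_le fun i x hx => Submodule.mem_iSup_of_mem (p := fun i => (U i).baseChange K) i
      (Submodule.tmul_mem_baseChange_of_mem 1 hx)
  exact this hv

theorem baseChange_sup (U U' : Submodule ℚ V) :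
    (U ⊔ U').baseChange K = U.baseChange K ⊔ U'.baseChange K := by
  rw [sup_eq_iSup, sup_eq_iSup, baseChange_iSup]
  exact iSup_congr fun b => by cases b <;> rfl

theorem finrank_submodule_baseChange (U : Submodule ℚ V) :
    Module.finrank K (U.baseChange K) = Module.finrank ℚ U := by
  have hinj : Function.Injective (U.subtype.baseChange K) := by
    rw [← LinearMap.ker_eq_bot, ker_baseChange, Submodule.ker_subtype, Submodule.baseChange_bot]
  rw [Submodule.baseChange, LinearMap.finrank_range_of_inj hinj, Module.finrank_baseChange]

end BaseChange

/-! ### The Galois action and Galois descent -/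

section Galois

variable {n r : ℕ} {K : Type*} [Field K] [Algebra ℚ K]

theorem galAct_tmul (g : K ≃ₐ[ℚ] K) (c : K) (v : FreeNilQ n r) :
    galAct g (c ⊗ₜ[ℚ] v) = (g c) ⊗ₜ[ℚ] v := rfl

theorem galAct_smul (g : K ≃ₐ[ℚ] K) (c : K) (x : FreeNil K n r) :
    galAct g (c • x) = g c • galAct g x := by
  induction x using TensorProduct.induction_on with
  | zero => simp
  | tmul a v => simp [TensorProduct.smul_tmul', galAct_tmul]
  | add x y hx hy => rw [smul_add, map_add, hx, hy, map_add, smul_add]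

theorem galAct_mul (g h : K ≃ₐ[ℚ] K) (x : FreeNil K n r) :
    galAct (g * h) x = galAct g (galAct h x) := by
  induction x using TensorProduct.induction_on with
  | zero => simp
  | tmul a v => simp [galAct_tmul]
  | add x y hx hy => simp only [map_add, hx, hy]

theorem galAct_one (x : FreeNil K n r) : galAct (1 : K ≃ₐ[ℚ] K) x = x := by
  induction x using TensorProduct.induction_on with
  | zero => simp
  | tmul a v => simp [galAct_tmul]
  | add x y hx hy => simp only [map_add, hx, hy]

theorem galAct_lie (g : K ≃ₐ[ℚ] K) (x y : FreeNil K n r) :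
    galAct g ⁅x, y⁆ = ⁅galAct g x, galAct g y⁆ :=
  LieHom.map_lie (LieAlgebra.ExtendScalars.map g.toAlgHom (LieHom.id : FreeNilQ n r →ₗ⁅ℚ⁆ _)) x y

theorem galAct_gen (g : K ≃ₐ[ℚ] K) (i : Fin n) : galAct g (gen K n r i) = gen K n r i := by
  rw [gen, galAct_tmul, map_one]

theorem galAct_baseChange (g : K ≃ₐ[ℚ] K) (f : FreeNilQ n r →ₗ[ℚ] FreeNilQ n r)
    (x : FreeNil K n r) : galAct g (f.baseChange K x) = f.baseChange K (galAct g x) := by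
  induction x using TensorProduct.induction_on with
  | zero => simp
  | tmul a v => simp [galAct_tmul]
  | add x y hx hy => simp only [map_add, hx, hy]

theorem galAct_bracketEval (g : K ≃ₐ[ℚ] K) (z : Fin n → FreeNil K n r) (t : FreeMagma (Fin n)) :
    galAct g (bracketEval z t) = bracketEval (fun i => galAct g (z i)) t := by
  induction t with
  | ih1 i => rfl
  | ih2 s t hs ht =>
    change galAct g ⁅bracketEval z s, bracketEval z t⁆ = _
    rw [galAct_lie, hs, ht]
    rfl

theorem galAct_mem_span {g : K ≃ₐ[ℚ] K} {S : Set (FreeNil K n r)} {E : Submodule K (FreeNil K n r)}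
    (h : ∀ s ∈ S, galAct g s ∈ E) {x : FreeNil K n r} (hx : x ∈ Submodule.span K S) :
    galAct g x ∈ E := by
  induction hx using Submodule.span_induction with
  | mem x hx => exact h x hx
  | zero => simp
  | add x y _ _ hx hy => rw [map_add]; exact add_mem hx hy
  | smul c x _ hx => rw [galAct_smul]; exact E.smul_mem _ hx

theorem mem_orbitSpan (w : FreeNil K n r) : w ∈ orbitSpan w :=
  Submodule.subset_span ⟨1, galAct_one w⟩

theorem galAct_mem_orbitSpan (g : K ≃ₐ[ℚ] K) {w x : FreeNil K n r} (hx : x ∈ orbitSpan w) :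
    galAct g x ∈ orbitSpan w := by
  refine galAct_mem_span ?_ hx
  rintro _ ⟨h, rfl⟩
  exact Submodule.subset_span ⟨g * h, galAct_mul g h w⟩

theorem galAct_mem_baseChange (g : K ≃ₐ[ℚ] K) {U : Submodule ℚ (FreeNilQ n r)} {x : FreeNil K n r}
    (hx : x ∈ U.baseChange K) : galAct g x ∈ U.baseChange K := by
  rw [Submodule.baseChange_eq_span] at hx
  refine galAct_mem_span ?_ hx
  rintro _ ⟨u, hu, rfl⟩
  rw [TensorProduct.mk_apply, galAct_tmul, map_one]
  exact Submodule.tmul_mem_baseChange_of_mem 1 hu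

theorem orbitSpan_le {w : FreeNil K n r} {E : Submodule K (FreeNil K n r)}
    (hE : ∀ (g : K ≃ₐ[ℚ] K), ∀ x ∈ E, galAct g x ∈ E) (hw : w ∈ E) : orbitSpan w ≤ E := by
  rw [orbitSpan, Submodule.span_le]
  rintro _ ⟨g, rfl⟩
  exact hE g w hw

theorem mem_ratPart {E : Submodule K (FreeNil K n r)} {v : FreeNilQ n r} :
    v ∈ ratPart E ↔ (1 : K) ⊗ₜ[ℚ] v ∈ E := Iff.rfl

theorem ratPart_baseChange (U : Submodule ℚ (FreeNilQ n r)) : ratPart (U.baseChange K) = U := by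
  ext v
  exact one_tmul_mem_baseChange

theorem ratPart_mono {E E' : Submodule K (FreeNil K n r)} (h : E ≤ E') : ratPart E ≤ ratPart E' :=
  fun _ hv => h hv

theorem baseChange_ratPart_le (E : Submodule K (FreeNil K n r)) : (ratPart E).baseChange K ≤ E :=
  baseChange_le_iff.2 fun _ hv => hv

variable [FiniteDimensional ℚ K] [IsGalois ℚ K]

theorem exists_one_tmul_of_galAct_fixed {x : FreeNil K n r} (hx : ∀ g : K ≃ₐ[ℚ] K, galAct g x = x) :
    ∃ v : FreeNilQ n r, (1 : K) ⊗ₜ[ℚ] v = x := by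
  let b := Module.finBasis ℚ (FreeNilQ n r)
  let B := b.baseChange K
  have hrepr : ∀ (g : K ≃ₐ[ℚ] K) (y : FreeNil K n r) i, B.repr (galAct g y) i = g (B.repr y i) := by
    intro g y i
    induction y using TensorProduct.induction_on with
    | zero => simp
    | tmul a v =>
      rw [galAct_tmul, Module.Basis.baseChange_repr_tmul, Module.Basis.baseChange_repr_tmul,
        map_smul]
    | add y y' hy hy' => simp only [map_add, Finsupp.add_apply, hy, hy']
  have hrat : ∀ i, ∃ q : ℚ, algebraMap ℚ K q = B.repr x i := fun i =>
    (IsGalois.mem_range_algebraMap_iff_fixed (B.repr x i)).2 fun g => by rw [← hrepr, hx g]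
  choose q hq using hrat
  refine ⟨∑ i, q i • b i, ?_⟩
  rw [← B.sum_repr x, TensorProduct.tmul_sum]
  refine Finset.sum_congr rfl fun i _ => ?_
  rw [← hq, Module.Basis.baseChange_apply, TensorProduct.tmul_smul, algebraMap_smul]

/-- Galois descent: a subspace stable under the Galois action is spanned by its rational points.
By Dedekind's independence of characters, `x` is a `K`-combination of the traces
`∑ g, galAct g (c • x)`, which are rational. -/
theorem isRational_of_galAct_mem {E : Submodule K (FreeNil K n r)}
    (hE : ∀ (g : K ≃ₐ[ℚ] K), ∀ x ∈ E, galAct g x ∈ E) : IsRational E := by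
  classical
  refine le_antisymm (baseChange_ratPart_le E) fun x hx => ?_
  have htop : Submodule.span K (Set.range fun (c : K) (g : K ≃ₐ[ℚ] K) => g c) = ⊤ := by
    by_contra h
    obtain ⟨f, hf0, hf⟩ := Submodule.exists_le_ker_of_lt_top _ (lt_top_iff_ne_top.2 h)
    have hli : LinearIndependent K fun (g : K ≃ₐ[ℚ] K) => (g : K → K) :=
      (linearIndependent_monoidHom K K).comp (fun g : K ≃ₐ[ℚ] K => ((g : K →* K)))
        fun g g' hgg => by
          ext c; exact DFunLike.congr_fun hgg c
    have hfs : ∀ v : (K ≃ₐ[ℚ] K) → K, f v = ∑ g, v g * f (Pi.single g 1) := by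
      intro v
      conv_lhs => rw [pi_eq_sum_univ' v]
      rw [map_sum]
      refine Finset.sum_congr rfl fun g _ => ?_
      rw [map_smul, smul_eq_mul]
    have h0 : ∑ g : K ≃ₐ[ℚ] K, f (Pi.single g 1) • (g : K → K) = 0 := by
      funext c
      have := hf (Submodule.subset_span ⟨c, rfl⟩)
      rw [LinearMap.mem_ker, hfs] at this
      simpa [Finset.sum_apply, mul_comm] using this
    have h1 := Fintype.linearIndependent_iff.1 hli _ h0
    apply hf0
    ext v
    simpa using h1 v
  have key : ∀ a ∈ Submodule.span K (Set.range fun (c : K) (g : K ≃ₐ[ℚ] K) => g c),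
      ∑ g, a g • galAct g x ∈ (ratPart E).baseChange K := by
    intro a ha
    induction ha using Submodule.span_induction with
    | mem a ha =>
      obtain ⟨c, rfl⟩ := ha
      have hfix : ∀ h : K ≃ₐ[ℚ] K, galAct h (∑ g : K ≃ₐ[ℚ] K, g c • galAct g x) =
          ∑ g : K ≃ₐ[ℚ] K, g c • galAct g x := by
        intro h
        rw [map_sum, ← Equiv.sum_comp (Equiv.mulLeft h) fun g : K ≃ₐ[ℚ] K => g c • galAct g x]
        refine Finset.sum_congr rfl fun g _ => ?_
        rw [galAct_smul, Equiv.coe_mulLeft, galAct_mul]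
        rfl
      obtain ⟨v, hv⟩ := exists_one_tmul_of_galAct_fixed hfix
      rw [← hv]
      refine Submodule.tmul_mem_baseChange_of_mem 1 (mem_ratPart.2 ?_)
      rw [hv]
      exact sum_mem fun g _ => E.smul_mem _ (hE g x hx)
    | zero => simp
    | add a b _ _ ha hb =>
      simp only [Pi.add_apply, add_smul, Finset.sum_add_distrib]
      exact add_mem ha hb
    | smul c a _ ha =>
      simp only [Pi.smul_apply, smul_assoc, ← Finset.smul_sum]
      exact Submodule.smul_mem _ c ha
  have := key (Pi.single 1 1) (htop ▸ Submodule.mem_top)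
  rw [Finset.sum_eq_single 1] at this
  · simpa [galAct_one] using this
  · intro g _ hg; simp [hg]
  · simp

theorem isRational_orbitSpan (w : FreeNil K n r) : IsRational (orbitSpan w) :=
  isRational_of_galAct_mem fun g _ hx => galAct_mem_orbitSpan g hx

end Galois

/-! ### Invariant subspaces of diagonalizable endomorphisms -/

/-- An invariant subspace contains the eigencomponents of its elements: these are the values at `f` of
Lagrange interpolation polynomials. The `v i` may vanish or coincide; only the labels `c i` are used
to sort them. -/
theorem mem_iSup_inf_span {K V ι : Type*} [Field K] [AddCommGroup V] [Module K V]
    {f : Module.End K V} {v : ι → V} {c : ι → K} (hv : ∀ i, f (v i) = c i • v i)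
    {J : Submodule K V} (hJ : ∀ x ∈ J, f x ∈ J) {x : V} (hxJ : x ∈ J)
    (hx : x ∈ Submodule.span K (Set.range v)) :
    x ∈ ⨆ μ : K, J ⊓ Submodule.span K (v '' {i | c i = μ}) := by
  classical
  have hle : Submodule.span K (Set.range v) ≤ ⨆ μ : K, Submodule.span K (v '' {i | c i = μ}) := by
    rw [Submodule.span_le]
    rintro _ ⟨i, rfl⟩
    exact Submodule.mem_iSup_of_mem (p := fun μ => Submodule.span K (v '' {i | c i = μ})) (c i)
      (Submodule.subset_span ⟨i, rfl, rfl⟩)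
  obtain ⟨g, hg⟩ := (Submodule.mem_iSup_iff_exists_dfinsupp' _ _).1 (hle hx)
  have heig : ∀ (μ : K) (y : V), y ∈ Submodule.span K (v '' {i | c i = μ}) → f y = μ • y := by
    intro μ y hy
    induction hy using Submodule.span_induction with
    | mem y hy => obtain ⟨i, rfl, rfl⟩ := hy; exact hv i
    | zero => simp
    | add y y' _ _ h h' => rw [map_add, h, h', smul_add]
    | smul a y _ h => rw [map_smul, h, smul_comm]
  have hpoly : ∀ P : K[X], aeval f P x ∈ J := by
    intro P
    induction P using Polynomial.induction_on' with
    | add P Q hP hQ => rw [map_add, LinearMap.add_apply]; exact add_mem hP hQ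
    | monomial k a =>
      rw [aeval_monomial, Module.End.mul_apply, Module.algebraMap_end_apply]
      refine J.smul_mem _ ?_
      induction k with
      | zero => simpa using hxJ
      | succ k ih => rw [pow_succ', Module.End.mul_apply]; exact hJ _ ih
  have hcomp : ∀ μ, (g μ : V) ∈ J := by
    intro μ
    by_cases hμ : μ ∈ g.support
    · have h1 := hpoly (Lagrange.basis g.support id μ)
      rw [← hg, DFinsupp.sum, map_sum, Finset.sum_eq_single μ] at h1
      · have h2 := Lagrange.eval_basis_self (s := g.support) (v := (id : K → K))
          Function.injective_id.injOn hμ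
        rw [id] at h2
        rwa [Module.End.aeval_apply_of_mem_apply_eq_smul (heig μ _ (g μ).2), h2, one_smul] at h1
      · intro ν hν hne
        have h2 := Lagrange.eval_basis_of_ne (s := g.support) (v := (id : K → K)) hne.symm hν
        rw [id] at h2
        rw [Module.End.aeval_apply_of_mem_apply_eq_smul (heig ν _ (g ν).2), h2, zero_smul]
      · intro h; exact absurd hμ h
    · rw [DFinsupp.notMem_support_iff.1 hμ]; exact J.zero_mem
  rw [← hg]
  exact sum_mem fun μ _ => Submodule.mem_iSup_of_mem
    (p := fun μ => J ⊓ Submodule.span K (v '' {i | c i = μ})) μ ⟨hcomp μ, (g μ).2⟩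

/-! ### Multiplicative relations between conjugate units -/

section Relations

/-- The endomorphism of the `ℤ`-module `Kˣ` (written additively) given by a field automorphism. -/
def unitsEnd {K : Type*} [Field K] [Algebra ℚ K] (σ : K ≃ₐ[ℚ] K) :
    Module.End ℤ (Additive Kˣ) :=
  (MonoidHom.toAdditive (Units.map (σ : K →* K))).toIntLinearMap

theorem unitsEnd_ofMul {K : Type*} [Field K] [Algebra ℚ K] (σ : K ≃ₐ[ℚ] K) (u : Kˣ) :
    unitsEnd σ (Additive.ofMul u) = Additive.ofMul (Units.map (σ : K →* K) u) := rfl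

/-- For prime `n`, a nonconstant integer vector generates, together with `∑ X ^ k`, an ideal of
`ℤ[X]` which contains a positive integer, because the cyclotomic polynomial is irreducible. -/
theorem exists_combination_eq_int {n : ℕ} (hn : n.Prime) (e : Fin n → ℤ) {i j : Fin n}
    (hij : e i ≠ e j) : ∃ (N : ℤ) (u v : ℤ[X]), N ≠ 0 ∧
      u * (∑ k, C (e k) * X ^ (k : ℕ)) + v * (∑ k ∈ Finset.range n, X ^ k) = C N := by
  have := Fact.mk hn
  set E : ℤ[X] := ∑ k, C (e k) * X ^ (k : ℕ) with hE
  have hEcoeff : ∀ k : Fin n, E.coeff k = e k := by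
    intro k
    simp only [hE, finsetSum_coeff, coeff_C_mul, coeff_X_pow]
    simp [Fin.val_inj]
  have hEdeg : E.natDegree ≤ n - 1 := by
    refine natDegree_sum_le_of_forall_le _ _ fun k _ => ?_
    exact (natDegree_C_mul_X_pow_le _ _).trans (by omega)
  have hirr : Irreducible (cyclotomic n ℚ) := cyclotomic.irreducible_rat hn.pos
  -- For reasons of degree only constant multiples of the cyclotomic polynomial could occur.
  have hnd : ¬ cyclotomic n ℚ ∣ E.map (Int.castRingHom ℚ) := by
    rintro ⟨q, hq⟩
    have hE0 : E.map (Int.castRingHom ℚ) ≠ 0 := by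
      intro h0
      have h1 : E = 0 := (Polynomial.map_eq_zero_iff Int.cast_injective).1 h0
      apply hij
      rw [← hEcoeff, ← hEcoeff, h1]; simp
    have hq0 : q ≠ 0 := by rintro rfl; exact hE0 (by rw [hq, mul_zero])
    have hdeg : q.natDegree = 0 := by
      have h1 := congrArg natDegree hq
      rw [natDegree_mul (cyclotomic_ne_zero n ℚ) hq0, natDegree_cyclotomic,
        Nat.totient_prime hn] at h1
      have h2 := natDegree_map_le (f := Int.castRingHom ℚ) (p := E)
      omega
    rw [eq_C_of_natDegree_eq_zero hdeg, cyclotomic_prime] at hq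
    have hc : ∀ k : Fin n, (e k : ℚ) = q.coeff 0 := by
      intro k
      have := congrArg (fun P => coeff P (k : ℕ)) hq
      simp only [coeff_map, hEcoeff, coeff_mul_C, finsetSum_coeff, coeff_X_pow] at this
      simpa using this
    apply hij
    exact_mod_cast (hc i).trans (hc j).symm
  obtain ⟨v, u, h⟩ := (hirr.coprime_iff_not_dvd).2 hnd
  obtain ⟨b, hb0, hb⟩ := IsLocalization.integerNormalization_spec (nonZeroDivisors ℤ) u
  obtain ⟨d, hd0, hd⟩ := IsLocalization.integerNormalization_spec (nonZeroDivisors ℤ) v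
  set u' := IsLocalization.integerNormalization (nonZeroDivisors ℤ) u
  set v' := IsLocalization.integerNormalization (nonZeroDivisors ℤ) v
  refine ⟨b * d, C d * u', C b * v',
    mul_ne_zero (nonZeroDivisors.ne_zero hb0) (nonZeroDivisors.ne_zero hd0), ?_⟩
  apply Polynomial.map_injective (Int.castRingHom ℚ) Int.cast_injective
  have hb' : u'.map (Int.castRingHom ℚ) = C (b : ℚ) * u := by
    have : Int.castRingHom ℚ = algebraMap ℤ ℚ := rfl
    rw [this, hb, ← smul_eq_C_mul]
    ext k; simp
  have hd' : v'.map (Int.castRingHom ℚ) = C (d : ℚ) * v := by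
    have : Int.castRingHom ℚ = algebraMap ℤ ℚ := rfl
    rw [this, hd, ← smul_eq_C_mul]
    ext k; simp
  have hcyc : (∑ k ∈ Finset.range n, X ^ k : ℤ[X]).map (Int.castRingHom ℚ) = cyclotomic n ℚ := by
    rw [cyclotomic_prime, Polynomial.map_sum]
    simp
  simp only [Polynomial.map_add, Polynomial.map_mul, map_C, hb', hd', hcyc]
  simp only [eq_intCast, Int.cast_mul, C_mul]
  linear_combination (C (b : ℚ) * C (d : ℚ)) * h

theorem iterate_finRotate {n : ℕ} {X : Type*} (s : X → X) (α : Fin n → X)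
    (h : ∀ j, s (α j) = α (finRotate n j)) (hn : 0 < n) (j : Fin n) :
    α j = s^[j] (α ⟨0, hn⟩) := by
  obtain ⟨m, rfl⟩ : ∃ m, n = m + 1 := ⟨n - 1, by omega⟩
  obtain ⟨k, hk⟩ := j
  induction k with
  | zero => rfl
  | succ k ih =>
    have hk' : k < m + 1 := by omega
    rw [Function.iterate_succ_apply', ← ih hk', h, finRotate_of_lt (by omega)]

theorem pow_natAbs_eq {K : Type*} [Field K] {x y : K} {N : ℤ} (h : x ^ N = y ^ N) :
    x ^ N.natAbs = y ^ N.natAbs := by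
  obtain ⟨m, rfl | rfl⟩ := Int.eq_nat_or_neg N
  · simpa using h
  · simpa using h

/-- For prime `n`, a multiplicative relation with nonconstant exponents between the cyclic conjugates
of `α` forces some powers of them to agree: in the `ℤ[X]`-module `Kˣ`, where `X` acts by `σ`, the
element `α` is killed by `X ^ n - 1` and by the exponent polynomial, hence by a multiple of `X - 1`. -/
theorem pow_eq_pow_of_cyclic {n : ℕ} (hn : n.Prime) {K : Type*} [Field K] [Algebra ℚ K]
    (σ : K ≃ₐ[ℚ] K) (hσ : σ ^ n = 1) (α : Fin n → K) (hα0 : ∀ j, α j ≠ 0)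
    (hα : ∀ j, σ (α j) = α (finRotate n j)) (e : Fin n → ℤ) (he : ∏ j, α j ^ e j = 1)
    {i j : Fin n} (hij : e i ≠ e j) : ∃ N : ℕ, 0 < N ∧ ∀ k l, α k ^ N = α l ^ N := by
  obtain ⟨N, u, v, hN, huv⟩ := exists_combination_eq_int hn e hij
  let o : Fin n := ⟨0, hn.pos⟩
  let a : Kˣ := Units.mk0 (α o) (hα0 o)
  let τ := unitsEnd σ
  have hτ : ∀ k : ℕ, (τ ^ k) (Additive.ofMul a) =
      Additive.ofMul (Units.map ((σ ^ k : K ≃ₐ[ℚ] K) : K →* K) a) := by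
    intro k
    induction k with
    | zero => ext; rfl
    | succ k ih =>
      rw [pow_succ', Module.End.mul_apply, ih, unitsEnd_ofMul, pow_succ']
      rfl
  have hpow : ∀ j : Fin n, α j = (σ ^ (j : ℕ)) (α o) := by
    intro j
    rw [iterate_finRotate σ α hα hn.pos j, AlgEquiv.coe_pow]
  have h1 : aeval τ (∑ k, C (e k) * X ^ (k : ℕ)) (Additive.ofMul a) = 0 := by
    rw [map_sum, LinearMap.sum_apply]
    have : ∀ k : Fin n, aeval τ (C (e k) * X ^ (k : ℕ)) (Additive.ofMul a) =
        Additive.ofMul ((Units.mk0 (α k) (hα0 k)) ^ e k) := by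
      intro k
      rw [map_mul, aeval_C, map_pow, aeval_X, Module.End.mul_apply, hτ, Module.algebraMap_end_apply,
        ofMul_zpow]
      congr 2
      ext
      exact (hpow k).symm
    rw [Finset.sum_congr rfl fun k _ => this k, ← ofMul_prod, ofMul_eq_zero]
    ext
    rw [Units.coe_prod, Units.val_one, ← he]
    exact Finset.prod_congr rfl fun k _ => by simp
  have h2 : aeval τ (X ^ n - 1 : ℤ[X]) (Additive.ofMul a) = 0 := by
    rw [map_sub, map_pow, aeval_X, map_one, LinearMap.sub_apply, hτ, hσ]
    exact sub_self _
  have h3 : aeval τ (C N * (X - 1)) (Additive.ofMul a) = 0 := by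
    have : C N * (X - 1 : ℤ[X]) = ((X - 1) * u) * (∑ k, C (e k) * X ^ (k : ℕ)) +
        v * (X ^ n - 1) := by
      rw [← huv, ← mul_geom_sum]
      ring
    rw [this, map_add, map_mul, map_mul (aeval τ) v, LinearMap.add_apply, Module.End.mul_apply,
      Module.End.mul_apply, h1, h2, map_zero, map_zero, add_zero]
  have h4 : σ (α o) ^ N = α o ^ N := by
    rw [map_mul, aeval_C, map_sub, aeval_X, map_one, Module.End.mul_apply,
      Module.algebraMap_end_apply, LinearMap.sub_apply, Module.End.one_apply, smul_sub,
      sub_eq_zero, unitsEnd_ofMul, ← ofMul_zpow, ← ofMul_zpow] at h3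
    have := congrArg Units.val (Additive.ofMul.injective h3)
    simpa [a] using this
  have h5 : σ (α o ^ N.natAbs) = α o ^ N.natAbs := by
    rw [map_pow]
    exact pow_natAbs_eq h4
  have h6 : ∀ k, α k ^ N.natAbs = α o ^ N.natAbs := by
    intro k
    rw [hpow k, ← map_pow]
    generalize (k : ℕ) = m
    induction m with
    | zero => rfl
    | succ m ih => rw [pow_succ, AlgEquiv.mul_apply, h5, ih]
  exact ⟨N.natAbs, Int.natAbs_pos.2 hN, fun k l => (h6 k).trans (h6 l).symm⟩

/-- A relation, divided by its image under the transposition of `i` and `j`, says that `α i / α j` is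
a root of unity. -/
theorem pow_eq_pow_of_symmetric {n : ℕ} {K : Type*} [Field K] [Algebra ℚ K] (α : Fin n → K)
    (hα0 : ∀ j, α j ≠ 0)
    (hα : ∀ π : Equiv.Perm (Fin n), ∃ g : K ≃ₐ[ℚ] K, ∀ j, g (α j) = α (π j))
    (e : Fin n → ℤ) (he : ∏ j, α j ^ e j = 1) {i j : Fin n} (hij : e i ≠ e j) :
    ∃ N : ℕ, 0 < N ∧ ∀ k l, α k ^ N = α l ^ N := by
  have hne : i ≠ j := fun h => hij (h ▸ rfl)
  obtain ⟨g, hg⟩ := hα (Equiv.swap i j)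
  have h1 : ∏ k, α (Equiv.swap i j k) ^ e k = 1 := by
    have := congrArg g he
    rw [map_prod, map_one] at this
    rw [← this]
    exact Finset.prod_congr rfl fun k _ => by rw [map_zpow₀, hg]
  have h2 : α i ^ (e i - e j) = α j ^ (e i - e j) := by
    have hrest : ∏ k ∈ (Finset.univ.erase i).erase j, α (Equiv.swap i j k) ^ e k =
        ∏ k ∈ (Finset.univ.erase i).erase j, α k ^ e k := by
      refine Finset.prod_congr rfl fun k hk => ?_
      simp only [Finset.mem_erase, Finset.mem_univ, and_true] at hk
      rw [Equiv.swap_apply_of_ne_of_ne hk.2 hk.1]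
    have hj : j ∈ Finset.univ.erase i := by simp [hne.symm]
    rw [← Finset.mul_prod_erase _ _ (Finset.mem_univ i), ← Finset.mul_prod_erase _ _ hj,
      Equiv.swap_apply_left, Equiv.swap_apply_right, hrest, ← mul_assoc] at h1
    rw [← Finset.mul_prod_erase _ _ (Finset.mem_univ i), ← Finset.mul_prod_erase _ _ hj,
      ← mul_assoc] at he
    have h3 : α j ^ e i * α i ^ e j = α i ^ e i * α j ^ e j :=
      mul_right_cancel₀ (right_ne_zero_of_mul (h1 ▸ one_ne_zero)) (h1.trans he.symm)
    rw [zpow_sub₀ (hα0 i), zpow_sub₀ (hα0 j), div_eq_div_iff (zpow_ne_zero _ (hα0 i))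
      (zpow_ne_zero _ (hα0 j))]
    exact h3.symm
  set N := (e i - e j).natAbs with hN
  have h3 : α i ^ N = α j ^ N := pow_natAbs_eq h2
  refine ⟨N, Int.natAbs_pos.2 (sub_ne_zero.2 hij), fun k l => ?_⟩
  by_cases hkl : k = l
  · rw [hkl]
  -- A permutation with `i ↦ k` and `j ↦ l`.
  obtain ⟨g, hg⟩ := hα (Equiv.swap (Equiv.swap i k j) l * Equiv.swap i k)
  have h4 := congrArg g h3
  rw [map_pow, map_pow, hg, hg, Equiv.Perm.mul_apply, Equiv.Perm.mul_apply, Equiv.swap_apply_left,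
    Equiv.swap_apply_left, Equiv.swap_apply_of_ne_of_ne _ hkl] at h4
  · exact h4
  · intro h
    have := (Equiv.swap i k).injective ((Equiv.swap_apply_left i k).trans h)
    exact hne this

/-- If the `N`-th powers of conjugate units agree, they are rational units, hence `1` or `-1`. -/
theorem pow_eq_one_of_pow_eq_pow {n : ℕ} {K : Type*} [Field K] [Algebra ℚ K]
    [FiniteDimensional ℚ K] [IsGalois ℚ K] (α : Fin n → K)
    (hint : ∀ j, IsIntegral ℤ (α j)) (hint' : ∀ j, IsIntegral ℤ (α j)⁻¹) (hα0 : ∀ j, α j ≠ 0)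
    (hgal : ∀ (g : K ≃ₐ[ℚ] K) j, ∃ k, g (α j) = α k) {N : ℕ}
    (hpow : ∀ k l, α k ^ N = α l ^ N) (j : Fin n) : α j ^ (2 * N) = 1 := by
  obtain ⟨q, hq⟩ := (IsGalois.mem_range_algebraMap_iff_fixed (α j ^ N)).2 fun g => by
    obtain ⟨k, hk⟩ := hgal g j
    rw [map_pow, hk, hpow k j]
  have h1 : IsIntegral ℤ q := by
    rw [← isIntegral_algebraMap_iff (algebraMap ℚ K).injective, hq]
    exact (hint j).pow N
  have h2 : IsIntegral ℤ q⁻¹ := by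
    rw [← isIntegral_algebraMap_iff (algebraMap ℚ K).injective, map_inv₀, hq, ← inv_pow]
    exact (hint' j).pow N
  obtain ⟨a, rfl⟩ := IsIntegrallyClosed.isIntegral_iff.1 h1
  obtain ⟨b, hb⟩ := IsIntegrallyClosed.isIntegral_iff.1 h2
  have hne : (algebraMap ℤ ℚ a) ≠ 0 := by
    intro h0
    rw [h0, map_zero] at hq
    exact pow_ne_zero N (hα0 j) hq.symm
  have hab : a * b = 1 := by
    have : algebraMap ℤ ℚ (a * b) = 1 := by rw [map_mul, hb, mul_inv_cancel₀ hne]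
    exact (algebraMap ℤ ℚ).injective_int (by rw [this, map_one])
  have ha : a ^ 2 = 1 := by
    rcases Int.eq_one_or_neg_one_of_mul_eq_one hab with rfl | rfl <;> norm_num
  rw [mul_comm, pow_mul, ← hq, ← map_pow, ← map_pow, ha, map_one, map_one]

end Relations

/-! ### The rational form of an Anosov automorphism -/

section RationalForm

theorem map_lie_of_tmul {K N L : Type*} [Field K] [Algebra ℚ K] [LieRing N] [LieAlgebra ℚ N]
    [LieRing L] [LieAlgebra K L] (F : (K ⊗[ℚ] N) →ₗ[K] L) (i : N → L)
    (hi : ∀ x y, i ⁅x, y⁆ = ⁅i x, i y⁆) (hF : ∀ (c : K) (x : N), F (c ⊗ₜ x) = c • i x)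
    (x y : K ⊗[ℚ] N) : F ⁅x, y⁆ = ⁅F x, F y⁆ := by
  induction x using TensorProduct.induction_on with
  | zero => simp
  | add x x' h h' => rw [add_lie, map_add, map_add, add_lie, h, h']
  | tmul c x =>
    induction y using TensorProduct.induction_on with
    | zero => simp
    | add y y' h h' => rw [lie_add, map_add, map_add, lie_add, h, h']
    | tmul d y =>
      rw [LieAlgebra.ExtendScalars.bracket_tmul, hF, hF, hF, smul_lie, lie_smul, smul_smul, hi]

/-- Extension of scalars of a homomorphism of Lie algebras. -/
def lieBaseChange (K : Type*) {N N' : Type*} [Field K] [Algebra ℚ K] [LieRing N] [LieAlgebra ℚ N]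
    [LieRing N'] [LieAlgebra ℚ N'] (f : N →ₗ⁅ℚ⁆ N') : (K ⊗[ℚ] N) →ₗ⁅K⁆ (K ⊗[ℚ] N') :=
  { (f : N →ₗ[ℚ] N').baseChange K with
    map_lie' := fun {x y} => map_lie_of_tmul ((f : N →ₗ[ℚ] N').baseChange K)
      (fun x => (1 : K) ⊗ₜ[ℚ] f x)
      (fun x y => by rw [LieAlgebra.ExtendScalars.bracket_tmul, one_mul, LieHom.map_lie])
      (fun c x => by
        rw [LinearMap.baseChange_tmul, TensorProduct.smul_tmul', smul_eq_mul, mul_one]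
        rfl) x y }

theorem lieBaseChange_apply {K N N' : Type*} [Field K] [Algebra ℚ K] [LieRing N] [LieAlgebra ℚ N]
    [LieRing N'] [LieAlgebra ℚ N'] (f : N →ₗ⁅ℚ⁆ N') (x : K ⊗[ℚ] N) :
    lieBaseChange K f x = (f : N →ₗ[ℚ] N').baseChange K x := rfl

universe u

variable {𝔫 : Type u} [LieRing 𝔫] [LieAlgebra ℝ 𝔫]

/-- The `ℚ`-span of a basis with rational structure constants in which an Anosov automorphism is
integral is a rational form of the Lie algebra, preserved by the automorphism. -/
theorem IsAnosovAut.exists_rational_form {f : 𝔫 ≃ₗ⁅ℝ⁆ 𝔫} (hf : IsAnosovAut f) :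
    ∃ (N : Type u) (_ : LieRing N) (_ : LieAlgebra ℚ N) (_ : Module.Finite ℚ N)
      (g : N →ₗ⁅ℚ⁆ N) (e : (ℝ ⊗[ℚ] N) ≃ₗ⁅ℝ⁆ 𝔫) (m : ℕ) (b : Module.Basis (Fin m) ℚ N)
      (M : Matrix.GeneralLinearGroup (Fin m) ℤ),
      (∀ x, e ((g : N →ₗ[ℚ] N).baseChange ℝ x) = f (e x)) ∧
      LinearMap.toMatrix b b (g : N →ₗ[ℚ] N) =
        (M : Matrix (Fin m) (Fin m) ℤ).map (Int.cast : ℤ → ℚ) ∧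
      ∀ μ : ℂ, ((M : Matrix (Fin m) (Fin m) ℤ).map (Int.cast : ℤ → ℂ)).charpoly.IsRoot μ →
        ‖μ‖ ≠ 1 := by
  obtain ⟨m, b, M, hb, hM, hμ⟩ := hf
  let _ : Module ℚ 𝔫 := Module.compHom 𝔫 (algebraMap ℚ ℝ)
  have hq : ∀ (q : ℚ) (x : 𝔫), q • x = (q : ℝ) • x := fun q x => rfl
  let _ : LieAlgebra ℚ 𝔫 := { lie_smul := fun q x y => by rw [hq, hq, lie_smul] }
  have : IsScalarTower ℚ ℝ 𝔫 := ⟨fun q c x => by rw [hq, smul_smul, Rat.smul_def]⟩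
  have hbspan : ∀ i j, ⁅b i, b j⁆ ∈ Submodule.span ℚ (Set.range b) := by
    intro i j
    rw [← b.sum_repr ⁅b i, b j⁆]
    refine sum_mem fun k _ => ?_
    obtain ⟨q, hq'⟩ := hb i j k
    rw [hq', ← hq]
    exact Submodule.smul_mem _ q (Submodule.subset_span ⟨k, rfl⟩)
  -- The rational form is the `ℚ`-span of the basis, as a subalgebra of `𝔫`.
  let H : LieSubalgebra ℚ 𝔫 :=
    { Submodule.span ℚ (Set.range b) with
      lie_mem' := by
        intro x y hx hy
        change x ∈ Submodule.span ℚ (Set.range b) at hx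
        change y ∈ Submodule.span ℚ (Set.range b) at hy
        change ⁅x, y⁆ ∈ Submodule.span ℚ (Set.range b)
        induction hx, hy using Submodule.span_induction₂ with
        | mem_mem x y hx hy =>
          obtain ⟨i, rfl⟩ := hx
          obtain ⟨j, rfl⟩ := hy
          exact hbspan i j
        | zero_left => simp
        | zero_right => simp
        | add_left x y w _ _ _ h1 h2 => rw [add_lie]; exact add_mem h1 h2
        | add_right x y w _ _ _ h1 h2 => rw [lie_add]; exact add_mem h1 h2
        | smul_left c x y _ _ h => rw [smul_lie]; exact Submodule.smul_mem _ c h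
        | smul_right c x y _ _ h => rw [lie_smul]; exact Submodule.smul_mem _ c h }
  have hli : LinearIndependent ℚ b := b.linearIndependent.restrict_scalars' ℚ
  let β : Module.Basis (Fin m) ℚ H := Module.Basis.span hli
  have hβ : ∀ i, (β i : 𝔫) = b i := fun i => congrArg Subtype.val (Module.Basis.span_apply hli i)
  let e₀ : (ℝ ⊗[ℚ] H) ≃ₗ[ℝ] 𝔫 := (β.baseChange ℝ).equiv b (Equiv.refl _)
  have he₀ : ∀ (c : ℝ) (x : H), e₀ (c ⊗ₜ x) = c • (x : 𝔫) := by
    intro c x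
    have h1 : e₀ ((1 : ℝ) ⊗ₜ x) = (x : 𝔫) := by
      have : (e₀.toLinearMap.restrictScalars ℚ) ∘ₗ (TensorProduct.mk ℚ ℝ H 1) =
          H.toSubmodule.subtype := by
        refine β.ext fun i => ?_
        have h2 : β.baseChange ℝ i = (1 : ℝ) ⊗ₜ β i := Module.Basis.baseChange_apply ..
        change e₀ ((1 : ℝ) ⊗ₜ β i) = (β i : 𝔫)
        rw [← h2, Module.Basis.equiv_apply, hβ]
        rfl
      exact LinearMap.congr_fun this x
    have h2 : c ⊗ₜ[ℚ] x = c • ((1 : ℝ) ⊗ₜ[ℚ] x) := by rw [TensorProduct.smul_tmul', smul_eq_mul,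
      mul_one]
    rw [h2, map_smul, h1]
  let e : (ℝ ⊗[ℚ] H) ≃ₗ⁅ℝ⁆ 𝔫 :=
    { e₀ with
      map_lie' := by
        intro x y
        change e₀ ⁅x, y⁆ = ⁅e₀ x, e₀ y⁆
        exact map_lie_of_tmul e₀.toLinearMap (fun x => (x : 𝔫)) (fun x y => rfl) he₀ x y }
  have hfb : ∀ j, f (b j) = ∑ i, ((M : Matrix (Fin m) (Fin m) ℤ) i j : ℚ) • b i := by
    intro j
    rw [← b.sum_repr (f (b j))]
    refine Finset.sum_congr rfl fun i _ => ?_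
    have := congrFun (congrFun hM i) j
    rw [LinearMap.toMatrix_apply] at this
    rw [hq]
    change b.repr (((f : 𝔫 →ₗ⁅ℝ⁆ 𝔫) : 𝔫 →ₗ[ℝ] 𝔫) (b j)) i • b i = _
    rw [this]
    simp
  have hfH : ∀ x ∈ H, f x ∈ H := by
    intro x hx
    change x ∈ Submodule.span ℚ (Set.range b) at hx
    change f x ∈ Submodule.span ℚ (Set.range b)
    induction hx using Submodule.span_induction with
    | mem x hx =>
      obtain ⟨j, rfl⟩ := hx
      rw [hfb]
      exact sum_mem fun i _ => Submodule.smul_mem _ _ (Submodule.subset_span ⟨i, rfl⟩)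
    | zero => simp
    | add x y _ _ h h' => rw [map_add]; exact add_mem h h'
    | smul c x _ h => rw [hq, map_smul, ← hq]; exact Submodule.smul_mem _ _ h
  let g : H →ₗ⁅ℚ⁆ H :=
    { toFun := fun x => ⟨f x, hfH x x.2⟩
      map_add' := fun x y => Subtype.ext (map_add f (x : 𝔫) y)
      map_smul' := fun c x => Subtype.ext (map_smul f (c : ℝ) (x : 𝔫))
      map_lie' := fun {x y} => Subtype.ext (LieEquiv.map_lie f (x : 𝔫) y) }
  refine ⟨H, inferInstance, inferInstance, Module.Finite.of_basis β, g, e, m, β, M, ?_, ?_, hμ⟩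
  · intro x
    change e₀ _ = f (e₀ x)
    induction x using TensorProduct.induction_on with
    | zero => simp
    | add x y h h' => rw [map_add, map_add, map_add, map_add, h, h']
    | tmul c x =>
      rw [LinearMap.baseChange_tmul, he₀, he₀, map_smul]
      rfl
  · ext i j
    rw [LinearMap.toMatrix_apply]
    have : (g : H →ₗ[ℚ] H) (β j) = ∑ i, ((M : Matrix (Fin m) (Fin m) ℤ) i j : ℚ) • β i := by
      apply Subtype.ext
      rw [AddSubmonoidClass.coe_finsetSum]
      change f (β j : 𝔫) = _
      rw [hβ, hfb]
      refine Finset.sum_congr rfl fun k _ => ?_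
      rw [← hβ]
      rfl
    rw [this, map_sum, Finset.sum_apply']
    simp [Finsupp.single_apply]

end RationalForm

/-! ### Cyclic modules over `ℚ[X]` -/

section Cyclic

theorem map_aeval_of_intertwine {R S V W : Type*} [CommRing R] [CommRing S] [AddCommGroup V]
    [Module R V] [AddCommGroup W] [Module S W] {T : Module.End R V} {T' : Module.End S W}
    {F : Type*} [FunLike F V W] [AddMonoidHomClass F V W] (φ : F) (h : ∀ x, φ (T x) = T' (φ x))
    (p : ℤ[X]) (x : V) : φ (aeval T p x) = aeval T' p (φ x) := by
  induction p using Polynomial.induction_on' with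
  | add p q hp hq => simp only [map_add, LinearMap.add_apply, hp, hq]
  | monomial k a =>
    simp only [aeval_monomial, Module.End.mul_apply, Module.algebraMap_end_apply, map_zsmul]
    congr 1
    induction k with
    | zero => simp
    | succ k ih => rw [pow_succ', pow_succ', Module.End.mul_apply, Module.End.mul_apply, h, ih]

theorem aeval_mem_of_invariant {R V : Type*} [CommRing R] [AddCommGroup V] [Module R V]
    {T : Module.End R V} {E : Submodule R V} (hE : ∀ x ∈ E, T x ∈ E) (P : R[X]) {x : V}
    (hx : x ∈ E) : aeval T P x ∈ E := by
  induction P using Polynomial.induction_on' with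
  | add P Q hP hQ => rw [map_add, LinearMap.add_apply]; exact add_mem hP hQ
  | monomial k a =>
    rw [aeval_monomial, Module.End.mul_apply, Module.algebraMap_end_apply]
    refine E.smul_mem _ ?_
    induction k with
    | zero => simpa using hx
    | succ k ih => rw [pow_succ', Module.End.mul_apply]; exact hE _ ih

variable {F V : Type*} [Field F] [AddCommGroup V] [Module F V] {T : Module.End F V} {p : F[X]}

theorem dvd_of_aeval_apply_eq_zero (hp : Irreducible p) (hT : aeval T p = 0) {w : V} (hw : w ≠ 0)
    {P : F[X]} (hP : aeval T P w = 0) : p ∣ P := by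
  by_contra h
  obtain ⟨a, b, hab⟩ := (hp.coprime_iff_not_dvd).2 h
  apply hw
  have := congrArg (fun Q => aeval T Q w) hab
  simpa [hT, hP] using this.symm

theorem aeval_apply_eq_of_dvd {w : V} (hT : aeval T p w = 0) {P Q : F[X]} (h : p ∣ P - Q) :
    aeval T P w = aeval T Q w := by
  obtain ⟨c, hc⟩ := h
  rw [← sub_eq_zero, ← LinearMap.sub_apply, ← map_sub, hc, mul_comm, map_mul, Module.End.mul_apply,
    hT, map_zero]

/-- If `T` is killed by an irreducible polynomial whose degree is the dimension, every nonzero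
vector is cyclic. -/
theorem exists_aeval_apply_eq [FiniteDimensional F V] (hp : Irreducible p) (hT : aeval T p = 0)
    (hdeg : Module.finrank F V = p.natDegree) {w : V} (hw : w ≠ 0) (x : V) :
    ∃ P : F[X], aeval T P w = x := by
  let φ : degreeLT F p.natDegree →ₗ[F] V :=
    ((LinearMap.applyₗ w).comp (aeval T).toLinearMap).comp (degreeLT F p.natDegree).subtype
  have hφ : ∀ P, φ P = aeval T (P : F[X]) w := fun _ => rfl
  have hinj : Function.Injective φ := by
    rw [← LinearMap.ker_eq_bot, LinearMap.ker_eq_bot']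
    intro P hP
    apply Subtype.ext
    by_contra h0
    have h1 : p.natDegree ≤ (P : F[X]).natDegree :=
      natDegree_le_of_dvd (dvd_of_aeval_apply_eq_zero hp hT hw hP) h0
    have h2 := mem_degreeLT.1 P.2
    rw [degree_eq_natDegree h0, Nat.cast_lt] at h2
    omega
  have hfr : Module.finrank F (degreeLT F p.natDegree) = Module.finrank F V := by
    rw [hdeg, (degreeLTEquiv F p.natDegree).finrank_eq, Module.finrank_fin_fun]
  have : FiniteDimensional F (degreeLT F p.natDegree) :=
    Module.Finite.equiv (degreeLTEquiv F p.natDegree).symm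
  obtain ⟨P, hP⟩ := (LinearMap.injective_iff_surjective_of_finrank_eq_finrank hfr).1 hinj x
  exact ⟨P, hP⟩

/-- Two endomorphisms with a common irreducible annihilator are intertwined: the orbit of `v` under `T`
satisfies the relations of the standard basis under a matrix with that characteristic polynomial. -/
theorem exists_vectors_of_charpoly {n : ℕ} (hn : p.natDegree = n) (hp : Irreducible p)
    (A : Matrix (Fin n) (Fin n) F) (hA : A.charpoly = p) {v : V} (hv : aeval T p v = 0) :
    ∃ u : Fin n → V, (∀ j, T (u j) = ∑ i, A i j • u i) ∧
      ∀ P : F[X], aeval T P v ∈ Submodule.span F (Set.range u) := by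
  have hn0 : 0 < n := hn ▸ hp.natDegree_pos
  let B : Module.End F (Fin n → F) := Matrix.toLin' A
  have hB : aeval B p = 0 := by
    have := LinearMap.aeval_self_charpoly B
    rwa [Matrix.charpoly_toLin', hA] at this
  let w : Fin n → F := Pi.single ⟨0, hn0⟩ 1
  have hw : w ≠ 0 := by
    intro h
    have := congrFun h ⟨0, hn0⟩
    simp [w] at this
  have hcyc := fun x => exists_aeval_apply_eq hp hB (by rw [Module.finrank_fin_fun, hn]) hw x
  choose P hP using fun j : Fin n => hcyc (Pi.single j 1)
  refine ⟨fun j => aeval T (P j) v, fun j => ?_, fun Q => ?_⟩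
  · have h1 : aeval B (X * P j) w = aeval B (∑ i, C (A i j) * P i) w := by
      simp only [map_mul, aeval_X, map_sum, Module.End.mul_apply, LinearMap.sum_apply, hP, aeval_C,
        Module.algebraMap_end_apply]
      ext k
      simp [B, Finset.sum_apply, Pi.single_apply]
    have h2 : p ∣ X * P j - ∑ i, C (A i j) * P i := by
      refine dvd_of_aeval_apply_eq_zero hp hB hw ?_
      rw [map_sub, LinearMap.sub_apply, h1, sub_self]
    have h3 := aeval_apply_eq_of_dvd hv h2
    simpa only [map_mul, aeval_X, map_sum, Module.End.mul_apply, LinearMap.sum_apply, aeval_C,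
      Module.algebraMap_end_apply] using h3
  · have h1 : aeval B Q w = aeval B (∑ i, C (aeval B Q w i) * P i) w := by
      simp only [map_mul, map_sum, Module.End.mul_apply, LinearMap.sum_apply, hP, aeval_C,
        Module.algebraMap_end_apply]
      ext k
      simp [Finset.sum_apply, Pi.single_apply]
    have h2 : p ∣ Q - ∑ i, C (aeval B Q w i) * P i := by
      refine dvd_of_aeval_apply_eq_zero hp hB hw ?_
      rw [map_sub, LinearMap.sub_apply, ← h1, sub_self]
    rw [aeval_apply_eq_of_dvd hv h2]
    simp only [map_mul, map_sum, Module.End.mul_apply, LinearMap.sum_apply, aeval_C,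
      Module.algebraMap_end_apply]
    exact sum_mem fun i _ => Submodule.smul_mem _ _ (Submodule.subset_span ⟨i, rfl⟩)

/-- Semisimplicity descends along an extension of scalars. -/
theorem squarefree_minpoly_of_baseChange {K V : Type*} [Field K] [Algebra ℚ K] [AddCommGroup V]
    [Module ℚ V] [Module.Finite ℚ V] {g : Module.End ℚ V} (h : Module.End.IsSemisimple (g.baseChange K)) :
    Squarefree (minpoly ℚ g) := by
  have hne : minpoly ℚ g ≠ 0 := minpoly.ne_zero (Algebra.IsIntegral.isIntegral g)
  have hbc : ∀ P : ℚ[X], aeval (g.baseChange K : Module.End K (K ⊗[ℚ] V)) (P.map (algebraMap ℚ K)) =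
      (aeval g P).baseChange K := by
    intro P
    rw [aeval_map_algebraMap]
    exact (aeval_algHom_apply (Module.End.baseChangeHom ℚ K V) g P)
  intro a ⟨c, hc⟩
  have ha0 : a ≠ 0 := by rintro rfl; exact hne (by rw [hc]; ring)
  have hc0 : c ≠ 0 := by rintro rfl; exact hne (by rw [hc]; ring)
  -- The polynomial `a * c` takes a value at `g` that is both nilpotent and semisimple.
  have h1 : aeval g (a * c) = 0 := by
    have hs := h.aeval ((a * c).map (algebraMap ℚ K))
    have hn : IsNilpotent (aeval (g.baseChange K : Module.End K (K ⊗[ℚ] V))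
        ((a * c).map (algebraMap ℚ K))) := by
      refine ⟨2, ?_⟩
      rw [hbc, ← LinearMap.baseChange_pow, ← map_pow]
      have : (a * c) ^ 2 = minpoly ℚ g * c := by rw [hc]; ring
      rw [this, map_mul, minpoly.aeval, zero_mul, LinearMap.baseChange_zero]
    have h0 := Module.End.eq_zero_of_isNilpotent_isSemisimple hn hs
    rw [hbc] at h0
    ext x
    exact one_tmul_injective (K := K) (by simpa using LinearMap.congr_fun h0 ((1 : K) ⊗ₜ x))
  have h2 := natDegree_le_of_dvd (minpoly.dvd ℚ g h1) (mul_ne_zero ha0 hc0)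
  rw [hc, natDegree_mul (mul_ne_zero ha0 ha0) hc0, natDegree_mul ha0 ha0,
    natDegree_mul ha0 hc0] at h2
  exact isUnit_iff_degree_eq_zero.2 (by rw [degree_eq_natDegree ha0]; norm_cast; omega)

end Cyclic

/-! ### Presentation by a free nilpotent Lie algebra -/

section Presentation

open LieModule

section Rational

variable {N : Type*} [LieRing N] [LieAlgebra ℚ N] {g : N →ₗ⁅ℚ⁆ N} {p : ℚ[X]}

theorem lcs_invariant {R L : Type*} [CommRing R] [LieRing L] [LieAlgebra R L] (g : L →ₗ⁅R⁆ L)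
    (k : ℕ) : ∀ x ∈ (lowerCentralSeries R L L k).toSubmodule,
      (g : L →ₗ[R] L) x ∈ (lowerCentralSeries R L L k).toSubmodule :=
  fun _ hx => lcs_le_comap g k hx

theorem exists_notMem_lcs_one (hp0 : Irreducible p)
    (hdim : Module.finrank ℚ (N ⧸ (lowerCentralSeries ℚ N N 1).toSubmodule) = p.natDegree) :
    ∃ u : N, u ∉ (lowerCentralSeries ℚ N N 1).toSubmodule := by
  by_contra! h
  have h1 : (lowerCentralSeries ℚ N N 1).toSubmodule = ⊤ := eq_top_iff.2 fun x _ => h x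
  have := hp0.natDegree_pos
  rw [← hdim, h1] at this
  have h2 : Module.finrank ℚ (N ⧸ (⊤ : Submodule ℚ N)) = 0 := Module.finrank_zero_of_subsingleton
  omega

theorem dvd_minpoly (hp0 : Irreducible p)
    (hp : ∀ x, aeval (g : N →ₗ[ℚ] N) p x ∈ (lowerCentralSeries ℚ N N 1).toSubmodule)
    (hdim : Module.finrank ℚ (N ⧸ (lowerCentralSeries ℚ N N 1).toSubmodule) = p.natDegree) :
    p ∣ minpoly ℚ (g : N →ₗ[ℚ] N) := by
  by_contra h
  obtain ⟨a, b, hab⟩ := (hp0.coprime_iff_not_dvd).2 h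
  obtain ⟨u, hu⟩ := exists_notMem_lcs_one hp0 hdim
  apply hu
  have h1 := congrArg (fun Q => aeval (g : N →ₗ[ℚ] N) Q u) hab
  simp only [map_add, map_mul, minpoly.aeval, mul_zero, add_zero, Module.End.mul_apply,
    map_one, Module.End.one_apply] at h1
  rw [← h1]
  exact aeval_mem_of_invariant (lcs_invariant g 1) a (hp u)

/-- A nilpotent Lie algebra with a semisimple automorphism whose action modulo the commutator ideal
has irreducible characteristic polynomial is an equivariant quotient of the free nilpotent one.
Since `minpoly g = p * q` with `p`, `q` coprime, the values of `q` at `g` lift the abelianization to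
a subspace killed by `p(g)`. -/
theorem exists_equivariant_surjection [Module.Finite ℚ N] {n r : ℕ} (hr : lowerCentralSeries ℚ N N r = ⊥)
    (hsq : Squarefree (minpoly ℚ (g : N →ₗ[ℚ] N))) (hp0 : Irreducible p)
    (hp : ∀ x, aeval (g : N →ₗ[ℚ] N) p x ∈ (lowerCentralSeries ℚ N N 1).toSubmodule)
    (hdim : Module.finrank ℚ (N ⧸ (lowerCentralSeries ℚ N N 1).toSubmodule) = p.natDegree)
    (hn : p.natDegree = n) (A : Matrix (Fin n) (Fin n) ℤ)
    (hA : (A.map (Int.cast : ℤ → ℚ)).charpoly = p) :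
    ∃ ψ : FreeNilQ n r →ₗ⁅ℚ⁆ N, Function.Surjective ψ ∧
      (∀ x, ψ (matEndQ r A x) = g (ψ x)) ∧
      LinearIndependent ℚ fun j => (lowerCentralSeries ℚ N N 1).toSubmodule.mkQ (ψ (genQ n r j)) := by
  set C := (lowerCentralSeries ℚ N N 1).toSubmodule with hC
  set T : Module.End ℚ N := (g : N →ₗ[ℚ] N) with hT
  obtain ⟨q, hq⟩ := dvd_minpoly hp0 hp hdim
  have hcop : IsCoprime p q := by
    refine (hp0.coprime_iff_not_dvd).2 ?_
    rintro ⟨c, rfl⟩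
    exact hp0.not_isUnit (hsq p ⟨c, by rw [hq]; ring⟩)
  obtain ⟨u, hu⟩ := exists_notMem_lcs_one hp0 hdim
  obtain ⟨a, b, hab⟩ := hcop
  set v := aeval T q u with hv
  have hpv : aeval T p v = 0 := by
    rw [hv, ← Module.End.mul_apply, ← map_mul, ← hq, minpoly.aeval, LinearMap.zero_apply]
  have hvC : v ∉ C := by
    intro h
    apply hu
    have h1 := congrArg (fun Q => aeval T Q u) hab
    simp only [map_add, map_mul, Module.End.mul_apply, LinearMap.add_apply, map_one,
      Module.End.one_apply] at h1
    rw [← h1]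
    exact add_mem (aeval_mem_of_invariant (lcs_invariant g 1) a (hp u))
      (aeval_mem_of_invariant (lcs_invariant g 1) b h)
  obtain ⟨e, he, hspan⟩ := exists_vectors_of_charpoly hn hp0 _ hA hpv
  -- The endomorphism induced on the abelianization.
  let Tb : Module.End ℚ (N ⧸ C) := C.mapQ C T (lcs_le_comap g 1)
  have hTb : ∀ (P : ℚ[X]) (x : N), aeval Tb P (C.mkQ x) = C.mkQ (aeval T P x) := by
    intro P x
    induction P using Polynomial.induction_on' with
    | add P Q hP hQ => simp only [map_add, LinearMap.add_apply, hP, hQ]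
    | monomial k c =>
      simp only [aeval_monomial, Module.End.mul_apply, Module.algebraMap_end_apply, map_smul]
      congr 1
      induction k with
      | zero => simp
      | succ k ih =>
        rw [pow_succ', pow_succ', Module.End.mul_apply, Module.End.mul_apply, ih]
        rfl
  have hTb0 : aeval Tb p = 0 := by
    ext x
    change aeval Tb p (C.mkQ x) = 0
    rw [hTb]
    exact (Submodule.Quotient.mk_eq_zero C).2 (hp x)
  have hv0 : C.mkQ v ≠ 0 := fun h => hvC ((Submodule.Quotient.mk_eq_zero C).1 h)
  have hgen : ∀ x : N, ∃ y ∈ Submodule.span ℚ (Set.range e), x - y ∈ C := by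
    intro x
    obtain ⟨P, hP⟩ := exists_aeval_apply_eq hp0 hTb0 hdim hv0 (C.mkQ x)
    refine ⟨_, hspan P, (Submodule.Quotient.mk_eq_zero C).1 ?_⟩
    rw [hTb] at hP
    exact sub_eq_zero.2 hP.symm
  have hztop : Submodule.span ℚ (Set.range e) ⊔ C = ⊤ := by
    refine eq_top_iff.2 fun x _ => ?_
    obtain ⟨y, hy, hxy⟩ := hgen x
    exact Submodule.mem_sup.2 ⟨y, hy, _, hxy, add_sub_cancel y x⟩
  let ψ : FreeNilQ n r →ₗ⁅ℚ⁆ N := freeNilLift hr e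
  have hψ : ∀ j, ψ (genQ n r j) = e j := freeNilLift_genQ hr e
  refine ⟨ψ, ?_, ?_, ?_⟩
  · have h1 := lieSubalgebra_eq_top hr hztop ψ.range fun i => ⟨genQ n r i, hψ i⟩
    exact LieHom.range_eq_top ψ |>.1 h1
  · have h1 : ψ.comp (matHomQ r A) = g.comp ψ := by
      refine freeNilQ_hom_ext fun j => ?_
      rw [LieHom.comp_apply, LieHom.comp_apply, matHomQ_apply, matEndQ_genQ, map_sum, hψ]
      refine Eq.trans ?_ (he j).symm
      refine Finset.sum_congr rfl fun i _ => ?_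
      rw [map_smul, hψ, Matrix.map_apply]
    exact fun x => LieHom.congr_fun h1 x
  · simp only [hψ]
    refine linearIndependent_of_top_le_span_of_card_eq_finrank ?_ (by
      rw [Fintype.card_fin, hdim, hn])
    rintro x -
    obtain ⟨x, rfl⟩ := C.mkQ_surjective x
    obtain ⟨y, hy, hxy⟩ := hgen x
    have h1 : C.mkQ x = C.mkQ y := sub_eq_zero.1 (by
      rw [← map_sub]; exact (Submodule.Quotient.mk_eq_zero C).2 hxy)
    have h2 := Submodule.mem_map_of_mem (f := C.mkQ) hy
    rw [Submodule.map_span, ← Set.range_comp] at h2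
    rw [h1]
    exact h2

end Rational

theorem nonempty_quotient_equiv {R L L' : Type*} [CommRing R] [LieRing L] [LieAlgebra R L]
    [LieRing L'] [LieAlgebra R L'] (F : L →ₗ⁅R⁆ L') (hF : Function.Surjective F) (I : LieIdeal R L)
    (hI : F.ker = I) : Nonempty (L' ≃ₗ⁅R⁆ (L ⧸ I)) := by
  subst hI
  exact ⟨((LieHom.quotKerEquivRange F).trans
    ((LieEquiv.ofEq _ _ (by rw [(LieHom.range_eq_top F).2 hF])).trans
      LieSubalgebra.topEquiv)).symm⟩

theorem ker_lieBaseChange {N N' : Type*} [LieRing N] [LieAlgebra ℚ N] [LieRing N'] [LieAlgebra ℚ N']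
    (F : N →ₗ⁅ℚ⁆ N') : (lieBaseChange ℝ F).ker = F.ker.baseChange ℝ := by
  rw [← LieSubmodule.toSubmodule_inj, LieSubmodule.coe_baseChange]
  exact ker_baseChange (K := ℝ) (F : N →ₗ[ℚ] N')

theorem lieBaseChange_surjective {N N' : Type*} [LieRing N] [LieAlgebra ℚ N] [LieRing N']
    [LieAlgebra ℚ N'] {F : N →ₗ⁅ℚ⁆ N'} (hF : Function.Surjective F) :
    Function.Surjective (lieBaseChange ℝ F) :=
  LinearMap.lTensor_surjective ℝ (g := (F : N →ₗ[ℚ] N')) hF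

end Presentation

section AnosovPresentation

open LieModule

theorem mem_lcs_iff_of_equiv {𝔫 N : Type*} [LieRing 𝔫] [LieAlgebra ℝ 𝔫] [LieRing N]
    [LieAlgebra ℚ N] (e : (ℝ ⊗[ℚ] N) ≃ₗ⁅ℝ⁆ 𝔫) (k : ℕ) (x : ℝ ⊗[ℚ] N) :
    e x ∈ lowerCentralSeries ℝ 𝔫 𝔫 k ↔ x ∈ (lowerCentralSeries ℚ N N k).toSubmodule.baseChange ℝ := by
  have h : x ∈ (lowerCentralSeries ℚ N N k).toSubmodule.baseChange ℝ ↔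
      x ∈ lowerCentralSeries ℝ (ℝ ⊗[ℚ] N) (ℝ ⊗[ℚ] N) k := by
    rw [LieSubmodule.lowerCentralSeries_tensor_eq_baseChange]
    rfl
  rw [h]
  constructor
  · intro hx
    have := LieIdeal.map_lowerCentralSeries_le k (LieIdeal.mem_map (f := e.symm.toLieHom) hx)
    simpa using this
  · intro hx
    exact LieIdeal.map_lowerCentralSeries_le k (LieIdeal.mem_map (f := e.toLieHom) hx)

variable {𝔫 : Type*} [LieRing 𝔫] [LieAlgebra ℝ 𝔫] [FiniteDimensional ℝ 𝔫]

/-- The first polynomial of a semisimple Anosov automorphism, if irreducible, is the minimal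
polynomial of a hyperbolic unit. For every integer matrix with this characteristic polynomial the Lie
algebra is an equivariant quotient of the free nilpotent Lie algebra by a rational ideal. -/
theorem exists_presentation {r n : ℕ} {f : 𝔫 ≃ₗ⁅ℝ⁆ 𝔫} {p : ℤ[X]} (hr : IsStepNilpotent 𝔫 r)
    (hf : IsAnosovAut f) (hss : Module.End.IsSemisimple ((f : 𝔫 →ₗ⁅ℝ⁆ 𝔫) : 𝔫 →ₗ[ℝ] 𝔫))
    (hp : IsFirstPoly f p) (hn : p.natDegree = n) (hirr : Irreducible p) :
    p.Monic ∧ IsUnit (p.coeff 0) ∧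
    (∀ μ : ℂ, (p.map (Int.castRingHom ℂ)).IsRoot μ → ‖μ‖ ≠ 1) ∧
    ∀ A : Matrix (Fin n) (Fin n) ℤ, A.charpoly = p →
      ∃ J : LieIdeal ℚ (FreeNilQ n r), (∀ x ∈ J, matEndQ r A x ∈ J) ∧
        J ≤ lowerCentralSeries ℚ (FreeNilQ n r) (FreeNilQ n r) 1 ∧
        LinearIndependent ℚ (genQ n r) ∧
        (∀ s < r, ¬ lowerCentralSeries ℚ (FreeNilQ n r) (FreeNilQ n r) s ≤ J) ∧
        Nonempty (𝔫 ≃ₗ⁅ℝ⁆ (FreeNil ℝ n r ⧸ J.baseChange ℝ)) := by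
  have hmonic : p.Monic := by
    refine monic_of_injective (f := Int.castRingHom ℝ) Int.cast_injective ?_
    rw [hp]
    exact LinearMap.charpoly_monic _
  have hirrQ : Irreducible (ratPoly p) :=
    (hmonic.irreducible_iff_irreducible_map_fraction_map (K := ℚ)).1 hirr
  obtain ⟨N, _, _, _, g, e, m, b, M, hge, hM, hμ⟩ := hf.exists_rational_form
  have hmem := mem_lcs_iff_of_equiv e
  have hmem1 : ∀ (k : ℕ) (x : N), e ((1 : ℝ) ⊗ₜ x) ∈ lowerCentralSeries ℝ 𝔫 𝔫 k ↔
      x ∈ (lowerCentralSeries ℚ N N k).toSubmodule := fun k x =>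
    (hmem k _).trans one_tmul_mem_baseChange
  have hlcs : ∀ k, lowerCentralSeries ℚ N N k = ⊥ ↔ lowerCentralSeries ℝ 𝔫 𝔫 k = ⊥ := by
    intro k
    constructor
    · intro h
      rw [eq_bot_iff]
      intro y hy
      rw [← e.apply_symm_apply y, hmem, h, LieSubmodule.bot_toSubmodule,
        Submodule.baseChange_bot, Submodule.mem_bot] at hy
      rw [LieSubmodule.mem_bot, ← e.apply_symm_apply y, hy, map_zero]
    · intro h
      rw [eq_bot_iff]
      intro x hx
      have h1 := (hmem1 k x).2 hx
      rw [h, LieSubmodule.mem_bot] at h1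
      have h2 : (1 : ℝ) ⊗ₜ[ℚ] x = (1 : ℝ) ⊗ₜ[ℚ] (0 : N) := by
        rw [TensorProduct.tmul_zero]
        exact e.injective (h1.trans (map_zero e).symm)
      exact (LieSubmodule.mem_bot _).2 (one_tmul_injective h2)
  have hrN : lowerCentralSeries ℚ N N r = ⊥ := (hlcs r).2 hr.1
  -- Cayley–Hamilton on the abelianization.
  have hpg : ∀ x, aeval (g : N →ₗ[ℚ] N) (ratPoly p) x ∈ (lowerCentralSeries ℚ N N 1).toSubmodule := by
    intro x
    rw [← hmem1 1]
    have h1 : aeval (g : N →ₗ[ℚ] N) (ratPoly p) = aeval (g : N →ₗ[ℚ] N) p := aeval_map_algebraMap ..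
    have h2 : aeval (abMap f) p = 0 := by
      rw [← aeval_map_algebraMap ℝ]
      have := LinearMap.aeval_self_charpoly (abMap f)
      rwa [← hp] at this
    let φ : N →+ 𝔫 := e.toLieHom.toLinearMap.toAddMonoidHom.comp
      (TensorProduct.mk ℚ ℝ N 1).toAddMonoidHom
    have h3 : φ (aeval (g : N →ₗ[ℚ] N) p x) = aeval ((f : 𝔫 →ₗ⁅ℝ⁆ 𝔫) : 𝔫 →ₗ[ℝ] 𝔫) p (φ x) := by
      refine map_aeval_of_intertwine φ (fun y => ?_) p x
      exact hge ((1 : ℝ) ⊗ₜ y)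
    have h4 := map_aeval_of_intertwine (lowerCentralSeries ℝ 𝔫 𝔫 1).toSubmodule.mkQ
      (T := ((f : 𝔫 →ₗ⁅ℝ⁆ 𝔫) : 𝔫 →ₗ[ℝ] 𝔫)) (T' := abMap f) (fun y => rfl) p (φ x)
    rw [h2, LinearMap.zero_apply] at h4
    rw [h1]
    change φ (aeval (g : N →ₗ[ℚ] N) p x) ∈ _
    rw [h3]
    exact (Submodule.Quotient.mk_eq_zero _).1 h4
  have hfrN : Module.finrank ℝ 𝔫 = Module.finrank ℚ N := by
    rw [← e.toLinearEquiv.finrank_eq, Module.finrank_baseChange]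
  have hfrC : Module.finrank ℝ (lowerCentralSeries ℝ 𝔫 𝔫 1).toSubmodule =
      Module.finrank ℚ (lowerCentralSeries ℚ N N 1).toSubmodule := by
    rw [← finrank_submodule_baseChange (K := ℝ),
      ← LinearEquiv.finrank_map_eq e.toLinearEquiv ((lowerCentralSeries ℚ N N 1).toSubmodule.baseChange ℝ)]
    have h1 : (lowerCentralSeries ℝ 𝔫 𝔫 1).toSubmodule =
        ((lowerCentralSeries ℚ N N 1).toSubmodule.baseChange ℝ).map
          (e.toLinearEquiv : (ℝ ⊗[ℚ] N) →ₗ[ℝ] 𝔫) := ?_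
    · rw [h1]
    ext y
    constructor
    · intro hy
      refine ⟨e.symm y, (hmem 1 _).1 ?_, e.apply_symm_apply y⟩
      rw [e.apply_symm_apply]; exact hy
    · rintro ⟨x, hx, rfl⟩
      exact (hmem 1 x).2 hx
  have hdim : Module.finrank ℚ (N ⧸ (lowerCentralSeries ℚ N N 1).toSubmodule) =
      (ratPoly p).natDegree := by
    have h1 : Module.finrank ℝ (𝔫 ⧸ (lowerCentralSeries ℝ 𝔫 𝔫 1).toSubmodule) = p.natDegree := by
      rw [← LinearMap.charpoly_natDegree (abMap f), ← hp, natDegree_map_eq_of_injective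
        Int.cast_injective]
    have h2 := Submodule.finrank_quotient_add_finrank (lowerCentralSeries ℝ 𝔫 𝔫 1).toSubmodule
    have h3 := Submodule.finrank_quotient_add_finrank (lowerCentralSeries ℚ N N 1).toSubmodule
    rw [natDegree_map_eq_of_injective Int.cast_injective]
    omega
  have hcharQ : (g : N →ₗ[ℚ] N).charpoly =
      (M : Matrix (Fin m) (Fin m) ℤ).charpoly.map (Int.castRingHom ℚ) := by
    rw [← LinearMap.charpoly_toMatrix _ b, hM]
    exact Matrix.charpoly_map _ (Int.castRingHom ℚ)
  have hdvd : p ∣ (M : Matrix (Fin m) (Fin m) ℤ).charpoly := by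
    rw [← map_dvd_map (Int.castRingHom ℚ) Int.cast_injective hmonic, ← hcharQ]
    exact (dvd_minpoly hirrQ hpg hdim).trans (minpoly.dvd ℚ _ (LinearMap.aeval_self_charpoly _))
  refine ⟨hmonic, ?_, ?_, ?_⟩
  · obtain ⟨c, hc⟩ := hdvd
    have h1 := Matrix.det_eq_sign_charpoly_coeff (M : Matrix (Fin m) (Fin m) ℤ)
    have h2 : IsUnit (M : Matrix (Fin m) (Fin m) ℤ).det :=
      (Matrix.isUnit_iff_isUnit_det _).1 M.isUnit
    rw [h1, hc, mul_coeff_zero] at h2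
    exact isUnit_of_mul_isUnit_left (isUnit_of_mul_isUnit_right h2)
  · intro μ hroot
    refine hμ μ ?_
    have h1 : ((M : Matrix (Fin m) (Fin m) ℤ).map (Int.cast : ℤ → ℂ)).charpoly =
        (M : Matrix (Fin m) (Fin m) ℤ).charpoly.map (Int.castRingHom ℂ) :=
      Matrix.charpoly_map _ (Int.castRingHom ℂ)
    rw [h1]
    exact hroot.dvd (Polynomial.map_dvd _ hdvd)
  · intro A hA
    have hsq : Squarefree (minpoly ℚ (g : N →ₗ[ℚ] N)) := by
      refine squarefree_minpoly_of_baseChange (K := ℝ) ?_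
      have h1 : (g : N →ₗ[ℚ] N).baseChange ℝ =
          (e.toLinearEquiv.symm.conj ((f : 𝔫 →ₗ⁅ℝ⁆ 𝔫) : 𝔫 →ₗ[ℝ] 𝔫)) := by
        refine LinearMap.ext fun x => e.injective ?_
        exact (hge x).trans (e.apply_symm_apply _).symm
      refine Module.End.isSemisimple_of_squarefree_aeval_eq_zero hss.minpoly_squarefree ?_
      rw [h1]
      change aeval ((e.toLinearEquiv.symm.conjAlgEquiv ℝ).toAlgHom _) _ = 0
      rw [aeval_algHom_apply, minpoly.aeval, map_zero]
    have hAQ : (A.map (Int.cast : ℤ → ℚ)).charpoly = ratPoly p := by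
      rw [← hA]
      exact Matrix.charpoly_map _ (Int.castRingHom ℚ)
    have hnQ : (ratPoly p).natDegree = n := by
      rw [natDegree_map_eq_of_injective Int.cast_injective, hn]
    obtain ⟨ψ, hψs, hψ, hli⟩ := exists_equivariant_surjection hrN hsq hirrQ hpg hdim hnQ A hAQ
    set C := (lowerCentralSeries ℚ N N 1).toSubmodule with hC
    refine ⟨ψ.ker, ?_, ?_, ?_, ?_, ?_⟩
    · intro x hx
      rw [LieHom.mem_ker] at hx ⊢
      rw [hψ, hx, map_zero]
    · intro x hx
      obtain ⟨y, hy, w, hw, rfl⟩ := Submodule.mem_sup.1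
        (span_genQ_sup (n := n) (r := r) ▸ Submodule.mem_top (x := x))
      obtain ⟨c, rfl⟩ := (Submodule.mem_span_range_iff_exists_fun ℚ).1 hy
      have hwC : C.mkQ (ψ w) = 0 := (Submodule.Quotient.mk_eq_zero C).2
        (LieIdeal.map_lowerCentralSeries_le 1 (LieIdeal.mem_map (f := ψ) hw))
      rw [LieHom.mem_ker] at hx
      have h1 := congrArg C.mkQ hx
      rw [map_add, map_add, hwC, add_zero, map_zero, map_sum, map_sum] at h1
      simp only [map_smul] at h1
      have h2 := Fintype.linearIndependent_iff.1 hli c h1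
      simpa [h2] using hw
    · exact LinearIndependent.of_comp (C.mkQ ∘ₗ (ψ : FreeNilQ n r →ₗ[ℚ] N)) hli
    · intro s hs hle
      refine hr.2 s hs ((hlcs s).1 ?_)
      rw [← LieIdeal.lowerCentralSeries_map_eq s hψs, eq_bot_iff, LieIdeal.map_le_iff_le_comap]
      exact hle
    · obtain ⟨E⟩ := nonempty_quotient_equiv _ (lieBaseChange_surjective hψs) _ (ker_lieBaseChange ψ)
      exact ⟨e.symm.trans E⟩

end AnosovPresentation

/-! ### Eigenframes of the first step -/

section Frames

open LieModule

variable {n r : ℕ} {K : Type*} [Field K] [Algebra ℚ K]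

theorem lcs_freeNil_eq (k : ℕ) :
    (lowerCentralSeries K (FreeNil K n r) (FreeNil K n r) k).toSubmodule =
      (lowerCentralSeries ℚ (FreeNilQ n r) (FreeNilQ n r) k).toSubmodule.baseChange K := by
  rw [LieSubmodule.lowerCentralSeries_tensor_eq_baseChange]
  rfl

theorem lcs_freeNil : lowerCentralSeries K (FreeNil K n r) (FreeNil K n r) r = ⊥ := by
  rw [LieSubmodule.lowerCentralSeries_tensor_eq_baseChange, lcs_freeNilQ,
    LieSubmodule.baseChange_bot]

theorem stepOne_eq_baseChange :
    stepOne K n r = (Submodule.span ℚ (Set.range (genQ n r))).baseChange K := by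
  rw [Submodule.baseChange_span, ← Set.range_comp]
  rfl

theorem span_sup_lcs_one {z : Fin n → FreeNil K n r}
    (hz : Submodule.span K (Set.range z) = stepOne K n r) :
    Submodule.span K (Set.range z) ⊔
      (lowerCentralSeries K (FreeNil K n r) (FreeNil K n r) 1).toSubmodule = ⊤ := by
  rw [hz, stepOne_eq_baseChange, lcs_freeNil_eq, ← baseChange_sup, span_genQ_sup,
    Submodule.baseChange_top]

theorem span_bracketEval_freeNil {z : Fin n → FreeNil K n r}
    (hz : Submodule.span K (Set.range z) = stepOne K n r) :
    Submodule.span K (Set.range (bracketEval z)) = ⊤ :=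
  span_bracketEval_eq_top lcs_freeNil (span_sup_lcs_one hz)

theorem linearIndependent_gen (h : LinearIndependent ℚ (genQ n r)) :
    LinearIndependent K (gen K n r) := by
  let e := Fintype.linearCombination ℚ (genQ n r)
  have he : LinearMap.ker e = ⊥ := by
    rw [LinearMap.ker_eq_bot']
    intro c hc
    exact funext (Fintype.linearIndependent_iff.1 h c hc)
  have h1 : LinearMap.ker (e.baseChange K) = ⊥ := by
    rw [ker_baseChange, he, Submodule.baseChange_bot]
  have h2 := ((Pi.basisFun ℚ (Fin n)).baseChange K).linearIndependent.map' _ h1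
  have h3 : gen K n r = e.baseChange K ∘ (Pi.basisFun ℚ (Fin n)).baseChange K := by
    funext i
    simp [e, gen]
  rw [h3]
  exact h2

theorem eq_of_sum_gen_eq (h : LinearIndependent ℚ (genQ n r)) {v w : Fin n → K}
    (hvw : ∑ j, v j • gen K n r j = ∑ j, w j • gen K n r j) : v = w := by
  exact funext (Fintype.linearIndependent_iffₛ.1 (linearIndependent_gen (K := K) h) v w hvw)

theorem matEnd_eq_lieBaseChange (A : Matrix (Fin n) (Fin n) ℤ) (x : FreeNil K n r) :
    matEnd K r A x = lieBaseChange K (matHomQ r A) x := rfl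

theorem matEnd_gen (A : Matrix (Fin n) (Fin n) ℤ) (j : Fin n) :
    matEnd K r A (gen K n r j) = ∑ i, (A i j : K) • gen K n r i := by
  rw [matEnd, gen, LinearMap.baseChange_tmul, matEndQ_genQ, TensorProduct.tmul_sum]
  refine Finset.sum_congr rfl fun i _ => ?_
  rw [TensorProduct.tmul_smul, gen, ← algebraMap_smul K ((A i j : ℚ))]
  simp

theorem matEnd_sum_gen (A : Matrix (Fin n) (Fin n) ℤ) (v : Fin n → K) :
    matEnd K r A (∑ j, v j • gen K n r j) =
      ∑ i, ((A.map (Int.cast : ℤ → K)).mulVec v) i • gen K n r i := by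
  rw [map_sum]
  simp only [map_smul, matEnd_gen, Finset.smul_sum, Matrix.mulVec, dotProduct, Finset.sum_smul,
    smul_smul, Matrix.map_apply]
  rw [Finset.sum_comm]
  simp only [mul_comm]

theorem matEnd_bracketEval {A : Matrix (Fin n) (Fin n) ℤ} {z : Fin n → FreeNil K n r}
    {α : Fin n → K} (hz : ∀ j, matEnd K r A (z j) = α j • z j) (t : FreeMagma (Fin n)) :
    matEnd K r A (bracketEval z t) = (∏ j, α j ^ letterCount j t) • bracketEval z t := by
  rw [matEnd_eq_lieBaseChange, map_bracketEval, ← bracketEval_smul]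
  congr 1
  funext j
  exact hz j

theorem galAct_matEnd (g : K ≃ₐ[ℚ] K) (A : Matrix (Fin n) (Fin n) ℤ) (x : FreeNil K n r) :
    galAct g (matEnd K r A x) = matEnd K r A (galAct g x) :=
  galAct_baseChange g _ x

theorem galAct_mem_stepOne (g : K ≃ₐ[ℚ] K) {x : FreeNil K n r} (hx : x ∈ stepOne K n r) :
    galAct g x ∈ stepOne K n r := by
  rw [stepOne_eq_baseChange] at *
  exact galAct_mem_baseChange g hx

theorem exists_eigenvector {A : Matrix (Fin n) (Fin n) ℤ} (h : LinearIndependent ℚ (genQ n r))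
    {α : K} (hα : (A.charpoly.map (Int.castRingHom K)).IsRoot α) :
    ∃ w ∈ stepOne K n r, w ≠ 0 ∧ matEnd K r A w = α • w := by
  have h1 : (A.map (Int.cast : ℤ → K)).charpoly = A.charpoly.map (Int.castRingHom K) :=
    Matrix.charpoly_map _ (Int.castRingHom K)
  rw [← h1, IsRoot, Matrix.eval_charpoly] at hα
  obtain ⟨v, hv, hv0⟩ := Matrix.exists_mulVec_eq_zero_iff.2 hα
  refine ⟨∑ j, v j • gen K n r j, sum_mem fun j _ => Submodule.smul_mem _ _
    (Submodule.subset_span ⟨j, rfl⟩), fun h0 => hv ?_, ?_⟩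
  · refine eq_of_sum_gen_eq (K := K) h (h0.trans ?_)
    simp
  · rw [Matrix.sub_mulVec, sub_eq_zero] at hv0
    rw [matEnd_sum_gen, ← hv0, Finset.smul_sum]
    refine Finset.sum_congr rfl fun i _ => ?_
    rw [smul_smul]
    simp [Matrix.scalar_apply, Matrix.mulVec_diagonal]

theorem linearIndependent_and_span_of_eigen {A : Matrix (Fin n) (Fin n) ℤ}
    {α : Fin n → K} (hα : Function.Injective α) {z : Fin n → FreeNil K n r}
    (hz : ∀ j, z j ∈ stepOne K n r) (hz0 : ∀ j, z j ≠ 0)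
    (heig : ∀ j, matEnd K r A (z j) = α j • z j) :
    LinearIndependent K z ∧ Submodule.span K (Set.range z) = stepOne K n r := by
  have hli : LinearIndependent K z :=
    Module.End.eigenvectors_linearIndependent' (matEnd K r A) α hα z fun j =>
      ⟨Module.End.mem_eigenspace_iff.2 (heig j), hz0 j⟩
  refine ⟨hli, ?_⟩
  have : Module.Finite K (stepOne K n r) := Module.Finite.span_of_finite K (Set.finite_range _)
  refine Submodule.eq_of_le_of_finrank_le (Submodule.span_le.2 ?_) ?_
  · rintro _ ⟨j, rfl⟩; exact hz j
  · rw [finrank_span_eq_card hli]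
    exact finrank_range_le_card (R := K) (gen K n r)

/-- The eigenvalues on an eigenframe are the roots of the characteristic polynomial. -/
theorem IsEigenFrame.exists_eigenvalues {A : Matrix (Fin n) (Fin n) ℤ} {z : Fin n → FreeNil K n r}
    (hz : IsEigenFrame A z) (h : LinearIndependent ℚ (genQ n r)) :
    ∃ α : Fin n → K, (∀ j, matEnd K r A (z j) = α j • z j) ∧
      A.charpoly.map (Int.castRingHom K) = ∏ j, (X - C (α j)) := by
  choose α hα using hz.eigen
  refine ⟨α, hα, ?_⟩
  have hcoord : ∀ j, ∃ v : Fin n → K, ∑ i, v i • gen K n r i = z j := fun j =>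
    (Submodule.mem_span_range_iff_exists_fun K).1
      (show z j ∈ stepOne K n r from hz.span_eq ▸ Submodule.subset_span ⟨j, rfl⟩)
  choose v hv using hcoord
  have hvli : LinearIndependent K v := by
    refine LinearIndependent.of_comp (Fintype.linearCombination K (gen K n r)) ?_
    convert hz.linearIndependent using 1
    funext j
    exact hv j
  let b : Module.Basis (Fin n) K (Fin n → K) := Module.Basis.mk hvli
    (hvli.span_eq_top_of_card_eq_finrank' (by simp)).ge
  have hb : ∀ j, b j = v j := fun j => by simp [b]
  have heig : ∀ j, (A.map (Int.cast : ℤ → K)).mulVec (v j) = α j • v j := by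
    intro j
    have h1 := hα j
    rw [← hv j, matEnd_sum_gen, Finset.smul_sum] at h1
    simp only [smul_smul] at h1
    exact eq_of_sum_gen_eq h h1
  have hdiag : LinearMap.toMatrix b b (Matrix.toLin' (A.map (Int.cast : ℤ → K))) =
      Matrix.diagonal α := by
    ext i j
    rw [LinearMap.toMatrix_apply, Matrix.toLin'_apply, hb, heig, ← hb, map_smul, Finsupp.smul_apply,
      b.repr_self, Matrix.diagonal_apply, Finsupp.single_apply]
    by_cases hij : i = j
    · simp [hij]
    · simp [hij, Ne.symm hij]
  have h1 : (A.map (Int.cast : ℤ → K)).charpoly = A.charpoly.map (Int.castRingHom K) :=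
    Matrix.charpoly_map _ (Int.castRingHom K)
  rw [← h1, ← Matrix.charpoly_toLin', ← LinearMap.charpoly_toMatrix _ b, hdiag]
  exact Matrix.charpoly_diagonal α

end Frames

/-! ### Roots of a hyperbolic unit polynomial -/

section Roots

variable {K : Type*} [Field K] {p : ℤ[X]} {α : K}

theorem isIntegral_of_isRoot (hp : p.Monic) (hα : (p.map (Int.castRingHom K)).IsRoot α) :
    IsIntegral ℤ α :=
  ⟨p, hp, by rwa [IsRoot, eval_map] at hα⟩

theorem inv_eq_of_isRoot (hp : IsUnit (p.coeff 0)) (hα : (p.map (Int.castRingHom K)).IsRoot α) :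
    α ≠ 0 ∧ α⁻¹ = aeval α (-(C (p.coeff 0) * p.divX)) := by
  have h1 : aeval α p = 0 := by
    rwa [IsRoot, eval_map, ← algebraMap_int_eq, ← aeval_def] at hα
  rw [← divX_mul_X_add p, map_add, map_mul, aeval_X, aeval_C] at h1
  have hu : algebraMap ℤ K (p.coeff 0) * algebraMap ℤ K (p.coeff 0) = 1 := by
    rw [← map_mul, Int.isUnit_mul_self hp, map_one]
  have h2 : aeval α (-(C (p.coeff 0) * p.divX)) * α = 1 := by
    rw [map_neg, map_mul, aeval_C]
    linear_combination (-algebraMap ℤ K (p.coeff 0)) * h1 + hu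
  exact ⟨right_ne_zero_of_mul (h2 ▸ one_ne_zero), (eq_inv_of_mul_eq_one_left h2).symm⟩

theorem isIntegral_inv_of_isRoot (hp : p.Monic) (hp0 : IsUnit (p.coeff 0))
    (hα : (p.map (Int.castRingHom K)).IsRoot α) : IsIntegral ℤ α⁻¹ := by
  rw [(inv_eq_of_isRoot hp0 hα).2]
  have h := aeval_subalgebra_coe (-(C (p.coeff 0) * p.divX)) (integralClosure ℤ K)
    ⟨α, isIntegral_of_isRoot hp hα⟩
  rw [← h]
  exact Subtype.property _

theorem pow_ne_one_of_isRoot [Algebra ℚ K] [FiniteDimensional ℚ K]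
    (hyp : ∀ μ : ℂ, (p.map (Int.castRingHom ℂ)).IsRoot μ → ‖μ‖ ≠ 1)
    (hα : (p.map (Int.castRingHom K)).IsRoot α) {N : ℕ} (hN : 0 < N) : α ^ N ≠ 1 := by
  intro h
  let τ : K →ₐ[ℚ] ℂ := IsAlgClosed.lift
  refine hyp (τ α) ?_ (Complex.norm_eq_one_of_pow_eq_one (n := N) (by rw [← map_pow, h, map_one]) hN.ne')
  have h1 := hα.map (f := (τ : K →+* ℂ))
  rwa [Polynomial.map_map, RingHom.ext_int ((τ : K →+* ℂ).comp (Int.castRingHom K))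
    (Int.castRingHom ℂ)] at h1

/-- There is no nontrivial multiplicative relation `∏ α j ^ e j = 1`, apart from those with constant
exponents. -/
def RelationsTrivial {n : ℕ} (α : Fin n → K) : Prop :=
  ∀ e : Fin n → ℤ, ∏ j, α j ^ e j = 1 → ∀ i j, e i = e j

theorem RelationsTrivial.exists_add {n : ℕ} {α : Fin n → K} (h : RelationsTrivial α)
    (hα0 : ∀ j, α j ≠ 0) {c d : Fin n → ℕ} (hcd : ∏ j, α j ^ c j = ∏ j, α j ^ d j) :
    ∃ k : ℤ, ∀ j, (c j : ℤ) = d j + k := by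
  rcases isEmpty_or_nonempty (Fin n) with hn | ⟨⟨o⟩⟩
  · exact ⟨0, fun j => isEmptyElim j⟩
  · have h1 : ∏ j, α j ^ ((c j : ℤ) - d j) = 1 := by
      simp only [zpow_sub₀ (hα0 _), zpow_natCast, Finset.prod_div_distrib]
      rw [hcd, div_self (Finset.prod_ne_zero_iff.2 fun j _ => pow_ne_zero _ (hα0 j))]
    refine ⟨(c o : ℤ) - d o, fun j => ?_⟩
    have := h _ h1 j o
    linarith

variable [Algebra ℚ K] [FiniteDimensional ℚ K] [IsGalois ℚ K] {n : ℕ}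

theorem relationsTrivial_of_cyclic (hn : n.Prime) (σ : K ≃ₐ[ℚ] K) (hσ : σ ^ n = 1)
    (hσG : ∀ g : K ≃ₐ[ℚ] K, g ∈ Subgroup.zpowers σ) (α : Fin n → K)
    (hint : ∀ j, IsIntegral ℤ (α j)) (hint' : ∀ j, IsIntegral ℤ (α j)⁻¹) (hα0 : ∀ j, α j ≠ 0)
    (htor : ∀ j, ∀ N : ℕ, 0 < N → α j ^ N ≠ 1)
    (hα : ∀ j, σ (α j) = α (finRotate n j)) : RelationsTrivial α := by
  intro e he i j
  by_contra hij
  obtain ⟨N, hN, hpow⟩ := pow_eq_pow_of_cyclic hn σ hσ α hα0 hα e he hij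
  refine htor i (2 * N) (by omega) (pow_eq_one_of_pow_eq_pow α hint hint' hα0 ?_ hpow i)
  intro g j
  have : g ∈ Submonoid.powers σ := by
    have : Finite (K ≃ₐ[ℚ] K) := inferInstance
    rw [mem_powers_iff_mem_zpowers]
    exact hσG g
  obtain ⟨m, rfl⟩ := this
  simp only
  induction m with
  | zero => exact ⟨j, rfl⟩
  | succ m ih =>
    obtain ⟨k, hk⟩ := ih
    exact ⟨finRotate n k, by rw [pow_succ', AlgEquiv.mul_apply, hk, hα]⟩

theorem relationsTrivial_of_symmetric (α : Fin n → K)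
    (hint : ∀ j, IsIntegral ℤ (α j)) (hint' : ∀ j, IsIntegral ℤ (α j)⁻¹) (hα0 : ∀ j, α j ≠ 0)
    (htor : ∀ j, ∀ N : ℕ, 0 < N → α j ^ N ≠ 1)
    (hgal : ∀ (g : K ≃ₐ[ℚ] K) j, ∃ k, g (α j) = α k)
    (hα : ∀ π : Equiv.Perm (Fin n), ∃ g : K ≃ₐ[ℚ] K, ∀ j, g (α j) = α (π j)) :
    RelationsTrivial α := by
  intro e he i j
  by_contra hij
  obtain ⟨N, hN, hpow⟩ := pow_eq_pow_of_symmetric α hα0 hα e he hij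
  exact htor i (2 * N) (by omega) (pow_eq_one_of_pow_eq_pow α hint hint' hα0 hgal hpow i)

end Roots

/-! ### Rational invariant ideals are of cyclic type -/

section CyclicType

open LieModule

variable {n r : ℕ} {K : Type*} [Field K] [Algebra ℚ K]

/-- Eigenvectors of a diagonal map without nontrivial relations between its entries are weight
vectors. -/
theorem isWeightVector_of_mem_span {z : Fin n → FreeNil K n r} {α : Fin n → K}
    (hrel : RelationsTrivial α) (hα0 : ∀ j, α j ≠ 0) {μ : K} {w : FreeNil K n r}
    (hw : w ∈ Submodule.span K (bracketEval z '' {t | ∏ j, α j ^ letterCount j t = μ})) :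
    IsWeightVector z w := by
  by_cases h : ∃ t₀ : FreeMagma (Fin n), ∏ j, α j ^ letterCount j t₀ = μ
  · obtain ⟨t₀, rfl⟩ := h
    refine ⟨fun j => letterCount j t₀, Submodule.span_mono ?_ hw⟩
    rintro _ ⟨t, ht, rfl⟩
    exact ⟨t, hrel.exists_add hα0 ht, rfl⟩
  · push Not at h
    have h1 : {t : FreeMagma (Fin n) | ∏ j, α j ^ letterCount j t = μ} = ∅ :=
      Set.eq_empty_of_forall_notMem fun t ht => h t ht
    rw [h1, Set.image_empty] at hw
    exact ⟨0, Submodule.span_mono (Set.empty_subset _) hw⟩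

/-- If the eigenvalues on a cyclic frame satisfy no nontrivial multiplicative relation, the
eigenvectors in the free nilpotent Lie algebra are weight vectors, so a rational invariant ideal is
generated by the rational points of orbits of weight vectors. -/
theorem isCyclicTypeIdealFor_of_invariant [FiniteDimensional ℚ K] {z : Fin n → FreeNil K n r}
    (hz : IsCyclicFrame z)
    {A : Matrix (Fin n) (Fin n) ℤ} {α : Fin n → K} (heig : ∀ j, matEnd K r A (z j) = α j • z j)
    (hrel : RelationsTrivial α) (hα0 : ∀ j, α j ≠ 0) {J : LieIdeal ℚ (FreeNilQ n r)}
    (hJ : ∀ x ∈ J, matEndQ r A x ∈ J) :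
    IsCyclicTypeIdealFor LieEquiv.refl z (J.baseChange ℝ) := by
  have := hz.isGalois
  set JK : Submodule K (FreeNil K n r) := J.toSubmodule.baseChange K with hJK
  have hJKinv : ∀ x ∈ JK, matEnd K r A x ∈ JK := by
    intro x hx
    have h1 : JK ≤ JK.comap (matEnd K r A) := baseChange_le_iff.2 fun v hv => by
      rw [Submodule.mem_comap, matEnd, LinearMap.baseChange_tmul]
      exact Submodule.tmul_mem_baseChange_of_mem 1 (hJ v hv)
    exact h1 hx
  let W : Set (FreeNil K n r) := {w | w ∈ JK ∧ IsWeightVector z w}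
  have hrat : ∀ w ∈ W, ratPart (orbitSpan w) ≤ J.toSubmodule := by
    intro w hw
    rw [← ratPart_baseChange (K := K) J.toSubmodule]
    exact ratPart_mono (orbitSpan_le (fun g x hx => galAct_mem_baseChange g hx) hw.1)
  have hJle : J.toSubmodule ≤ ⨆ w : W, ratPart (orbitSpan (w : FreeNil K n r)) := by
    rw [← baseChange_le_baseChange (K := K), baseChange_iSup]
    intro x hx
    have hspan : x ∈ Submodule.span K (Set.range (bracketEval z)) := by
      rw [span_bracketEval_freeNil hz.span_eq]; exact Submodule.mem_top
    have h1 := mem_iSup_inf_span (matEnd_bracketEval heig) hJKinv hx hspan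
    have hle : (⨆ μ : K, JK ⊓ Submodule.span K (bracketEval z ''
        {t | ∏ j, α j ^ letterCount j t = μ})) ≤
        ⨆ w : W, (ratPart (orbitSpan (w : FreeNil K n r))).baseChange K := ?_
    · exact hle h1
    refine iSup_le fun μ => ?_
    rintro w ⟨hwJ, hw⟩
    have hwW : w ∈ W := ⟨hwJ, isWeightVector_of_mem_span hrel hα0 hw⟩
    refine Submodule.mem_iSup_of_mem
      (p := fun w : W => (ratPart (orbitSpan (w : FreeNil K n r))).baseChange K) ⟨w, hwW⟩ ?_
    rw [(isRational_orbitSpan w : (ratPart (orbitSpan w)).baseChange K = orbitSpan w)]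
    exact mem_orbitSpan w
  refine ⟨hz, W, fun w hw => hw.2, le_antisymm ?_ ?_⟩
  · set I := LieSubmodule.lieSpan ℝ (FreeNil ℝ n r)
      (⋃ w ∈ W, (LieEquiv.refl : FreeNil ℝ n r ≃ₗ⁅ℝ⁆ _) '' (toReal (orbitSpan w) : Set (FreeNil ℝ n r)))
      with hI
    have h1 : J.toSubmodule ≤ (I.toSubmodule.restrictScalars ℚ).comap
        (TensorProduct.mk ℚ ℝ (FreeNilQ n r) 1) := by
      refine hJle.trans (iSup_le fun w v hv => ?_)
      refine LieSubmodule.subset_lieSpan (Set.mem_biUnion w.2 ⟨(1 : ℝ) ⊗ₜ v, ?_, rfl⟩)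
      exact Submodule.tmul_mem_baseChange_of_mem 1 hv
    exact (baseChange_le_iff (K := ℝ) (E := I.toSubmodule)).2 h1
  · rw [LieSubmodule.lieSpan_le]
    refine Set.iUnion₂_subset fun w hw => ?_
    rintro _ ⟨x, hx, rfl⟩
    exact Submodule.baseChange_mono ℝ (hrat w hw) hx

end CyclicType

/-! ### Splitting fields with cyclic Galois group -/

section SplittingField

theorem exists_matrix_charpoly {p : ℤ[X]} (hp : p.Monic) {n : ℕ} (hn : p.natDegree = n) :
    ∃ A : Matrix (Fin n) (Fin n) ℤ, A.charpoly = p := by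
  let B := AdjoinRoot.powerBasis' hp
  have hdim : B.dim = n := hn
  have hroot : B.gen = AdjoinRoot.root p := rfl
  refine ⟨Matrix.reindex (finCongr hdim) (finCongr hdim) (Algebra.leftMulMatrix B.basis B.gen), ?_⟩
  rw [Matrix.charpoly_reindex]
  have h1 : p ∣ (Algebra.leftMulMatrix B.basis B.gen).charpoly := by
    rw [← AdjoinRoot.mk_eq_zero, ← AdjoinRoot.aeval_eq, charpoly_leftMulMatrix, ← hroot,
      minpoly.aeval]
  refine (eq_of_monic_of_dvd_of_natDegree_le hp (Matrix.charpoly_monic _) h1 ?_)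
  rw [Matrix.charpoly_natDegree_eq_dim, Fintype.card_fin, hdim, hn]

variable {p : ℤ[X]} {n : ℕ}

theorem isRoot_map_int_iff {K : Type*} [Field K] [Algebra ℚ K] {x : K} (hp : p.Monic) :
    (p.map (Int.castRingHom K)).IsRoot x ↔ x ∈ (ratPoly p).rootSet K := by
  rw [mem_rootSet, and_iff_right (hp.map _).ne_zero, aeval_def, eval₂_map, IsRoot, eval_map,
    RingHom.ext_int ((algebraMap ℚ K).comp (Int.castRingHom ℚ)) (Int.castRingHom K)]

theorem card_rootSet_ratPoly (K : Type*) [Field K] [Algebra ℚ K] [IsSplittingField ℚ K (ratPoly p)]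
    (hn : p.natDegree = n) (hirr : Irreducible (ratPoly p)) :
    Fintype.card ((ratPoly p).rootSet K) = n := by
  rw [card_rootSet_eq_natDegree hirr.separable (IsSplittingField.splits K _),
    natDegree_map_eq_of_injective Int.cast_injective, hn]

theorem algEquiv_mem_rootSet {K : Type*} [Field K] [Algebra ℚ K] {q : ℚ[X]} (g : K ≃ₐ[ℚ] K) {x : K}
    (hx : x ∈ q.rootSet K) : g x ∈ q.rootSet K := by
  rw [mem_rootSet] at hx ⊢
  refine ⟨hx.1, ?_⟩
  have := aeval_algHom_apply (g : K →ₐ[ℚ] K) x q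
  rw [hx.2, map_zero] at this
  exact this

theorem exists_algEquiv_apply_eq {K : Type*} [Field K] [Algebra ℚ K] [Normal ℚ K]
    {q : ℚ[X]} (hirr : Irreducible q) {x y : K} (hx : x ∈ q.rootSet K) (hy : y ∈ q.rootSet K) :
    ∃ g : K ≃ₐ[ℚ] K, g x = y := by
  have hx' := minpoly.eq_of_irreducible hirr (mem_rootSet.mp hx).2
  have hy' := minpoly.eq_of_irreducible hirr (mem_rootSet.mp hy).2
  obtain ⟨g, hg⟩ := (Normal.minpoly_eq_iff_mem_orbit K).mp (hy'.symm.trans hx')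
  exact ⟨g, hg⟩

theorem algEquiv_eq_of_rootSet {K : Type*} [Field K] [Algebra ℚ K] {q : ℚ[X]}
    [IsSplittingField ℚ K q] {g h : K ≃ₐ[ℚ] K} (hgh : ∀ x ∈ q.rootSet K, g x = h x) : g = h := by
  have h1 : (g : K →ₐ[ℚ] K) = h :=
    AlgHom.ext_of_adjoin_eq_top (IsSplittingField.adjoin_rootSet K q) hgh
  exact AlgEquiv.ext fun x => DFunLike.congr_fun h1 x

theorem apply_finRotate {X : Type*} (f : ℕ → X) (h : f n = f 0) (j : Fin n) :
    f (finRotate n j) = f (j + 1) := by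
  obtain ⟨m, rfl⟩ : ∃ m, n = m + 1 := ⟨n - 1, by have := j.2; omega⟩
  rw [coe_finRotate]
  split_ifs with hj
  · rw [hj, Fin.val_last, h]
  · rfl

/-- If the Galois group is cyclic, hence abelian, it acts simply transitively on the roots. -/
theorem exists_generator_of_isCyclic {K : Type*} [Field K] [Algebra ℚ K]
    [IsSplittingField ℚ K (ratPoly p)] (hn : p.natDegree = n) (hirr : Irreducible (ratPoly p))
    (hcyc : IsCyclic (K ≃ₐ[ℚ] K)) :
    Module.finrank ℚ K = n ∧ ∃ (σ : K ≃ₐ[ℚ] K) (a : K),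
      (∀ g : K ≃ₐ[ℚ] K, g ∈ Subgroup.zpowers σ) ∧ σ ^ n = 1 ∧ a ∈ (ratPoly p).rootSet K ∧
      Function.Injective fun j : Fin n => (σ ^ (j : ℕ)) a := by
  have : FiniteDimensional ℚ K := IsSplittingField.finiteDimensional K (ratPoly p)
  have : IsGalois ℚ K := IsGalois.of_separable_splitting_field hirr.separable
  obtain ⟨σ, hσ⟩ := hcyc.exists_generator
  have hcomm : ∀ g h : K ≃ₐ[ℚ] K, g * h = h * g := by
    intro g h
    obtain ⟨i, rfl⟩ := hσ g
    obtain ⟨j, rfl⟩ := hσ h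
    exact zpow_mul_comm σ i j
  obtain ⟨a, ha⟩ : ∃ a, a ∈ (ratPoly p).rootSet K := by
    have h1 : 0 < Fintype.card ((ratPoly p).rootSet K) := by
      rw [card_rootSet_ratPoly K hn hirr, ← hn,
        ← natDegree_map_eq_of_injective (f := Int.castRingHom ℚ) Int.cast_injective]
      exact hirr.natDegree_pos
    obtain ⟨⟨a, ha⟩⟩ := Fintype.card_pos_iff.1 h1
    exact ⟨a, ha⟩
  let φ : (K ≃ₐ[ℚ] K) → (ratPoly p).rootSet K := fun g => ⟨g a, algEquiv_mem_rootSet g ha⟩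
  have hφinj : Function.Injective φ := by
    intro g h hgh
    refine algEquiv_eq_of_rootSet (q := ratPoly p) fun x hx => ?_
    obtain ⟨k, rfl⟩ := exists_algEquiv_apply_eq hirr ha hx
    have h1 : g a = h a := congrArg Subtype.val hgh
    change (g * k) a = (h * k) a
    rw [hcomm g k, hcomm h k]
    exact congrArg k h1
  have hφsurj : Function.Surjective φ := by
    rintro ⟨x, hx⟩
    obtain ⟨k, hk⟩ := exists_algEquiv_apply_eq hirr ha hx
    exact ⟨k, Subtype.ext hk⟩
  have hcard : Nat.card (K ≃ₐ[ℚ] K) = n := by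
    rw [Nat.card_congr (Equiv.ofBijective φ ⟨hφinj, hφsurj⟩), Nat.card_eq_fintype_card,
      card_rootSet_ratPoly K hn hirr]
  have hord : orderOf σ = n := by rw [orderOf_eq_card_of_forall_mem_zpowers hσ, hcard]
  refine ⟨by rw [← IsGalois.card_aut_eq_finrank, hcard], σ, a, hσ, ?_, ha, ?_⟩
  · rw [← hord, pow_orderOf_eq_one]
  · intro i j hij
    have h1 : σ ^ (i : ℕ) = σ ^ (j : ℕ) := hφinj (Subtype.ext hij)
    exact Fin.ext (pow_injOn_Iio_orderOf (by rw [hord]; exact i.2) (by rw [hord]; exact j.2) h1)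

theorem galAct_pow {r : ℕ} {K : Type*} [Field K] [Algebra ℚ K] (σ : K ≃ₐ[ℚ] K) (k : ℕ) (x : FreeNil K n r) :
    galAct (σ ^ (k + 1)) x = galAct σ (galAct (σ ^ k) x) := by
  rw [pow_succ', galAct_mul]

/-- Stated for the default `ℚ`-algebra structure of the field, which is only propositionally equal to
the one of the splitting field construction. -/
theorem isSplittingField_ratPoly (p : ℤ[X]) :
    IsSplittingField ℚ (ratPoly p).SplittingField (ratPoly p) := by
  have h := IsSplittingField.splittingField (ratPoly p)
  convert h
  exact Subsingleton.elim _ _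

theorem nonempty_gal_mulEquiv (p : ℤ[X]) (K : Type*) [Field K] [Algebra ℚ K]
    [IsSplittingField ℚ K (ratPoly p)] : Nonempty ((ratPoly p).Gal ≃* (K ≃ₐ[ℚ] K)) :=
  ⟨AlgEquiv.autCongr (IsSplittingField.algEquiv K (ratPoly p)).symm⟩

variable {𝔫 : Type*} [LieRing 𝔫] [LieAlgebra ℝ 𝔫] [FiniteDimensional ℝ 𝔫]

/-- A Galois orbit of an eigenvector in the first step is a cyclic frame, so the kernel of the
presentation by a free nilpotent Lie algebra is an ideal of cyclic type. -/
theorem exists_cyclicType {r : ℕ} {f : 𝔫 ≃ₗ⁅ℝ⁆ 𝔫} (hr : IsStepNilpotent 𝔫 r)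
    (hf : IsAnosovAut f) (hss : Module.End.IsSemisimple ((f : 𝔫 →ₗ⁅ℝ⁆ 𝔫) : 𝔫 →ₗ[ℝ] 𝔫))
    (hp : IsFirstPoly f p) (hn : p.natDegree = n) (hirr : Irreducible p) (hprime : n.Prime)
    (hcyc : IsCyclic (ratPoly p).Gal) :
    ∃ I : LieIdeal ℝ (FreeNil ℝ n r), IsCyclicTypeIdeal I ∧
      Nonempty (𝔫 ≃ₗ⁅ℝ⁆ (FreeNil ℝ n r ⧸ I)) := by
  obtain ⟨hmonic, hunit, hyp, hpres⟩ := exists_presentation hr hf hss hp hn hirr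
  have hirrQ : Irreducible (ratPoly p) :=
    (hmonic.irreducible_iff_irreducible_map_fraction_map (K := ℚ)).1 hirr
  obtain ⟨A, hA⟩ := exists_matrix_charpoly hmonic hn
  obtain ⟨J, hJ, -, hgen, -, hiso⟩ := hpres A hA
  let K := (ratPoly p).SplittingField
  have hsplit : IsSplittingField ℚ K (ratPoly p) := isSplittingField_ratPoly p
  have hcycK : IsCyclic (K ≃ₐ[ℚ] K) := by
    obtain ⟨E⟩ := nonempty_gal_mulEquiv p K
    exact isCyclic_of_surjective E E.surjective
  obtain ⟨hfin, σ, a, hσ, hσn, ha, hinj⟩ := exists_generator_of_isCyclic hn hirrQ hcycK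
  refine ⟨J.baseChange ℝ, ⟨K, inferInstance, inferInstance, LieEquiv.refl, ?_⟩, hiso⟩
  have : FiniteDimensional ℚ K := IsSplittingField.finiteDimensional K (ratPoly p)
  have hgal : IsGalois ℚ K := IsGalois.of_separable_splitting_field hirrQ.separable
  have haroot : (A.charpoly.map (Int.castRingHom K)).IsRoot a := by
    rw [hA]; exact (isRoot_map_int_iff hmonic).2 ha
  obtain ⟨w, hw, hw0, hwa⟩ := exists_eigenvector (r := r) hgen
    haroot
  let α : Fin n → K := fun j => (σ ^ (j : ℕ)) a
  let z : Fin n → FreeNil K n r := fun j => galAct (σ ^ (j : ℕ)) w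
  have hroot : ∀ j, (p.map (Int.castRingHom _)).IsRoot (α j) := fun j =>
    (isRoot_map_int_iff hmonic).2 (algEquiv_mem_rootSet _ ha)
  have heig : ∀ j, matEnd _ r A (z j) = α j • z j := by
    intro j
    rw [← galAct_matEnd, hwa, galAct_smul]
  have hz0 : ∀ j, z j ≠ 0 := by
    intro j h
    apply hw0
    have := congrArg (galAct (σ ^ (j : ℕ))⁻¹) h
    rwa [← galAct_mul, inv_mul_cancel, galAct_one, map_zero] at this
  obtain ⟨hli, hspan⟩ := linearIndependent_and_span_of_eigen hinj
    (fun j => galAct_mem_stepOne _ hw) hz0 heig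
  have hα0 : ∀ j, α j ≠ 0 := fun j => (inv_eq_of_isRoot hunit (hroot j)).1
  have hframe : IsCyclicFrame z :=
    { isGalois := hgal
      finrank_eq := hfin
      linearIndependent := hli
      span_eq := hspan
      cyclic := ⟨σ, hσ, fun j => by
        have := apply_finRotate (fun k => galAct (σ ^ k) w) (by rw [hσn, pow_zero]) j
        exact (galAct_pow σ j w).symm.trans this.symm⟩ }
  refine ⟨z, isCyclicTypeIdealFor_of_invariant hframe heig ?_ hα0 hJ⟩
  refine relationsTrivial_of_cyclic hprime σ hσn hσ α
    (fun j => isIntegral_of_isRoot hmonic (hroot j))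
    (fun j => isIntegral_inv_of_isRoot hmonic hunit (hroot j)) hα0
    (fun j N hN => pow_ne_one_of_isRoot hyp (hroot j) hN) fun j => ?_
  have := apply_finRotate (fun k => (σ ^ k) a) (by rw [hσn, pow_zero]) j
  refine Eq.trans ?_ this.symm
  rw [pow_succ']
  rfl

end SplittingField

/-! ### Frames permuted by the full symmetric group -/

section Symmetric

open LieModule

/-- Monomials of degrees that differ by less than `n` are determined by their values: adding a constant
to all exponents changes the degree by a multiple of `n`. -/
theorem RelationsTrivial.eq_of_prod_eq {K : Type*} [Field K] {n : ℕ} {α : Fin n → K}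
    (h : RelationsTrivial α) (hα0 : ∀ j, α j ≠ 0) {s t : Multiset (Fin n)}
    (hst : (s.map α).prod = (t.map α).prod) (h1 : s.card < t.card + n) (h2 : t.card < s.card + n) :
    s = t := by
  have hprod : ∀ u : Multiset (Fin n), (u.map α).prod = ∏ j, α j ^ u.count j := fun u => by
    rw [Finset.prod_multiset_map_count]
    refine Finset.prod_subset (Finset.subset_univ _) fun x _ hx => ?_
    rw [Multiset.count_eq_zero.2 (by simpa using hx), pow_zero]
  rw [hprod, hprod] at hst
  obtain ⟨k, hk⟩ := h.exists_add hα0 hst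
  have hcard : (s.card : ℤ) = t.card + n * k := by
    rw [← Multiset.sum_count_eq_card (s := Finset.univ) (m := s) fun _ _ => Finset.mem_univ _,
      ← Multiset.sum_count_eq_card (s := Finset.univ) (m := t) fun _ _ => Finset.mem_univ _]
    push_cast
    simp [hk, Finset.sum_add_distrib]
  have hk0 : k = 0 := by
    by_contra hne
    rcases lt_or_gt_of_ne hne with h | h
    · nlinarith
    · nlinarith
  ext j
  have := hk j
  omega

theorem isSemisimple_of_span_eigen {K V ι : Type*} [Field K] [AddCommGroup V] [Module K V]
    [FiniteDimensional K V] {f : Module.End K V} {v : ι → V} {c : ι → K}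
    (hv : ∀ i, f (v i) = c i • v i) (hspan : Submodule.span K (Set.range v) = ⊤) :
    f.IsSemisimple := by
  classical
  let P : K[X] := ∏ μ ∈ f.finite_hasEigenvalue.toFinset, (X - C μ)
  have hP : P.Separable := separable_prod_X_sub_C_iff'.2 fun _ _ _ _ h => h
  refine Module.End.isSemisimple_of_squarefree_aeval_eq_zero hP.squarefree ?_
  refine LinearMap.ext_on_range hspan fun i => ?_
  by_cases h0 : v i = 0
  · simp [h0]
  · have hev : f.HasEigenvector (c i) (v i) := ⟨Module.End.mem_eigenspace_iff.2 (hv i), h0⟩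
    rw [LinearMap.zero_apply, Module.End.aeval_apply_of_hasEigenvector hev]
    have : P.eval (c i) = 0 := by
      rw [eval_prod]
      refine Finset.prod_eq_zero (i := c i) ?_ (by simp)
      simpa using Module.End.hasEigenvalue_of_hasEigenvector hev
    rw [this, zero_smul]

variable {n r : ℕ} {K : Type*} [Field K] [Algebra ℚ K]

/-- An eigenframe of `f^A` with multiplicatively independent eigenvalues `α` that the Galois group
permutes, up to scalars, by all permutations. -/
structure IsSymmetricFrame (A : Matrix (Fin n) (Fin n) ℤ) (z : Fin n → FreeNil K n r)
    (α : Fin n → K) : Prop where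
  span_eq : Submodule.span K (Set.range z) = stepOne K n r
  eigen : ∀ j, matEnd K r A (z j) = α j • z j
  ne_zero : ∀ j, α j ≠ 0
  relations : RelationsTrivial α
  exists_perm : ∀ g : K ≃ₐ[ℚ] K, ∃ (π : Equiv.Perm (Fin n)) (c : Fin n → K),
    (∀ j, c j ≠ 0) ∧ ∀ j, galAct g (z j) = c j • z (π j)
  exists_galAct : ∀ π : Equiv.Perm (Fin n), ∃ (g : K ≃ₐ[ℚ] K) (c : Fin n → K),
    (∀ j, c j ≠ 0) ∧ ∀ j, galAct g (z j) = c j • z (π j)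

theorem galAct_injective (g : K ≃ₐ[ℚ] K) : Function.Injective (galAct (n := n) (r := r) g) := by
  intro x y h
  have := congrArg (galAct g⁻¹) h
  rwa [← galAct_mul, ← galAct_mul, inv_mul_cancel, galAct_one, galAct_one] at this

/-- An eigenframe for the roots of a polynomial with Galois group `S_n` is symmetric. -/
theorem isSymmetricFrame_of_eigen {p : ℤ[X]} [IsSplittingField ℚ K (ratPoly p)]
    {A : Matrix (Fin n) (Fin n) ℤ} {z : Fin n → FreeNil K n r} {α : Fin n → K}
    (hmonic : p.Monic) (hunit : IsUnit (p.coeff 0))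
    (hirr : Irreducible (ratPoly p))
    (hyp : ∀ μ : ℂ, (p.map (Int.castRingHom ℂ)).IsRoot μ → ‖μ‖ ≠ 1)
    (hsym : Nonempty ((ratPoly p).Gal ≃* Equiv.Perm (Fin n)))
    (hspan : Submodule.span K (Set.range z) = stepOne K n r) (hli : LinearIndependent K z)
    (heig : ∀ j, matEnd K r A (z j) = α j • z j)
    (hα : p.map (Int.castRingHom K) = ∏ j, (X - C (α j))) : IsSymmetricFrame A z α := by
  classical
  have : FiniteDimensional ℚ K := IsSplittingField.finiteDimensional K (ratPoly p)
  have hgal : IsGalois ℚ K := IsGalois.of_separable_splitting_field hirr.separable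
  have hroot : ∀ x, x ∈ (ratPoly p).rootSet K ↔ ∃ j, α j = x := by
    intro x
    rw [← isRoot_map_int_iff hmonic, hα, IsRoot, eval_prod, Finset.prod_eq_zero_iff]
    simp [sub_eq_zero, eq_comm]
  have hinj : Function.Injective α := by
    rw [← separable_prod_X_sub_C_iff, ← hα]
    have h := hirr.separable.map (f := algebraMap ℚ K)
    rwa [Polynomial.map_map, RingHom.ext_int ((algebraMap ℚ K).comp (Int.castRingHom ℚ))
      (Int.castRingHom K)] at h
  have hisroot : ∀ j, (p.map (Int.castRingHom K)).IsRoot (α j) := fun j =>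
    (isRoot_map_int_iff hmonic).2 ((hroot _).2 ⟨j, rfl⟩)
  -- The permutation of the indices induced by a Galois automorphism.
  have hidx : ∀ g : K ≃ₐ[ℚ] K, ∃ π : Equiv.Perm (Fin n), ∀ j, g (α j) = α (π j) := by
    intro g
    choose π hπ using fun j => (hroot (g (α j))).1
      (algEquiv_mem_rootSet g ((hroot _).2 ⟨j, rfl⟩))
    have hπinj : Function.Injective π := fun i j hij => hinj (g.injective (by
      rw [← hπ, ← hπ, hij]))
    exact ⟨Equiv.ofBijective π (Finite.injective_iff_bijective.1 hπinj), fun j => (hπ j).symm⟩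
  choose Φ hΦ using hidx
  have hΦinj : Function.Injective Φ := by
    intro g h hgh
    refine algEquiv_eq_of_rootSet (q := ratPoly p) fun x hx => ?_
    obtain ⟨j, rfl⟩ := (hroot x).1 hx
    rw [hΦ, hΦ, hgh]
  have hΦbij : Function.Bijective Φ := by
    have hcard : Nat.card (K ≃ₐ[ℚ] K) = Nat.card (Equiv.Perm (Fin n)) := by
      obtain ⟨E⟩ := hsym
      obtain ⟨E'⟩ := nonempty_gal_mulEquiv p K
      exact Nat.card_congr (E'.symm.trans E).toEquiv
    exact (Nat.bijective_iff_injective_and_card Φ).2 ⟨hΦinj, hcard⟩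
  -- Eigenvalues are distinct, so eigenvectors are determined up to scalars.
  have hact : ∀ g : K ≃ₐ[ℚ] K, ∃ c : Fin n → K,
      (∀ j, c j ≠ 0) ∧ ∀ j, galAct g (z j) = c j • z (Φ g j) := by
    intro g
    have h1 : ∀ j, ∃ c : K, galAct g (z j) = c • z (Φ g j) := by
      intro j
      have hmem : galAct g (z j) ∈ Submodule.span K (Set.range z) := by
        rw [hspan]
        exact galAct_mem_stepOne g (hspan ▸ Submodule.subset_span ⟨j, rfl⟩)
      obtain ⟨c, hc⟩ := (Submodule.mem_span_range_iff_exists_fun K).1 hmem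
      have h2 : matEnd K r A (galAct g (z j)) = α (Φ g j) • galAct g (z j) := by
        rw [← galAct_matEnd, heig, galAct_smul, hΦ]
      have h3 : ∑ k, (c k * α k) • z k = ∑ k, (α (Φ g j) * c k) • z k := by
        rw [← hc, map_sum, Finset.smul_sum] at h2
        simpa only [map_smul, heig, smul_smul] using h2
      have h4 := Fintype.linearIndependent_iffₛ.1 hli _ _ h3
      refine ⟨c (Φ g j), ?_⟩
      rw [← hc]
      refine Finset.sum_eq_single _ (fun k _ hk => ?_) (fun h => absurd (Finset.mem_univ _) h)
      have h5 : c k * (α k - α (Φ g j)) = 0 := by linear_combination h4 k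
      rcases mul_eq_zero.1 h5 with h | h
      · rw [h, zero_smul]
      · exact absurd (hinj (sub_eq_zero.1 h)) hk
    choose c hc using h1
    refine ⟨c, fun j h0 => hli.ne_zero j (galAct_injective g ?_), hc⟩
    rw [hc, h0, zero_smul, map_zero]
  have hα0 : ∀ j, α j ≠ 0 := fun j => (inv_eq_of_isRoot hunit (hisroot j)).1
  refine ⟨hspan, heig, hα0, ?_, fun g => ⟨Φ g, hact g⟩, fun π => ?_⟩
  · refine relationsTrivial_of_symmetric α (fun j => isIntegral_of_isRoot hmonic (hisroot j))
      (fun j => isIntegral_inv_of_isRoot hmonic hunit (hisroot j)) hα0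
      (fun j N hN => pow_ne_one_of_isRoot hyp (hisroot j) hN) (fun g j => ⟨Φ g j, hΦ g j⟩)
      fun π => ?_
    obtain ⟨g, rfl⟩ := hΦbij.2 π
    exact ⟨g, hΦ g⟩
  · obtain ⟨g, rfl⟩ := hΦbij.2 π
    exact ⟨g, hact g⟩

end Symmetric

/-! ### Invariant subspaces of the second and third step -/

section Steps

open LieModule

variable {n r : ℕ} {K : Type*} [Field K]

theorem normedSpan_one_le {L : Type*} [LieRing L] [LieAlgebra K L] (z : Fin n → L) :
    normedSpan K z 1 ≤ Submodule.span K (Set.range fun t : Fin n × Fin n => ⁅z t.1, z t.2⁆) := by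
  refine iSup_le fun i => ?_
  rw [normedSpan, Submodule.map_span_le]
  rintro _ ⟨j, rfl⟩
  exact Submodule.subset_span ⟨(i, j), rfl⟩

theorem normedSpan_two_le {L : Type*} [LieRing L] [LieAlgebra K L] (z : Fin n → L) :
    normedSpan K z 2 ≤
      Submodule.span K (Set.range fun t : Fin n × Fin n × Fin n => ⁅⁅z t.1, z t.2.1⁆, z t.2.2⁆) := by
  refine iSup_le fun k => (Submodule.map_mono (normedSpan_one_le z)).trans ?_
  rw [Submodule.map_span_le]
  rintro _ ⟨⟨i, j⟩, rfl⟩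
  rw [toEnd_apply_apply, ← lie_skew]
  exact Submodule.neg_mem _ (Submodule.subset_span ⟨(i, j, k), rfl⟩)

theorem mem_of_smul_mem {V : Type*} [AddCommGroup V] [Module K V] {E : Submodule K V} {c : K} {x : V}
    (hc : c ≠ 0) (h : c • x ∈ E) : x ∈ E := by
  simpa [smul_smul, inv_mul_cancel₀ hc] using E.smul_mem c⁻¹ h

theorem smul_lie_smul {L : Type*} [LieRing L] [LieAlgebra K L] (a b : K) (x y : L) :
    ⁅a • x, b • y⁆ = (a * b) • ⁅x, y⁆ := by
  rw [smul_lie, lie_smul, smul_smul]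

theorem lie_lie_swap {L : Type*} [LieRing L] (a b c : L) :
    ⁅⁅a, c⁆, b⁆ = ⁅⁅a, b⁆, c⁆ - ⁅⁅c, b⁆, a⁆ := by
  rw [lie_lie a c b, ← lie_skew c ⁅a, b⁆, ← lie_skew a ⁅c, b⁆]
  abel

variable [Algebra ℚ K]

/- The following identities are restated for the module structure of a tensor product. -/

theorem freeNil_smul_lie_smul (a b : K) (x y : FreeNil K n r) :
    ⁅a • x, b • y⁆ = (a * b) • ⁅x, y⁆ := smul_lie_smul a b x y

theorem freeNil_lie_skew (x y : FreeNil K n r) : -⁅y, x⁆ = ⁅x, y⁆ := lie_skew x y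

theorem freeNil_lie_self_lie (x y : FreeNil K n r) : ⁅⁅x, x⁆, y⁆ = 0 := by
  rw [lie_self x]
  exact zero_lie y

theorem freeNil_lie_lie_swap (a b c : FreeNil K n r) :
    ⁅⁅a, c⁆, b⁆ = ⁅⁅a, b⁆, c⁆ - ⁅⁅c, b⁆, a⁆ := lie_lie_swap a b c

theorem freeNil_lie_skew_lie (x y w : FreeNil K n r) : -⁅⁅y, x⁆, w⁆ = ⁅⁅x, y⁆, w⁆ := by
  rw [← freeNil_lie_skew x y]
  exact (neg_lie ⁅y, x⁆ w).symm

theorem lcs_freeNil_of_le (k : ℕ) (hk : r ≤ k) :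
    lowerCentralSeries K (FreeNil K n r) (FreeNil K n r) k = ⊥ :=
  le_bot_iff.1 ((antitone_lowerCentralSeries K _ _ hk).trans lcs_freeNil.le)

theorem lcs_two_le (hr : r ≤ 3) {z : Fin n → FreeNil K n r}
    (hz : Submodule.span K (Set.range z) = stepOne K n r) :
    (lowerCentralSeries K (FreeNil K n r) (FreeNil K n r) 2).toSubmodule ≤
      Submodule.span K (Set.range fun t : Fin n × Fin n × Fin n => ⁅⁅z t.1, z t.2.1⁆, z t.2.2⁆) := by
  refine (lcs_le_normedSpan_sup (span_sup_lcs_one hz) 2).trans (sup_le (normedSpan_two_le z) ?_)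
  rw [lcs_freeNil_of_le 3 hr]
  exact bot_le

theorem lcs_one_le (hr : r ≤ 3) {z : Fin n → FreeNil K n r}
    (hz : Submodule.span K (Set.range z) = stepOne K n r) :
    (lowerCentralSeries K (FreeNil K n r) (FreeNil K n r) 1).toSubmodule ≤
      Submodule.span K (Set.range (Sum.elim (fun t : Fin n × Fin n => ⁅z t.1, z t.2⁆)
        fun t : Fin n × Fin n × Fin n => ⁅⁅z t.1, z t.2.1⁆, z t.2.2⁆)) := by
  rw [Set.Sum.elim_range, Submodule.span_union]
  exact (lcs_le_normedSpan_sup (span_sup_lcs_one hz) 1).trans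
    (sup_le_sup (normedSpan_one_le z) (lcs_two_le hr hz))

theorem matEnd_lie (A : Matrix (Fin n) (Fin n) ℤ) (x y : FreeNil K n r) :
    matEnd K r A ⁅x, y⁆ = ⁅matEnd K r A x, matEnd K r A y⁆ := by
  simp only [matEnd_eq_lieBaseChange, LieHom.map_lie]

variable {A : Matrix (Fin n) (Fin n) ℤ} {z : Fin n → FreeNil K n r} {α : Fin n → K}

theorem IsSymmetricFrame.matEnd_pair (hz : IsSymmetricFrame A z α) (i j : Fin n) :
    matEnd K r A ⁅z i, z j⁆ = (α i * α j) • ⁅z i, z j⁆ := by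
  rw [matEnd_lie, hz.eigen, hz.eigen, freeNil_smul_lie_smul]

theorem IsSymmetricFrame.matEnd_triple (hz : IsSymmetricFrame A z α) (i j k : Fin n) :
    matEnd K r A ⁅⁅z i, z j⁆, z k⁆ = (α i * α j * α k) • ⁅⁅z i, z j⁆, z k⁆ := by
  rw [matEnd_lie, hz.matEnd_pair, hz.eigen, freeNil_smul_lie_smul]

theorem exists_perm_pair {a b i j : Fin n} (hab : a ≠ b) (hij : i ≠ j) :
    ∃ π : Equiv.Perm (Fin n), π a = i ∧ π b = j := by
  refine ⟨Equiv.swap (Equiv.swap a i b) j * Equiv.swap a i, ?_, ?_⟩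
  · rw [Equiv.Perm.mul_apply, Equiv.swap_apply_left, Equiv.swap_apply_of_ne_of_ne _ hij]
    intro h
    apply hab
    apply (Equiv.swap a i).injective
    rw [← h, Equiv.swap_apply_left]
  · rw [Equiv.Perm.mul_apply, Equiv.swap_apply_left]

theorem IsSymmetricFrame.pair_mem (hz : IsSymmetricFrame A z α) {E : Submodule K (FreeNil K n r)}
    (hgal : ∀ g : K ≃ₐ[ℚ] K, ∀ x ∈ E, galAct g x ∈ E) {a b : Fin n} (hab : a ≠ b)
    (h : ⁅z a, z b⁆ ∈ E) (i j : Fin n) : ⁅z i, z j⁆ ∈ E := by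
  by_cases hij : i = j
  · rw [hij, lie_self]; exact E.zero_mem
  obtain ⟨π, rfl, rfl⟩ := exists_perm_pair hab hij
  obtain ⟨g, c, hc, hg⟩ := hz.exists_galAct π
  have h1 := hgal g _ h
  rw [galAct_lie, hg, hg, freeNil_smul_lie_smul] at h1
  exact mem_of_smul_mem (mul_ne_zero (hc a) (hc b)) h1

theorem IsSymmetricFrame.triple_mem (hz : IsSymmetricFrame A z α) {E : Submodule K (FreeNil K n r)}
    (hgal : ∀ g : K ≃ₐ[ℚ] K, ∀ x ∈ E, galAct g x ∈ E) {a b : Fin n} (hab : a ≠ b)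
    (h : ⁅⁅z a, z b⁆, z a⁆ ∈ E) (i j : Fin n) : ⁅⁅z i, z j⁆, z i⁆ ∈ E := by
  by_cases hij : i = j
  · rw [hij, freeNil_lie_self_lie]; exact E.zero_mem
  obtain ⟨π, rfl, rfl⟩ := exists_perm_pair hab hij
  obtain ⟨g, c, hc, hg⟩ := hz.exists_galAct π
  have h1 := hgal g _ h
  rw [galAct_lie, galAct_lie, hg, hg, freeNil_smul_lie_smul, freeNil_smul_lie_smul] at h1
  exact mem_of_smul_mem (mul_ne_zero (mul_ne_zero (hc a) (hc b)) (hc a)) h1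

/-- A proper invariant ideal inside the commutator ideal lies in the third step: the eigenvectors in
the second step are multiples of the brackets `⁅z i, z j⁆`, which the Galois group permutes
transitively. -/
theorem IsSymmetricFrame.le_span_triple (hz : IsSymmetricFrame A z α) (hr : r ≤ 3)
    {E : Submodule K (FreeNil K n r)} (hinv : ∀ x ∈ E, matEnd K r A x ∈ E)
    (hgal : ∀ g : K ≃ₐ[ℚ] K, ∀ x ∈ E, galAct g x ∈ E) (hlie : ∀ x ∈ E, ∀ y, ⁅x, y⁆ ∈ E)
    (hle : E ≤ (lowerCentralSeries K (FreeNil K n r) (FreeNil K n r) 1).toSubmodule)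
    (hnle : ¬ (lowerCentralSeries K (FreeNil K n r) (FreeNil K n r) 1).toSubmodule ≤ E) :
    E ≤ Submodule.span K
      (Set.range fun t : Fin n × Fin n × Fin n => ⁅⁅z t.1, z t.2.1⁆, z t.2.2⁆) := by
  have hpair : ∀ a b, a ≠ b → ⁅z a, z b⁆ ∉ E := by
    intro a b hab h
    refine hnle ((lcs_one_le hr hz.span_eq).trans (Submodule.span_le.2 ?_))
    rintro _ ⟨t | t, rfl⟩
    · exact hz.pair_mem hgal hab h _ _
    · exact hlie _ (hz.pair_mem hgal hab h _ _) _
  intro x hx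
  have h1 := mem_iSup_inf_span (f := matEnd K r A)
    (c := Sum.elim (fun t : Fin n × Fin n => α t.1 * α t.2)
      fun t : Fin n × Fin n × Fin n => α t.1 * α t.2.1 * α t.2.2)
    (by
      rintro (t | t)
      · exact hz.matEnd_pair _ _
      · exact hz.matEnd_triple _ _ _) hinv hx (lcs_one_le hr hz.span_eq (hle hx))
  refine (iSup_le fun μ => ?_ : _ ≤ Submodule.span K
    (Set.range fun t : Fin n × Fin n × Fin n => ⁅⁅z t.1, z t.2.1⁆, z t.2.2⁆)) h1
  rintro y ⟨hyE, hy⟩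
  by_cases hμ : ∃ a b, a ≠ b ∧ α a * α b = μ
  · obtain ⟨a, b, hab, rfl⟩ := hμ
    have hn : 1 < n := by
      have h1 := a.2
      have h2 := b.2
      have h3 : (a : ℕ) ≠ b := fun h => hab (Fin.ext h)
      omega
    have hmem : y ∈ Submodule.span K {⁅z a, z b⁆} := by
      refine Submodule.span_le.2 ?_ hy
      rintro _ ⟨⟨i, j⟩ | ⟨i, j, k⟩, ht, rfl⟩
      · have h2 : ({i, j} : Multiset (Fin n)) = {a, b} :=
          hz.relations.eq_of_prod_eq hz.ne_zero (by simpa using ht) (by simp; omega)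
            (by simp; omega)
        have hi : i ∈ ({a, b} : Multiset (Fin n)) := h2 ▸ by simp
        have hj : j ∈ ({a, b} : Multiset (Fin n)) := h2 ▸ by simp
        simp only [Multiset.insert_eq_cons, Multiset.mem_cons, Multiset.mem_singleton] at hi hj
        simp only [Sum.elim_inl, SetLike.mem_coe]
        rcases hi with rfl | rfl <;> rcases hj with rfl | rfl
        · rw [lie_self]; exact Submodule.zero_mem _
        · exact Submodule.mem_span_singleton_self _
        · rw [← freeNil_lie_skew (z i) (z j)]
          exact Submodule.neg_mem _ (Submodule.mem_span_singleton_self _)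
        · rw [lie_self]; exact Submodule.zero_mem _
      · have h2 : ({i, j, k} : Multiset (Fin n)) = {a, b} :=
          hz.relations.eq_of_prod_eq hz.ne_zero (by simpa [mul_assoc] using ht) (by simp; omega)
            (by simp; omega)
        have := congrArg Multiset.card h2
        simp at this
    obtain ⟨s, rfl⟩ := Submodule.mem_span_singleton.1 hmem
    by_cases hs : s = 0
    · rw [hs, zero_smul]; exact Submodule.zero_mem _
    · exact absurd (mem_of_smul_mem hs hyE) (hpair a b hab)
  · push Not at hμ
    refine Submodule.span_le.2 ?_ hy
    rintro _ ⟨⟨i, j⟩ | t, ht, rfl⟩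
    · have hij : i = j := by
        by_contra hij
        exact hμ i j hij ht
      rw [hij, Sum.elim_inl, lie_self]
      exact Submodule.zero_mem _
    · exact Submodule.subset_span ⟨t, rfl⟩

end Steps

/-! ### The subspaces `F₁` and `F₂` -/

section ThirdStep

open LieModule

variable {n r : ℕ} {K : Type*} [Field K] [Algebra ℚ K]

/-- The span of the brackets `⁅⁅z a, z b⁆, z c⁆` whose letters are distinct and form the set `T`. -/
def distinctSpan (z : Fin n → FreeNil K n r) (T : Finset (Fin n)) : Submodule K (FreeNil K n r) :=
  Submodule.span K {x | ∃ a b c, a ≠ b ∧ a ≠ c ∧ b ≠ c ∧ {a, b, c} = T ∧ x = ⁅⁅z a, z b⁆, z c⁆}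

variable {A : Matrix (Fin n) (Fin n) ℤ} {z : Fin n → FreeNil K n r} {α : Fin n → K}

theorem lie_lie_mem_distinctSpan {a b c : Fin n} (hab : a ≠ b) (hac : a ≠ c) (hbc : b ≠ c) :
    ⁅⁅z a, z b⁆, z c⁆ ∈ distinctSpan z {a, b, c} :=
  Submodule.subset_span ⟨a, b, c, hab, hac, hbc, rfl, rfl⟩

theorem distinctSpan_eq_bot {T : Finset (Fin n)} (hT : T.card ≠ 3) : distinctSpan z T = ⊥ := by
  rw [distinctSpan, Submodule.span_eq_bot]
  rintro _ ⟨a, b, c, hab, hac, hbc, rfl, rfl⟩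
  exact absurd (Finset.card_eq_three.2 ⟨a, b, c, hab, hac, hbc, rfl⟩) hT

/-- By the Jacobi identity two of the brackets in three given letters span them all. -/
theorem distinctSpan_le {a b c : Fin n} {E : Submodule K (FreeNil K n r)}
    (h1 : ⁅⁅z a, z b⁆, z c⁆ ∈ E) (h2 : ⁅⁅z c, z b⁆, z a⁆ ∈ E) : distinctSpan z {a, b, c} ≤ E := by
  have h3 : ⁅⁅z a, z c⁆, z b⁆ ∈ E := by
    rw [freeNil_lie_lie_swap]
    exact E.sub_mem h1 h2
  refine Submodule.span_le.2 ?_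
  rintro _ ⟨i, j, k, hij, hik, hjk, hT, rfl⟩
  have hi : i ∈ ({a, b, c} : Finset (Fin n)) := hT ▸ by simp
  have hj : j ∈ ({a, b, c} : Finset (Fin n)) := hT ▸ by simp
  have hk : k ∈ ({a, b, c} : Finset (Fin n)) := hT ▸ by simp
  simp only [Finset.mem_insert, Finset.mem_singleton] at hi hj hk
  rw [SetLike.mem_coe]
  rcases hi with rfl | rfl | rfl <;> rcases hj with rfl | rfl | rfl <;>
    rcases hk with rfl | rfl | rfl <;>
    first
    | exact absurd rfl hij
    | exact absurd rfl hik
    | exact absurd rfl hjk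
    | assumption
    | (rw [← freeNil_lie_skew_lie]; exact E.neg_mem (by assumption))

theorem finrank_distinctSpan_le (T : Finset (Fin n)) :
    Module.finrank K (distinctSpan z T) ≤ 2 := by
  classical
  by_cases hT : T.card = 3
  · obtain ⟨a, b, c, hab, hac, hbc, rfl⟩ := Finset.card_eq_three.1 hT
    have h1 : distinctSpan z {a, b, c} ≤ Submodule.span K
        ((({⁅⁅z a, z b⁆, z c⁆, ⁅⁅z c, z b⁆, z a⁆} : Finset (FreeNil K n r))) : Set _) :=
      distinctSpan_le (Submodule.subset_span (by simp)) (Submodule.subset_span (by simp))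
    exact (Submodule.finrank_mono h1).trans
      ((finrank_span_finset_le_card _).trans Finset.card_le_two)
  · rw [distinctSpan_eq_bot hT, finrank_bot]
    exact Nat.zero_le 2

theorem distinctSpan_le_F2 (T : Finset (Fin n)) : distinctSpan z T ≤ F2 z := by
  by_cases hT : T.card = 3
  · have hsort : ∃ a b c, b < a ∧ a < c ∧ T = {a, b, c} := by
      let o := T.orderEmbOfFin hT
      refine ⟨o 1, o 0, o 2, o.lt_iff_lt.2 (by decide), o.lt_iff_lt.2 (by decide), ?_⟩
      ext x
      have h1 : x ∈ T ↔ x ∈ Set.range o := by rw [Finset.range_orderEmbOfFin]; rfl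
      rw [h1]
      simp only [Set.mem_range, Fin.exists_fin_succ, Finset.mem_insert, Finset.mem_singleton]
      simp [eq_comm]
      tauto
    obtain ⟨a, b, c, hba, hac, rfl⟩ := hsort
    exact distinctSpan_le (Submodule.subset_span ⟨a, b, c, hba, hac, Or.inl rfl⟩)
      (Submodule.subset_span ⟨a, b, c, hba, hac, Or.inr rfl⟩)
  · rw [distinctSpan_eq_bot hT]
    exact bot_le

theorem lie_lie_mem_F2 {a b c : Fin n} (hab : a ≠ b) (hac : a ≠ c) (hbc : b ≠ c) :
    ⁅⁅z a, z b⁆, z c⁆ ∈ F2 z :=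
  distinctSpan_le_F2 _ (lie_lie_mem_distinctSpan hab hac hbc)

theorem F2_eq_span : F2 z = Submodule.span K {x | ∃ a b c, a ≠ b ∧ a ≠ c ∧ b ≠ c ∧
    x = ⁅⁅z a, z b⁆, z c⁆} := by
  refine le_antisymm (Submodule.span_le.2 ?_) (Submodule.span_le.2 ?_)
  · rintro _ ⟨i, j, k, hji, hik, rfl | rfl⟩
    · exact Submodule.subset_span ⟨i, j, k, hji.ne', hik.ne, (hji.trans hik).ne, rfl⟩
    · exact Submodule.subset_span ⟨k, j, i, (hji.trans hik).ne', hik.ne', hji.ne, rfl⟩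
  · rintro _ ⟨a, b, c, hab, hac, hbc, rfl⟩
    exact lie_lie_mem_F2 hab hac hbc

theorem lie_lie_mem_F1 (a b : Fin n) : ⁅⁅z a, z b⁆, z a⁆ ∈ F1 z := by
  rcases lt_trichotomy b a with h | rfl | h
  · exact Submodule.subset_span ⟨a, b, h, Or.inl rfl⟩
  · rw [freeNil_lie_self_lie]; exact Submodule.zero_mem _
  · rw [← freeNil_lie_skew_lie]
    exact Submodule.neg_mem _ (Submodule.subset_span ⟨b, a, h, Or.inr rfl⟩)

theorem F1_le {E : Submodule K (FreeNil K n r)} (h : ∀ i j, ⁅⁅z i, z j⁆, z i⁆ ∈ E) : F1 z ≤ E := by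
  refine Submodule.span_le.2 ?_
  rintro _ ⟨i, j, -, rfl | rfl⟩
  · exact h i j
  · rw [SetLike.mem_coe, ← freeNil_lie_skew_lie]
    exact E.neg_mem (h j i)

theorem span_triple_le : Submodule.span K
      (Set.range fun t : Fin n × Fin n × Fin n => ⁅⁅z t.1, z t.2.1⁆, z t.2.2⁆) ≤ F1 z ⊔ F2 z := by
  refine Submodule.span_le.2 ?_
  rintro _ ⟨⟨a, b, c⟩, rfl⟩
  change ⁅⁅z a, z b⁆, z c⁆ ∈ F1 z ⊔ F2 z
  by_cases hab : a = b
  · subst hab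
    rw [freeNil_lie_self_lie]; exact Submodule.zero_mem _
  by_cases hac : a = c
  · subst hac
    exact Submodule.mem_sup_left (lie_lie_mem_F1 _ _)
  by_cases hbc : b = c
  · subst hbc
    rw [← freeNil_lie_skew_lie]
    exact Submodule.neg_mem _ (Submodule.mem_sup_left (lie_lie_mem_F1 _ _))
  · exact Submodule.mem_sup_right (lie_lie_mem_F2 hab hac hbc)

namespace IsSymmetricFrame

theorem matEnd_mem_F2 (hz : IsSymmetricFrame A z α) {x : FreeNil K n r} (hx : x ∈ F2 z) :
    matEnd K r A x ∈ F2 z := by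
  have h : F2 z ≤ (F2 z).comap (matEnd K r A) := by
    refine F2_eq_span.le.trans (Submodule.span_le.2 ?_)
    rintro _ ⟨a, b, c, hab, hac, hbc, rfl⟩
    rw [SetLike.mem_coe, Submodule.mem_comap, hz.matEnd_triple]
    exact Submodule.smul_mem _ _ (lie_lie_mem_F2 hab hac hbc)
  exact h hx

theorem galAct_triple {g : K ≃ₐ[ℚ] K} {π : Equiv.Perm (Fin n)} {c : Fin n → K}
    (hg : ∀ j, galAct g (z j) = c j • z (π j)) (i j k : Fin n) :
    galAct g ⁅⁅z i, z j⁆, z k⁆ = (c i * c j * c k) • ⁅⁅z (π i), z (π j)⁆, z (π k)⁆ := by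
  rw [galAct_lie, galAct_lie, hg, hg, hg, freeNil_smul_lie_smul, freeNil_smul_lie_smul]

theorem galAct_mem_F2 (hz : IsSymmetricFrame A z α) (g : K ≃ₐ[ℚ] K) {x : FreeNil K n r}
    (hx : x ∈ F2 z) : galAct g x ∈ F2 z := by
  obtain ⟨π, c, -, hg⟩ := hz.exists_perm g
  rw [F2_eq_span] at hx
  refine galAct_mem_span ?_ hx
  rintro _ ⟨i, j, k, hij, hik, hjk, rfl⟩
  rw [galAct_triple hg]
  exact Submodule.smul_mem _ _ (lie_lie_mem_F2 (π.injective.ne hij) (π.injective.ne hik)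
    (π.injective.ne hjk))

theorem galAct_mem_distinctSpan {g : K ≃ₐ[ℚ] K} {π : Equiv.Perm (Fin n)} {c : Fin n → K}
    (hg : ∀ j, galAct g (z j) = c j • z (π j)) {T : Finset (Fin n)} {x : FreeNil K n r}
    (hx : x ∈ distinctSpan z T) : galAct g x ∈ distinctSpan z (T.image π) := by
  refine galAct_mem_span ?_ hx
  rintro _ ⟨i, j, k, hij, hik, hjk, rfl, rfl⟩
  rw [galAct_triple hg]
  refine Submodule.smul_mem _ _ ?_
  have h := lie_lie_mem_distinctSpan (z := z) (π.injective.ne hij) (π.injective.ne hik)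
    (π.injective.ne hjk)
  simpa [Finset.image_insert] using h

theorem matEnd_of_mem_distinctSpan (hz : IsSymmetricFrame A z α) {T : Finset (Fin n)}
    {x : FreeNil K n r} (hx : x ∈ distinctSpan z T) : matEnd K r A x = (∏ j ∈ T, α j) • x := by
  have h : distinctSpan z T ≤ LinearMap.ker (matEnd K r A - (∏ j ∈ T, α j) • LinearMap.id) := by
    refine Submodule.span_le.2 ?_
    rintro _ ⟨a, b, c, hab, hac, hbc, rfl, rfl⟩
    rw [SetLike.mem_coe, LinearMap.mem_ker, LinearMap.sub_apply, hz.matEnd_triple,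
      Finset.prod_insert (by simp [hab, hac]), Finset.prod_pair hbc, mul_assoc]
    exact sub_self _
  simpa [sub_eq_zero] using h hx

theorem eq_of_prod_eq (hz : IsSymmetricFrame A z α) {S T : Finset (Fin n)} (hS : S.card = 3)
    (hT : T.card = 3) (h : ∏ j ∈ S, α j = ∏ j ∈ T, α j) : S = T := by
  have hn : 3 ≤ n := by
    have := Finset.card_le_univ S
    rwa [hS, Fintype.card_fin] at this
  refine Finset.val_injective (hz.relations.eq_of_prod_eq hz.ne_zero h ?_ ?_)
  · change S.card < T.card + n; omega
  · change T.card < S.card + n; omega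

/-- The eigencomponents of an invariant subspace of `F₂`. -/
theorem le_iSup_distinctSpan (hz : IsSymmetricFrame A z α) {E : Submodule K (FreeNil K n r)}
    (hinv : ∀ x ∈ E, matEnd K r A x ∈ E) (hE : E ≤ F2 z) :
    E ≤ ⨆ T : {T : Finset (Fin n) // T.card = 3}, E ⊓ distinctSpan z T := by
  intro x hx
  have h1 := mem_iSup_inf_span (f := matEnd K r A)
    (ι := {t : Fin n × Fin n × Fin n // t.1 ≠ t.2.1 ∧ t.1 ≠ t.2.2 ∧ t.2.1 ≠ t.2.2})
    (v := fun t => ⁅⁅z t.1.1, z t.1.2.1⁆, z t.1.2.2⁆)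
    (c := fun t => ∏ j ∈ ({t.1.1, t.1.2.1, t.1.2.2} : Finset (Fin n)), α j)
    (fun t => hz.matEnd_of_mem_distinctSpan
      (lie_lie_mem_distinctSpan t.2.1 t.2.2.1 t.2.2.2)) hinv hx (by
        have h2 := hE hx
        rw [F2_eq_span] at h2
        refine Submodule.span_mono ?_ h2
        rintro _ ⟨a, b, c, hab, hac, hbc, rfl⟩
        exact ⟨⟨(a, b, c), hab, hac, hbc⟩, rfl⟩)
  refine (iSup_le fun μ => ?_ : _ ≤ ⨆ T : {T : Finset (Fin n) // T.card = 3},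
    E ⊓ distinctSpan z T) h1
  rintro y ⟨hyE, hy⟩
  by_cases hμ : ∃ T : Finset (Fin n), T.card = 3 ∧ ∏ j ∈ T, α j = μ
  · obtain ⟨T, hT, rfl⟩ := hμ
    refine Submodule.mem_iSup_of_mem
      (p := fun T : {T : Finset (Fin n) // T.card = 3} => E ⊓ distinctSpan z T) ⟨T, hT⟩ ⟨hyE, ?_⟩
    refine Submodule.span_le.2 ?_ hy
    rintro _ ⟨⟨⟨a, b, c⟩, hab, hac, hbc⟩, ht, rfl⟩
    have hT' : {a, b, c} = T :=
      hz.eq_of_prod_eq (Finset.card_eq_three.2 ⟨a, b, c, hab, hac, hbc, rfl⟩) hT ht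
    subst hT'
    exact lie_lie_mem_distinctSpan hab hac hbc
  · push Not at hμ
    have hy0 : y = 0 := by
      rw [← Submodule.mem_bot K]
      refine Submodule.span_le.2 ?_ hy
      rintro _ ⟨⟨⟨a, b, c⟩, hab, hac, hbc⟩, ht, rfl⟩
      exact absurd ht (hμ _ (Finset.card_eq_three.2 ⟨a, b, c, hab, hac, hbc, rfl⟩))
    rw [hy0]
    exact Submodule.zero_mem _

theorem exists_perm_image {S T : Finset (Fin n)} (h : S.card = T.card) :
    ∃ π : Equiv.Perm (Fin n), S.image π = T := by
  have e : {x // x ∈ S} ≃ {x // x ∈ T} := Finset.equivOfCardEq h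
  refine ⟨e.extendSubtype, Finset.eq_of_subset_of_card_le ?_ ?_⟩
  · intro y hy
    obtain ⟨x, hx, rfl⟩ := Finset.mem_image.1 hy
    exact e.extendSubtype_mem x hx
  · rw [Finset.card_image_of_injective _ (Equiv.injective _), h]

/-- A rational invariant subspace of `F₂` that is neither `0` nor `F₂` meets each of the at most
two-dimensional eigenspaces in a line. -/
theorem finrank_of_le_F2 (hz : IsSymmetricFrame A z α) {E : Submodule K (FreeNil K n r)}
    (hinv : ∀ x ∈ E, matEnd K r A x ∈ E) (hgal : ∀ g : K ≃ₐ[ℚ] K, ∀ x ∈ E, galAct g x ∈ E)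
    (hE : E ≤ F2 z) : E = ⊥ ∨ E = F2 z ∨ Module.finrank K E = n.choose 3 := by
  by_cases hbot : E = ⊥
  · exact Or.inl hbot
  by_cases htop : E = F2 z
  · exact Or.inr (Or.inl htop)
  refine Or.inr (Or.inr ?_)
  have hdec := hz.le_iSup_distinctSpan hinv hE
  have hmove : ∀ S T : Finset (Fin n), S.card = T.card → ∃ g : K ≃ₐ[ℚ] K,
      ∀ x ∈ distinctSpan z S, galAct g x ∈ distinctSpan z T := by
    intro S T hST
    obtain ⟨π, rfl⟩ := exists_perm_image hST
    obtain ⟨g, c, -, hg⟩ := hz.exists_galAct π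
    exact ⟨g, fun x hx => galAct_mem_distinctSpan hg hx⟩
  have hne : ∀ T : {T : Finset (Fin n) // T.card = 3}, E ⊓ distinctSpan z T ≠ ⊥ := by
    intro T hT
    refine hbot (le_bot_iff.1 (hdec.trans (iSup_le fun S => ?_)))
    rintro x ⟨hxE, hx⟩
    obtain ⟨g, hg⟩ := hmove S T (S.2.trans T.2.symm)
    have h1 : galAct g x ∈ E ⊓ distinctSpan z T := ⟨hgal g x hxE, hg x hx⟩
    rw [hT, Submodule.mem_bot] at h1
    rw [Submodule.mem_bot]
    exact galAct_injective g (h1.trans (map_zero _).symm)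
  have hnle : ∀ T : {T : Finset (Fin n) // T.card = 3}, ¬ distinctSpan z T ≤ E := by
    intro T hT
    refine htop (le_antisymm hE ?_)
    rw [F2_eq_span]
    refine Submodule.span_le.2 ?_
    rintro x ⟨a, b, c, hab, hac, hbc, rfl⟩
    obtain ⟨g, hg⟩ := hmove {a, b, c} T
      ((Finset.card_eq_three.2 ⟨a, b, c, hab, hac, hbc, rfl⟩).trans T.2.symm)
    have h1 := hgal g⁻¹ _ (hT (hg _ (lie_lie_mem_distinctSpan hab hac hbc)))
    rwa [← galAct_mul, inv_mul_cancel, galAct_one] at h1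
  -- One eigenvector for each set of three letters; these eigenvectors form a basis of `E`.
  choose e heE he0 using fun T => (Submodule.ne_bot_iff _).1 (hne T)
  have hspan : E = Submodule.span K (Set.range e) := by
    refine le_antisymm (hdec.trans (iSup_le fun T => ?_)) (Submodule.span_le.2 ?_)
    · have hlt : E ⊓ distinctSpan z T < distinctSpan z T :=
        lt_of_le_of_ne inf_le_right fun h => hnle T (inf_eq_right.1 h)
      have h1 := Submodule.finrank_lt_finrank_of_lt hlt
      have h2 := finrank_distinctSpan_le (z := z) (T : Finset (Fin n))
      have h3 : Submodule.span K {e T} = E ⊓ distinctSpan z T := by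
        refine Submodule.eq_of_le_of_finrank_le ?_ ?_
        · rw [Submodule.span_singleton_le_iff_mem]; exact heE T
        · rw [finrank_span_singleton (he0 T)]; omega
      rw [← h3]
      exact Submodule.span_mono (Set.singleton_subset_iff.2 ⟨T, rfl⟩)
    · rintro _ ⟨T, rfl⟩
      exact (heE T).1
  have hli : LinearIndependent K e :=
    Module.End.eigenvectors_linearIndependent' (matEnd K r A)
      (fun T : {T : Finset (Fin n) // T.card = 3} => ∏ j ∈ T.1, α j)
      (fun S T h => Subtype.ext (hz.eq_of_prod_eq S.2 T.2 h)) e fun T =>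
      ⟨Module.End.mem_eigenspace_iff.2 (hz.matEnd_of_mem_distinctSpan (heE T).2), he0 T⟩
  rw [hspan, finrank_span_eq_card hli, Fintype.card_finset_len, Fintype.card_fin]

end IsSymmetricFrame
end ThirdStep

/-! ### Symmetric Galois group -/

section SymmetricGroup

open LieModule

variable {n r : ℕ} {K : Type*} [Field K] [Algebra ℚ K]
  {A : Matrix (Fin n) (Fin n) ℤ} {z : Fin n → FreeNil K n r} {α : Fin n → K}

namespace IsSymmetricFrame

/-- An eigenvector with letters `a`, `b`, `a` is a multiple of `⁅⁅z a, z b⁆, z a⁆`, and the Galois group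
permutes these brackets transitively; all other eigenvectors in the third step lie in `F₂`. -/
theorem le_F2_or_F1_le (hz : IsSymmetricFrame A z α) {E : Submodule K (FreeNil K n r)}
    (hinv : ∀ x ∈ E, matEnd K r A x ∈ E) (hgal : ∀ g : K ≃ₐ[ℚ] K, ∀ x ∈ E, galAct g x ∈ E)
    (hE : E ≤ Submodule.span K
      (Set.range fun t : Fin n × Fin n × Fin n => ⁅⁅z t.1, z t.2.1⁆, z t.2.2⁆)) :
    E ≤ F2 z ∨ F1 z ≤ E := by
  by_cases hF : F1 z ≤ E
  · exact Or.inr hF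
  have hnot : ∀ a b, a ≠ b → ⁅⁅z a, z b⁆, z a⁆ ∉ E := fun a b hab h =>
    hF (F1_le (hz.triple_mem hgal hab h))
  refine Or.inl fun x hx => ?_
  have h1 := mem_iSup_inf_span (f := matEnd K r A)
    (c := fun t : Fin n × Fin n × Fin n => α t.1 * α t.2.1 * α t.2.2)
    (fun t => hz.matEnd_triple _ _ _) hinv hx (hE hx)
  refine (iSup_le fun μ => ?_ : _ ≤ F2 z) h1
  rintro y ⟨hyE, hy⟩
  -- The eigenvalue determines the letters of the brackets that contribute to `y`.
  by_cases hμ : ∃ a b, a ≠ b ∧ α a * α b * α a = μ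
  · obtain ⟨a, b, hab, rfl⟩ := hμ
    have hn : 1 < n := by
      have h1 := a.2
      have h2 := b.2
      have h3 : (a : ℕ) ≠ b := fun h => hab (Fin.ext h)
      omega
    have hmem : y ∈ Submodule.span K {⁅⁅z a, z b⁆, z a⁆} := by
      refine Submodule.span_le.2 ?_ hy
      rintro _ ⟨⟨i, j, k⟩, ht, rfl⟩
      change ⁅⁅z i, z j⁆, z k⁆ ∈ Submodule.span K {⁅⁅z a, z b⁆, z a⁆}
      have h2 : ({i, j, k} : Multiset (Fin n)) = {a, b, a} :=
        hz.relations.eq_of_prod_eq hz.ne_zero (by simpa [mul_assoc] using ht) (by simp; omega)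
          (by simp; omega)
      have hi : i ∈ ({a, b, a} : Multiset (Fin n)) := h2 ▸ by simp
      have hj : j ∈ ({a, b, a} : Multiset (Fin n)) := h2 ▸ by simp
      have hk : k ∈ ({a, b, a} : Multiset (Fin n)) := h2 ▸ by simp
      have hcount := congrArg (Multiset.count b) h2
      simp only [Multiset.insert_eq_cons, Multiset.mem_cons, Multiset.mem_singleton] at hi hj hk
      have hi' : i = a ∨ i = b := by tauto
      have hj' : j = a ∨ j = b := by tauto
      have hk' : k = a ∨ k = b := by tauto
      by_cases hij : i = j
      · rw [hij, freeNil_lie_self_lie]; exact Submodule.zero_mem _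
      rcases hk' with hk' | hk'
      · rw [hk']
        rcases hi' with hi' | hi'
        · rw [hi', hj'.resolve_left fun h => hij (hi'.trans h.symm)]
          exact Submodule.mem_span_singleton_self _
        · rw [hi', hj'.resolve_right fun h => hij (hi'.trans h.symm),
            ← freeNil_lie_skew_lie (z b) (z a)]
          exact Submodule.neg_mem _ (Submodule.mem_span_singleton_self _)
      · exfalso
        rcases hi' with hi' | hi'
        · have hj'' := hj'.resolve_left fun h => hij (hi'.trans h.symm)
          simp [hi', hj'', hk', hab.symm] at hcount
        · have hj'' := hj'.resolve_right fun h => hij (hi'.trans h.symm)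
          simp [hi', hj'', hk', hab.symm] at hcount
    obtain ⟨s, rfl⟩ := Submodule.mem_span_singleton.1 hmem
    by_cases hs : s = 0
    · rw [hs, zero_smul]; exact Submodule.zero_mem _
    · exact absurd (mem_of_smul_mem hs hyE) (hnot a b hab)
  · push Not at hμ
    refine Submodule.span_le.2 ?_ hy
    rintro _ ⟨⟨a, b, c⟩, ht, rfl⟩
    change ⁅⁅z a, z b⁆, z c⁆ ∈ F2 z
    by_cases hab : a = b
    · rw [hab, freeNil_lie_self_lie]; exact Submodule.zero_mem _
    refine lie_lie_mem_F2 hab (fun hac => ?_) (fun hbc => ?_)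
    · subst hac
      exact hμ a b hab ht
    · subst hbc
      refine hμ b a (Ne.symm hab) (Eq.trans ?_ ht)
      simp only
      ring

theorem isSemisimple_matEndQ (hz : IsSymmetricFrame A z α) :
    Module.End.IsSemisimple (matEndQ r A) := by
  have h : Module.End.IsSemisimple ((matEndQ r A).baseChange K) :=
    isSemisimple_of_span_eigen (f := matEnd K r A) (matEnd_bracketEval hz.eigen)
      (span_bracketEval_freeNil hz.span_eq)
  exact Module.End.isSemisimple_of_squarefree_aeval_eq_zero (squarefree_minpoly_of_baseChange h)
    (minpoly.aeval _ _)

/-- A proper nonzero invariant subspace of `F₂` has a rational invariant complement, as `f^A` is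
semisimple, and the dimension count applies to both. -/
theorem eq_bot_or_isF2a [FiniteDimensional ℚ K] [IsGalois ℚ K] (hz : IsSymmetricFrame A z α)
    {E : Submodule K (FreeNil K n r)}
    (hinv : ∀ x ∈ E, matEnd K r A x ∈ E) (hgal : ∀ g : K ≃ₐ[ℚ] K, ∀ x ∈ E, galAct g x ∈ E)
    (hE : E ≤ F2 z) : E = ⊥ ∨ E = F2 z ∨ IsF2a A z E := by
  rcases hz.finrank_of_le_F2 hinv hgal hE with h | h | hrank
  · exact Or.inl h
  · exact Or.inr (Or.inl h)
  by_cases hbot : E = ⊥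
  · exact Or.inl hbot
  by_cases htop : E = F2 z
  · exact Or.inr (Or.inl htop)
  refine Or.inr (Or.inr ?_)
  have hErat : IsRational E := isRational_of_galAct_mem hgal
  have hFrat : IsRational (F2 z) := isRational_of_galAct_mem fun g x => hz.galAct_mem_F2 g
  have hratinv : ∀ {E : Submodule K (FreeNil K n r)}, (∀ x ∈ E, matEnd K r A x ∈ E) →
      ∀ v ∈ ratPart E, matEndQ r A v ∈ ratPart E := by
    intro E hE v hv
    have := hE _ (mem_ratPart.1 hv)
    rwa [matEnd, LinearMap.baseChange_tmul] at this
  obtain ⟨D, hD, hcompl⟩ := Module.End.isSemisimple_iff.1 hz.isSemisimple_matEndQ (ratPart E)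
    (hratinv hinv)
  set U : Submodule ℚ (FreeNilQ n r) := D ⊓ ratPart (F2 z) with hU
  have hUinv : ∀ v ∈ U, matEndQ r A v ∈ U := fun v hv =>
    ⟨hD hv.1, hratinv (fun x => hz.matEnd_mem_F2) v hv.2⟩
  set E' : Submodule K (FreeNil K n r) := U.baseChange K with hE'
  have hE'inv : ∀ x ∈ E', matEnd K r A x ∈ E' := by
    have h : E' ≤ E'.comap (matEnd K r A) := baseChange_le_iff.2 fun v hv => by
      rw [Submodule.mem_comap, matEnd, LinearMap.baseChange_tmul]
      exact Submodule.tmul_mem_baseChange_of_mem 1 (hUinv v hv)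
    exact fun x hx => h hx
  have hE'gal : ∀ g : K ≃ₐ[ℚ] K, ∀ x ∈ E', galAct g x ∈ E' := fun g x => galAct_mem_baseChange g
  have hE'le : E' ≤ F2 z := by
    rw [← (hFrat : (ratPart (F2 z)).baseChange K = F2 z)]
    exact Submodule.baseChange_mono K inf_le_right
  have hinf : E ⊓ E' = ⊥ := by
    have h1 : IsRational (E ⊓ E') :=
      isRational_of_galAct_mem fun g x hx => ⟨hgal g x hx.1, hE'gal g x hx.2⟩
    have h2 : ratPart (E ⊓ E') = ⊥ := by
      refine le_bot_iff.1 (le_trans ?_ hcompl.inf_eq_bot.le)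
      refine le_inf (ratPart_mono inf_le_left) ((ratPart_mono inf_le_right).trans ?_)
      rw [hE', ratPart_baseChange]
      exact inf_le_left
    rw [← (h1 : (ratPart (E ⊓ E')).baseChange K = E ⊓ E'), h2, Submodule.baseChange_bot]
  have hsup : E ⊔ E' = F2 z := by
    have h1 : ratPart E ⊔ U = ratPart (F2 z) := by
      rw [hU, ← sup_inf_assoc_of_le _ (ratPart_mono hE), hcompl.sup_eq_top, top_inf_eq]
    rw [← (hErat : (ratPart E).baseChange K = E), hE', ← baseChange_sup, h1]
    exact hFrat
  refine ⟨E', ⟨hErat, hinv⟩, ⟨?_, hE'inv⟩, hinf, hsup, hrank, ?_⟩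
  · rw [IsRational, hE', ratPart_baseChange]
  · rcases hz.finrank_of_le_F2 hE'inv hE'gal hE'le with h | h | h
    · rw [h, sup_bot_eq] at hsup
      exact absurd hsup htop
    · rw [h, inf_eq_left.2 hE] at hinf
      exact absurd hinf hbot
    · exact h

end IsSymmetricFrame

theorem matEnd_mem_baseChange {J : Submodule ℚ (FreeNilQ n r)} (hJ : ∀ x ∈ J, matEndQ r A x ∈ J)
    {x : FreeNil K n r} (hx : x ∈ J.baseChange K) : matEnd K r A x ∈ J.baseChange K := by
  have h : J.baseChange K ≤ (J.baseChange K).comap (matEnd K r A) := baseChange_le_iff.2 fun v hv => by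
    rw [Submodule.mem_comap, matEnd, LinearMap.baseChange_tmul]
    exact Submodule.tmul_mem_baseChange_of_mem 1 (hJ v hv)
  exact h hx

theorem lie_mem_baseChange {J : LieIdeal ℚ (FreeNilQ n r)} {x : FreeNil K n r}
    (hx : x ∈ J.toSubmodule.baseChange K) (y : FreeNil K n r) :
    ⁅x, y⁆ ∈ J.toSubmodule.baseChange K :=
  lie_mem_left K _ (J.baseChange K) x y hx

theorem realIdeal_baseChange (J : LieIdeal ℚ (FreeNilQ n r)) :
    realIdeal (J.toSubmodule.baseChange K) = J.baseChange ℝ := by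
  rw [realIdeal, toReal, ratPart_baseChange]
  exact LieSubmodule.lieSpan_eq (J.baseChange ℝ)

theorem exists_symmetricFrame {p : ℤ[X]} [IsSplittingField ℚ K (ratPoly p)]
    (hn : p.natDegree = n) (hmonic : p.Monic) (hunit : IsUnit (p.coeff 0))
    (hirr : Irreducible (ratPoly p))
    (hyp : ∀ μ : ℂ, (p.map (Int.castRingHom ℂ)).IsRoot μ → ‖μ‖ ≠ 1)
    (hsym : Nonempty ((ratPoly p).Gal ≃* Equiv.Perm (Fin n))) (hA : A.charpoly = p)
    (hgen : LinearIndependent ℚ (genQ n r)) :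
    ∃ (z : Fin n → FreeNil K n r) (α : Fin n → K), IsSymmetricFrame A z α := by
  have e : Fin n ≃ (ratPoly p).rootSet K :=
    (Fintype.equivFinOfCardEq (card_rootSet_ratPoly K hn hirr)).symm
  choose z hz hz0 heig using fun j => exists_eigenvector (A := A) (r := r) hgen
    (α := (e j : K)) (by rw [hA]; exact (isRoot_map_int_iff hmonic).2 (e j).2)
  obtain ⟨hli, hspan⟩ := linearIndependent_and_span_of_eigen
    (Subtype.val_injective.comp e.injective) hz hz0 heig
  have hframe : IsEigenFrame A z := ⟨hli, hspan, fun j => ⟨_, heig j⟩⟩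
  obtain ⟨α, hα, hprod⟩ := hframe.exists_eigenvalues hgen
  exact ⟨z, α, isSymmetricFrame_of_eigen hmonic hunit hirr hyp hsym hspan hli hα (hA ▸ hprod)⟩

variable {𝔫 : Type*} [LieRing 𝔫] [LieAlgebra ℝ 𝔫] [FiniteDimensional ℝ 𝔫] {p : ℤ[X]}

/-- In the two-step case the third step vanishes, so the kernel of the presentation is zero. -/
theorem nonempty_equiv_freeNil {f : 𝔫 ≃ₗ⁅ℝ⁆ 𝔫} (hr : IsStepNilpotent 𝔫 2)
    (hf : IsAnosovAut f) (hss : Module.End.IsSemisimple ((f : 𝔫 →ₗ⁅ℝ⁆ 𝔫) : 𝔫 →ₗ[ℝ] 𝔫))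
    (hp : IsFirstPoly f p) (hn : p.natDegree = n) (hirr : Irreducible p)
    (hsym : Nonempty ((ratPoly p).Gal ≃* Equiv.Perm (Fin n))) :
    Nonempty (𝔫 ≃ₗ⁅ℝ⁆ FreeNil ℝ n 2) := by
  obtain ⟨hmonic, hunit, hyp, hpres⟩ := exists_presentation hr hf hss hp hn hirr
  have hirrQ : Irreducible (ratPoly p) :=
    (hmonic.irreducible_iff_irreducible_map_fraction_map (K := ℚ)).1 hirr
  obtain ⟨A, hA⟩ := exists_matrix_charpoly hmonic hn
  obtain ⟨J, hJ, hJ1, hgen, hstep, ⟨e⟩⟩ := hpres A hA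
  let K := (ratPoly p).SplittingField
  have hsplit : IsSplittingField ℚ K (ratPoly p) := isSplittingField_ratPoly p
  obtain ⟨z, α, hz⟩ := exists_symmetricFrame (K := K) hn hmonic hunit hirrQ hyp hsym hA hgen
  have hle := hz.le_span_triple (by norm_num) (E := J.toSubmodule.baseChange K)
    (fun x => matEnd_mem_baseChange hJ) (fun g x => galAct_mem_baseChange g)
    (fun x => lie_mem_baseChange)
    (by rw [lcs_freeNil_eq]; exact Submodule.baseChange_mono K hJ1)
    (by
      rw [lcs_freeNil_eq, baseChange_le_baseChange]
      exact hstep 1 (by norm_num))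
  have hzero : Submodule.span K
      (Set.range fun t : Fin n × Fin n × Fin n => ⁅⁅z t.1, z t.2.1⁆, z t.2.2⁆) = ⊥ := by
    rw [Submodule.span_eq_bot]
    rintro _ ⟨t, rfl⟩
    have h1 : ⁅z t.2.2, ⁅z t.1, z t.2.1⁆⁆ ∈
        lowerCentralSeries K (FreeNil K n 2) (FreeNil K n 2) 2 := by
      simp only [lowerCentralSeries_succ]
      exact LieSubmodule.lie_mem_lie (LieSubmodule.mem_top _)
        (LieSubmodule.lie_mem_lie (LieSubmodule.mem_top _) (LieSubmodule.mem_top _))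
    rw [lcs_freeNil, LieSubmodule.mem_bot] at h1
    have h2 := freeNil_lie_skew ⁅z t.1, z t.2.1⁆ (z t.2.2)
    rw [h1, neg_zero] at h2
    exact h2.symm
  have hJbot : J = ⊥ := by
    rw [← LieSubmodule.toSubmodule_inj, LieSubmodule.bot_toSubmodule, ← le_bot_iff,
      ← baseChange_le_baseChange (K := K), Submodule.baseChange_bot, ← hzero]
    exact hle
  have hker : (LieHom.id : FreeNil ℝ n 2 →ₗ⁅ℝ⁆ FreeNil ℝ n 2).ker = J.baseChange ℝ := by
    rw [hJbot, LieSubmodule.baseChange_bot]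
    ext x
    simp [LieHom.mem_ker]
  obtain ⟨e'⟩ := nonempty_quotient_equiv (LieHom.id : FreeNil ℝ n 2 →ₗ⁅ℝ⁆ FreeNil ℝ n 2)
    Function.surjective_id _ hker
  exact ⟨e.trans e'.symm⟩

/-- The kernel of the presentation lies in the third step `F₁ ⊔ F₂`; it is not all of it because the
Lie algebra is exactly three-step nilpotent. -/
theorem exists_ideal_of_symmetric {K : Type*} [Field K] [Algebra ℚ K]
    [IsSplittingField ℚ K (ratPoly p)] {f : 𝔫 ≃ₗ⁅ℝ⁆ 𝔫}
    (hr : IsStepNilpotent 𝔫 3)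
    (hf : IsAnosovAut f) (hss : Module.End.IsSemisimple ((f : 𝔫 →ₗ⁅ℝ⁆ 𝔫) : 𝔫 →ₗ[ℝ] 𝔫))
    (hp : IsFirstPoly f p) (hn : p.natDegree = n) (hirr : Irreducible p)
    (hsym : Nonempty ((ratPoly p).Gal ≃* Equiv.Perm (Fin n)))
    (hA : A.charpoly = p) {z : Fin n → FreeNil K n 3} (hframe : IsEigenFrame A z) :
    ∃ I : LieIdeal ℝ (FreeNil ℝ n 3),
      (I = ⊥ ∨ I = realIdeal (F1 z) ∨ I = realIdeal (F2 z) ∨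
        (∃ F2a, IsF2a A z F2a ∧ I = realIdeal (F1 z ⊔ F2a)) ∨
        (∃ F2a, IsF2a A z F2a ∧ I = realIdeal F2a)) ∧
      Nonempty (𝔫 ≃ₗ⁅ℝ⁆ (FreeNil ℝ n 3 ⧸ I)) := by
  obtain ⟨hmonic, hunit, hyp, hpres⟩ := exists_presentation hr hf hss hp hn hirr
  have hirrQ : Irreducible (ratPoly p) :=
    (hmonic.irreducible_iff_irreducible_map_fraction_map (K := ℚ)).1 hirr
  obtain ⟨J, hJ, hJ1, hgen, hstep, hiso⟩ := hpres A hA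
  have : FiniteDimensional ℚ K := IsSplittingField.finiteDimensional K (ratPoly p)
  have hgal : IsGalois ℚ K := IsGalois.of_separable_splitting_field hirrQ.separable
  obtain ⟨α, hα, hprod⟩ := hframe.exists_eigenvalues hgen
  have hz : IsSymmetricFrame A z α := isSymmetricFrame_of_eigen hmonic hunit hirrQ hyp hsym
    hframe.span_eq hframe.linearIndependent hα (hA ▸ hprod)
  refine ⟨J.baseChange ℝ, ?_, hiso⟩
  rw [← realIdeal_baseChange (K := K)]
  set E : Submodule K (FreeNil K n 3) := J.toSubmodule.baseChange K with hEdef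
  have hinv : ∀ x ∈ E, matEnd K 3 A x ∈ E := fun x => matEnd_mem_baseChange hJ
  have hEgal : ∀ g : K ≃ₐ[ℚ] K, ∀ x ∈ E, galAct g x ∈ E := fun g x => galAct_mem_baseChange g
  have hE : E ≤ Submodule.span K
      (Set.range fun t : Fin n × Fin n × Fin n => ⁅⁅z t.1, z t.2.1⁆, z t.2.2⁆) :=
    hz.le_span_triple le_rfl hinv hEgal (fun x => lie_mem_baseChange)
      (by rw [lcs_freeNil_eq]; exact Submodule.baseChange_mono K hJ1)
      (by
        rw [lcs_freeNil_eq, hEdef, baseChange_le_baseChange]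
        exact hstep 1 (by norm_num))
  rcases hz.le_F2_or_F1_le hinv hEgal hE with h2 | h1
  · rcases hz.eq_bot_or_isF2a hinv hEgal h2 with h | h | h
    · refine Or.inl ?_
      rw [h, realIdeal, toReal]
      have : ratPart (⊥ : Submodule K (FreeNil K n 3)) = ⊥ := by
        rw [← Submodule.baseChange_bot, ratPart_baseChange]
      rw [this, Submodule.baseChange_bot, Submodule.bot_coe, LieSubmodule.lieSpan_eq_bot_iff]
      simp
    · exact Or.inr (Or.inr (Or.inl (by rw [h])))
    · exact Or.inr (Or.inr (Or.inr (Or.inr ⟨E, h, rfl⟩)))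
  · have hEeq : E = F1 z ⊔ (E ⊓ F2 z) := by
      rw [inf_comm, ← sup_inf_assoc_of_le _ h1, inf_eq_right.2 (hE.trans span_triple_le)]
    rcases hz.eq_bot_or_isF2a (E := E ⊓ F2 z)
      (fun x hx => ⟨hinv x hx.1, hz.matEnd_mem_F2 hx.2⟩)
      (fun g x hx => ⟨hEgal g x hx.1, hz.galAct_mem_F2 g hx.2⟩) inf_le_right with h | h | h
    · refine Or.inr (Or.inl ?_)
      rw [h, sup_bot_eq] at hEeq
      rw [hEeq]
    · exfalso
      rw [h] at hEeq
      refine hstep 2 (by norm_num) ?_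
      have h2 := (lcs_two_le le_rfl hz.span_eq).trans span_triple_le
      rw [← hEeq, lcs_freeNil_eq, hEdef, baseChange_le_baseChange] at h2
      exact h2
    · exact Or.inr (Or.inr (Or.inr (Or.inl ⟨E ⊓ F2 z, h, by rw [← hEeq]⟩)))

end SymmetricGroup

/-! ### Hyperbolic automorphisms of rational Lie algebras -/

section Lattice

/-- The `ℤ[g]`-submodule generated by a basis is a lattice on which `g` and its inverse act. -/
theorem exists_integral_basis {V : Type*} [AddCommGroup V] [Module ℚ V] [Module.Finite ℚ V]
    {g h : Module.End ℚ V} (hg : IsIntegral ℤ g) (hh : h ∈ Algebra.adjoin ℤ {g}) (hgh : g * h = 1)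
    (hhg : h * g = 1) :
    ∃ (m : ℕ) (b : Module.Basis (Fin m) ℚ V) (M : Matrix.GeneralLinearGroup (Fin m) ℤ),
      LinearMap.toMatrix b b g = (M : Matrix (Fin m) (Fin m) ℤ).map (Int.cast : ℤ → ℚ) := by
  let S := Algebra.adjoin ℤ {g}
  let b₀ := Module.finBasis ℚ V
  let ev : V → (Module.End ℚ V →ₗ[ℤ] V) := fun v =>
    (LinearMap.applyₗ v : Module.End ℚ V →ₗ[ℚ] V).restrictScalars ℤ
  have hev : ∀ v u, ev v u = u v := fun _ _ => rfl
  -- The lattice `∑ ℤ[g] b₀ i`, which is finitely generated because `g` is integral.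
  let Λ : Submodule ℤ V := ⨆ i, (Subalgebra.toSubmodule S).map (ev (b₀ i))
  have hΛ : ∀ s ∈ S, ∀ x ∈ Λ, s x ∈ Λ := by
    intro s hs
    have h1 : Λ ≤ Λ.comap (s.restrictScalars ℤ) := by
      refine iSup_le fun i => ?_
      rintro _ ⟨u, hu, rfl⟩
      exact Submodule.mem_iSup_of_mem (p := fun i => (Subalgebra.toSubmodule S).map (ev (b₀ i))) i
        ⟨s * u, S.mul_mem hs hu, rfl⟩
    exact fun x hx => h1 hx
  have hb₀ : ∀ i, b₀ i ∈ Λ := fun i =>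
    Submodule.mem_iSup_of_mem (p := fun i => (Subalgebra.toSubmodule S).map (ev (b₀ i))) i
      ⟨1, S.one_mem, rfl⟩
  have hfin : Module.Finite ℤ Λ := Module.Finite.iff_fg.2
    (Submodule.fg_iSup _ fun i => (hg.fg_adjoin_singleton).map _)
  have htf : Module.IsTorsionFree ℤ V := Module.IsTorsionFree.trans_faithfulSMul ℤ ℚ V
  let bΛ := Module.finBasis ℤ Λ
  have hli : LinearIndependent ℚ fun i => (bΛ i : V) := by
    rw [← LinearIndependent.iff_fractionRing ℤ ℚ]
    exact bΛ.linearIndependent.map' Λ.subtype Λ.ker_subtype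
  have hspan : ⊤ ≤ Submodule.span ℚ (Set.range fun i => (bΛ i : V)) := by
    rw [← b₀.span_eq, Submodule.span_le]
    rintro _ ⟨i, rfl⟩
    have h1 := congrArg Subtype.val (bΛ.sum_repr ⟨b₀ i, hb₀ i⟩)
    rw [AddSubmonoidClass.coe_finsetSum] at h1
    have h2 : ∑ j, ((bΛ.repr ⟨b₀ i, hb₀ i⟩ j • bΛ j : Λ) : V) ∈
        Submodule.span ℚ (Set.range fun i => (bΛ i : V)) := by
      refine sum_mem fun j _ => ?_
      have h3 : ((bΛ.repr ⟨b₀ i, hb₀ i⟩ j • bΛ j : Λ) : V) =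
          (bΛ.repr ⟨b₀ i, hb₀ i⟩ j : ℚ) • (bΛ j : V) := (Int.cast_smul_eq_zsmul ℚ _ _).symm
      rw [h3]
      exact Submodule.smul_mem _ _ (Submodule.subset_span ⟨j, rfl⟩)
    rwa [h1] at h2
  let b := Module.Basis.mk hli hspan
  have hb : ∀ i, b i = bΛ i := fun i => Module.Basis.mk_apply hli hspan i
  let gΛ : Λ →ₗ[ℤ] Λ := (g.restrictScalars ℤ).restrict
    (hΛ g (Algebra.self_mem_adjoin_singleton ℤ g))
  let hΛ' : Λ →ₗ[ℤ] Λ := (h.restrictScalars ℤ).restrict (hΛ h hh)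
  refine ⟨_, b, ⟨LinearMap.toMatrix bΛ bΛ gΛ, LinearMap.toMatrix bΛ bΛ hΛ', ?_, ?_⟩, ?_⟩
  · rw [← LinearMap.toMatrix_mul, ← LinearMap.toMatrix_one bΛ]
    congr 1
    ext x
    exact LinearMap.congr_fun hgh (x : V)
  · rw [← LinearMap.toMatrix_mul, ← LinearMap.toMatrix_one bΛ]
    congr 1
    ext x
    exact LinearMap.congr_fun hhg (x : V)
  · ext i j
    rw [LinearMap.toMatrix_apply]
    have h1 : g (b j) = ∑ k, (LinearMap.toMatrix bΛ bΛ gΛ k j : ℚ) • b k := by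
      have h2 := congrArg Subtype.val (bΛ.sum_repr (gΛ (bΛ j)))
      rw [AddSubmonoidClass.coe_finsetSum] at h2
      rw [hb]
      refine Eq.trans h2.symm (Finset.sum_congr rfl fun k _ => ?_)
      rw [LinearMap.toMatrix_apply, hb]
      exact (Int.cast_smul_eq_zsmul ℚ _ _).symm
    rw [h1, map_sum, Finset.sum_apply']
    simp [Finsupp.single_apply]

/-- An endomorphism of a rational Lie algebra that is annihilated by the polynomial of a hyperbolic
unit becomes an Anosov automorphism over `ℝ`. -/
theorem isAnosov_baseChange {N : Type*} [LieRing N] [LieAlgebra ℚ N] [Module.Finite ℚ N]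
    (g : N →ₗ⁅ℚ⁆ N) {P : ℤ[X]} (hP : P.Monic) (hP0 : IsUnit (P.coeff 0))
    (hPg : aeval (g : Module.End ℚ N) P = 0)
    (hyp : ∀ μ : ℂ, (P.map (Int.castRingHom ℂ)).IsRoot μ → ‖μ‖ ≠ 1) : IsAnosov (ℝ ⊗[ℚ] N) := by
  set G : Module.End ℚ N := (g : N →ₗ[ℚ] N) with hG
  set H : Module.End ℚ N := aeval G (-(C (P.coeff 0) * P.divX)) with hH
  -- As the constant coefficient of `P` is a unit, the inverse of `G` is a polynomial in `G`.
  have hHG : H * G = 1 := by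
    have h1 := hPg
    rw [← divX_mul_X_add P, map_add, map_mul, aeval_X, aeval_C] at h1
    have hu : algebraMap ℤ (Module.End ℚ N) (P.coeff 0) * algebraMap ℤ _ (P.coeff 0) = 1 := by
      rw [← map_mul, Int.isUnit_mul_self hP0, map_one]
    rw [hH, map_neg, map_mul, aeval_C, neg_mul, mul_assoc, eq_neg_of_add_eq_zero_left h1, mul_neg,
      neg_neg, hu]
  have hGH : G * H = 1 := by
    rw [← hHG, hH]
    nth_rw 1 [← aeval_X (R := ℤ) G]
    nth_rw 4 [← aeval_X (R := ℤ) G]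
    rw [← map_mul, ← map_mul, mul_comm]
  obtain ⟨m, b, M, hM⟩ := exists_integral_basis (g := G) (h := H) ⟨P, hP, hPg⟩
    (aeval_mem_adjoin_singleton ℤ G) hGH hHG
  have hinj : Function.Injective (lieBaseChange ℝ g) := by
    have h1 : H.baseChange ℝ ∘ₗ G.baseChange ℝ = LinearMap.id := by
      rw [← LinearMap.baseChange_comp]
      exact (congrArg (LinearMap.baseChange ℝ) hHG).trans LinearMap.baseChange_id
    exact Function.LeftInverse.injective (g := H.baseChange ℝ) fun x => LinearMap.congr_fun h1 x
  have hsurj : Function.Surjective (lieBaseChange ℝ g) := by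
    have h1 : G.baseChange ℝ ∘ₗ H.baseChange ℝ = LinearMap.id := by
      rw [← LinearMap.baseChange_comp]
      exact (congrArg (LinearMap.baseChange ℝ) hGH).trans LinearMap.baseChange_id
    exact Function.RightInverse.surjective (g := H.baseChange ℝ) fun x => LinearMap.congr_fun h1 x
  refine ⟨LieEquiv.ofBijective (lieBaseChange ℝ g) ⟨hinj, hsurj⟩, m, b.baseChange ℝ, M, ?_, ?_, ?_⟩
  · intro i j k
    refine ⟨b.repr ⁅b i, b j⁆ k, ?_⟩
    rw [Module.Basis.baseChange_apply, Module.Basis.baseChange_apply, LieAlgebra.ExtendScalars.bracket_tmul,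
      Module.Basis.baseChange_repr_tmul]
    simp [Algebra.smul_def]
  · ext i j
    have h1 := congrFun (congrFun hM i) j
    rw [LinearMap.toMatrix_apply, Matrix.map_apply] at h1
    rw [LinearMap.toMatrix_apply, Matrix.map_apply, Module.Basis.baseChange_apply]
    have h2 : (b.baseChange ℝ).repr ((1 : ℝ) ⊗ₜ[ℚ] G (b j)) i = b.repr (G (b j)) i • (1 : ℝ) :=
      Module.Basis.baseChange_repr_tmul _ b 1 (G (b j)) i
    refine Eq.trans h2 ?_
    rw [h1, Algebra.smul_def]
    simp
  · intro μ hμ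
    refine hyp μ ?_
    have hMP : aeval (M : Matrix (Fin m) (Fin m) ℤ) P = 0 := by
      have h1 : aeval ((M : Matrix (Fin m) (Fin m) ℤ).map (Int.cast : ℤ → ℚ)) P = 0 := by
        rw [← hM]
        have h2 := aeval_algHom_apply ((LinearMap.toMatrixAlgEquiv b).toAlgHom.restrictScalars ℤ) G P
        rw [hPg, map_zero] at h2
        exact h2
      have h3 := aeval_algHom_apply (Int.castRingHom ℚ).toIntAlgHom.mapMatrix
        (M : Matrix (Fin m) (Fin m) ℤ) P
      have h4 : (Int.castRingHom ℚ).toIntAlgHom.mapMatrix (aeval (M : Matrix (Fin m) (Fin m) ℤ) P) = 0 :=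
        h3.symm.trans h1
      ext i j
      have h5 := congrFun (congrFun h4 i) j
      exact Int.cast_injective (α := ℚ) (by simpa using h5)
    have hMC : aeval ((M : Matrix (Fin m) (Fin m) ℤ).map (Int.cast : ℤ → ℂ))
        (P.map (algebraMap ℤ ℂ)) = 0 := by
      rw [aeval_map_algebraMap]
      have h3 := aeval_algHom_apply (Int.castRingHom ℂ).toIntAlgHom.mapMatrix
        (M : Matrix (Fin m) (Fin m) ℤ) P
      rw [hMP, map_zero] at h3
      exact h3
    rw [← Matrix.mem_spectrum_iff_isRoot_charpoly] at hμ
    have h1 := spectrum.subset_polynomial_aeval _ (P.map (algebraMap ℤ ℂ)) ⟨μ, hμ, rfl⟩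
    rw [hMC] at h1
    by_contra h0
    refine h1 ?_
    rw [spectrum.mem_resolventSet_iff, sub_zero]
    exact (IsUnit.mk0 _ h0).map (algebraMap ℂ _)

end Lattice

/-! ### Rational quotients -/

section Quotients

open LieModule

theorem IsAnosov.of_equiv {L L' : Type*} [LieRing L] [LieAlgebra ℝ L] [LieRing L'] [LieAlgebra ℝ L']
    (h : IsAnosov L) (e : L ≃ₗ⁅ℝ⁆ L') : IsAnosov L' := by
  obtain ⟨f, m, b, M, hb, hM, hμ⟩ := h
  refine ⟨(e.symm.trans f).trans e, m, b.map e.toLinearEquiv, M, ?_, ?_, hμ⟩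
  · intro i j k
    obtain ⟨q, hq⟩ := hb i j k
    refine ⟨q, ?_⟩
    rw [Module.Basis.map_apply, Module.Basis.map_apply, Module.Basis.map_repr, ← hq]
    change b.repr (e.symm ⁅e (b i), e (b j)⁆) k = _
    rw [← LieEquiv.map_lie, LieEquiv.symm_apply_apply]
  · rw [← hM]
    ext i j
    rw [LinearMap.toMatrix_apply, LinearMap.toMatrix_apply, Module.Basis.map_apply,
      Module.Basis.map_repr]
    change b.repr (e.symm (e (f (e.symm (e (b j)))))) i = b.repr (f (b j)) i
    rw [LieEquiv.symm_apply_apply, LieEquiv.symm_apply_apply]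

variable {n r : ℕ}

/-- The projection onto a quotient by an ideal. -/
def quotHom {R L : Type*} [CommRing R] [LieRing L] [LieAlgebra R L] (I : LieIdeal R L) :
    L →ₗ⁅R⁆ (L ⧸ I) :=
  { LieSubmodule.Quotient.mk' I with
    map_lie' := fun {_ _} => rfl }

theorem quotHom_surjective {R L : Type*} [CommRing R] [LieRing L] [LieAlgebra R L]
    (I : LieIdeal R L) : Function.Surjective (quotHom I) :=
  LieSubmodule.Quotient.surjective_mk' I

theorem quotHom_eq_zero {R L : Type*} [CommRing R] [LieRing L] [LieAlgebra R L]
    {I : LieIdeal R L} {x : L} : quotHom I x = 0 ↔ x ∈ I :=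
  LieSubmodule.Quotient.mk_eq_zero'

theorem ker_quotHom {R L : Type*} [CommRing R] [LieRing L] [LieAlgebra R L] (I : LieIdeal R L) :
    (quotHom I).ker = I := by
  ext x
  rw [LieHom.mem_ker, quotHom_eq_zero]

/-- The endomorphism of a quotient induced by an endomorphism preserving the ideal. -/
def quotEnd {R L : Type*} [CommRing R] [LieRing L] [LieAlgebra R L] {I : LieIdeal R L}
    (g : L →ₗ⁅R⁆ L) (hg : ∀ x ∈ I, g x ∈ I) : (L ⧸ I) →ₗ⁅R⁆ (L ⧸ I) :=
  { Submodule.mapQ I.toSubmodule I.toSubmodule (g : L →ₗ[R] L) hg with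
    map_lie' := by
      intro x y
      obtain ⟨x, rfl⟩ := quotHom_surjective I x
      obtain ⟨y, rfl⟩ := quotHom_surjective I y
      exact congrArg (quotHom I) (LieHom.map_lie g x y) }

/-- A rational quotient of the free nilpotent Lie algebra is Anosov if it has an endomorphism that is
annihilated by the polynomial of a hyperbolic unit. -/
theorem isAnosov_quotient {I : LieIdeal ℚ (FreeNilQ n r)} (g : FreeNilQ n r →ₗ⁅ℚ⁆ FreeNilQ n r)
    (hg : ∀ x ∈ I, g x ∈ I) {P : ℤ[X]} (hP : P.Monic) (hP0 : IsUnit (P.coeff 0))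
    (hPg : ∀ x, aeval (g : Module.End ℚ (FreeNilQ n r)) P x ∈ I)
    (hyp : ∀ μ : ℂ, (P.map (Int.castRingHom ℂ)).IsRoot μ → ‖μ‖ ≠ 1) :
    IsAnosov (FreeNil ℝ n r ⧸ I.baseChange ℝ) := by
  have hfin : Module.Finite ℚ (FreeNilQ n r ⧸ I) :=
    Module.Finite.of_surjective (quotHom I : FreeNilQ n r →ₗ[ℚ] _) (quotHom_surjective I)
  have h1 : ∀ (Q : ℤ[X]) (x : FreeNilQ n r),
      aeval (quotEnd g hg : Module.End ℚ (FreeNilQ n r ⧸ I)) Q (quotHom I x) =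
        quotHom I (aeval (g : Module.End ℚ (FreeNilQ n r)) Q x) := by
    intro Q x
    induction Q using Polynomial.induction_on' generalizing x with
    | add P Q hP hQ => rw [map_add, map_add, LinearMap.add_apply, LinearMap.add_apply, map_add, hP, hQ]
    | monomial k c =>
      rw [aeval_monomial, aeval_monomial, Module.End.mul_apply, Module.End.mul_apply,
        Module.algebraMap_end_apply, Module.algebraMap_end_apply, map_zsmul]
      congr 1
      induction k generalizing x with
      | zero => rfl
      | succ k ih =>
        rw [pow_succ, pow_succ, Module.End.mul_apply, Module.End.mul_apply]
        exact ih (g x)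
  have h2 : IsAnosov (ℝ ⊗[ℚ] (FreeNilQ n r ⧸ I)) := by
    refine isAnosov_baseChange (quotEnd g hg) hP hP0 ?_ hyp
    ext x
    obtain ⟨x, rfl⟩ := quotHom_surjective I x
    rw [h1, LinearMap.zero_apply, quotHom_eq_zero]
    exact hPg x
  obtain ⟨e⟩ := nonempty_quotient_equiv (lieBaseChange ℝ (quotHom I))
    (lieBaseChange_surjective (quotHom_surjective I)) (I.baseChange ℝ)
    (by rw [ker_lieBaseChange, ker_quotHom])
  exact h2.of_equiv e

variable {K : Type*} [Field K] [Algebra ℚ K]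

/-- The rational ideal generated by the rational points of the orbits of a set of vectors. -/
def orbitIdeal (W : Set (FreeNil K n r)) : LieIdeal ℚ (FreeNilQ n r) :=
  LieSubmodule.lieSpan ℚ (FreeNilQ n r) (⋃ w ∈ W, (ratPart (orbitSpan w) : Set (FreeNilQ n r)))

theorem ratPart_orbitSpan_le {W : Set (FreeNil K n r)} {w : FreeNil K n r} (hw : w ∈ W) :
    ratPart (orbitSpan w) ≤ (orbitIdeal W).toSubmodule := fun _ hv =>
  LieSubmodule.subset_lieSpan (Set.mem_biUnion hw hv)

/-- An ideal generated by the real forms of orbits is, up to the change `φ` of the rational structure,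
the real form of the rational ideal `orbitIdeal W`. -/
theorem mem_orbitIdeal_iff {φ : FreeNil ℝ n r ≃ₗ⁅ℝ⁆ FreeNil ℝ n r} {W : Set (FreeNil K n r)}
    {I : LieIdeal ℝ (FreeNil ℝ n r)} (hI : I = LieSubmodule.lieSpan ℝ (FreeNil ℝ n r)
      (⋃ w ∈ W, φ '' (toReal (orbitSpan w) : Set (FreeNil ℝ n r)))) (x : FreeNil ℝ n r) :
    φ x ∈ I ↔ x ∈ (orbitIdeal W).baseChange ℝ := by
  constructor
  · have h1 : I ≤ LieIdeal.comap (φ.symm : FreeNil ℝ n r →ₗ⁅ℝ⁆ FreeNil ℝ n r)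
        ((orbitIdeal W).baseChange ℝ) := by
      rw [hI, LieSubmodule.lieSpan_le]
      refine Set.iUnion₂_subset fun w hw => ?_
      rintro _ ⟨y, hy, rfl⟩
      change φ.symm (φ y) ∈ (orbitIdeal W).baseChange ℝ
      rw [LieEquiv.symm_apply_apply]
      exact Submodule.baseChange_mono ℝ (ratPart_orbitSpan_le hw) hy
    intro hx
    have h2 : φ.symm (φ x) ∈ (orbitIdeal W).baseChange ℝ := h1 hx
    rwa [LieEquiv.symm_apply_apply] at h2
  · let I' : LieIdeal ℝ (FreeNil ℝ n r) := I.comap (φ : FreeNil ℝ n r →ₗ⁅ℝ⁆ FreeNil ℝ n r)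
    let J : LieIdeal ℚ (FreeNilQ n r) :=
      { (I'.toSubmodule.restrictScalars ℚ).comap (TensorProduct.mk ℚ ℝ (FreeNilQ n r) 1) with
        lie_mem := by
          intro y v hv
          change (1 : ℝ) ⊗ₜ[ℚ] ⁅y, v⁆ ∈ I'
          have h1 : (1 : ℝ) ⊗ₜ[ℚ] ⁅y, v⁆ = ⁅(1 : ℝ) ⊗ₜ[ℚ] y, (1 : ℝ) ⊗ₜ[ℚ] v⁆ := by
            rw [LieAlgebra.ExtendScalars.bracket_tmul, one_mul]
          rw [h1]
          exact lie_mem_right ℝ _ I' _ _ hv }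
    have h1 : orbitIdeal W ≤ J := by
      rw [orbitIdeal, LieSubmodule.lieSpan_le]
      refine Set.iUnion₂_subset fun w hw v hv => ?_
      change φ ((1 : ℝ) ⊗ₜ[ℚ] v) ∈ I
      rw [hI]
      exact LieSubmodule.subset_lieSpan (Set.mem_biUnion hw
        ⟨_, Submodule.tmul_mem_baseChange_of_mem 1 hv, rfl⟩)
    have h2 : (orbitIdeal W).toSubmodule.baseChange ℝ ≤ I'.toSubmodule :=
      baseChange_le_iff.2 fun v hv => h1 hv
    exact fun hx => h2 hx

theorem nonempty_quotient_orbitIdeal {φ : FreeNil ℝ n r ≃ₗ⁅ℝ⁆ FreeNil ℝ n r}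
    {W : Set (FreeNil K n r)}
    {I : LieIdeal ℝ (FreeNil ℝ n r)} (hI : I = LieSubmodule.lieSpan ℝ (FreeNil ℝ n r)
      (⋃ w ∈ W, φ '' (toReal (orbitSpan w) : Set (FreeNil ℝ n r)))) :
    Nonempty ((FreeNil ℝ n r ⧸ I) ≃ₗ⁅ℝ⁆ (FreeNil ℝ n r ⧸ (orbitIdeal W).baseChange ℝ)) := by
  refine nonempty_quotient_equiv ((quotHom I).comp (φ : FreeNil ℝ n r →ₗ⁅ℝ⁆ FreeNil ℝ n r))
    ((quotHom_surjective I).comp φ.surjective) _ ?_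
  ext x
  rw [LieHom.mem_ker, LieHom.comp_apply, quotHom_eq_zero, ← mem_orbitIdeal_iff hI]
  rfl

theorem map_mem_orbitIdeal {W : Set (FreeNil K n r)} (g : FreeNilQ n r →ₗ⁅ℚ⁆ FreeNilQ n r)
    (hW : ∀ w ∈ W, ∃ c : K, lieBaseChange K g w = c • w) :
    ∀ x ∈ orbitIdeal W, g x ∈ orbitIdeal W := by
  have h1 : orbitIdeal W ≤ (orbitIdeal W).comap g := by
    rw [orbitIdeal, LieSubmodule.lieSpan_le]
    refine Set.iUnion₂_subset fun w hw v hv => ?_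
    refine LieSubmodule.subset_lieSpan (Set.mem_biUnion hw ?_)
    obtain ⟨c, hc⟩ := hW w hw
    have h2 : orbitSpan w ≤ (orbitSpan w).comap ((g : FreeNilQ n r →ₗ[ℚ] FreeNilQ n r).baseChange K) := by
      refine Submodule.span_le.2 ?_
      rintro _ ⟨s, rfl⟩
      change (g : FreeNilQ n r →ₗ[ℚ] FreeNilQ n r).baseChange K (galAct s w) ∈ orbitSpan w
      rw [← galAct_baseChange]
      refine galAct_mem_orbitSpan s ?_
      change lieBaseChange K g w ∈ _
      rw [hc]
      exact Submodule.smul_mem _ _ (mem_orbitSpan w)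
    have h3 := h2 (mem_ratPart.1 hv)
    rw [Submodule.mem_comap, LinearMap.baseChange_tmul] at h3
    exact h3
  exact fun x hx => h1 hx

end Quotients

/-! ### Units in Galois extensions of odd degree -/

section Units

variable {K : Type*} [Field K]

theorem isUnit_coeff_zero_minpoly [CharZero K] {x : K} (hx0 : x ≠ 0) (hx : IsIntegral ℤ x)
    (hx' : IsIntegral ℤ x⁻¹) : IsUnit ((minpoly ℤ x).coeff 0) := by
  -- The reverse of a monic polynomial of `x⁻¹` vanishes at `x` and has constant coefficient `1`.
  have h1 : minpoly ℤ x ∣ (minpoly ℤ x⁻¹).reverse := by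
    refine minpoly.isIntegrallyClosed_dvd hx ?_
    let _ : Invertible x⁻¹ := invertibleOfNonzero (inv_ne_zero hx0)
    have := eval₂_reverse_eq_zero_iff (algebraMap ℤ K) x⁻¹ (minpoly ℤ x⁻¹)
    rw [invOf_eq_inv, inv_inv] at this
    exact this.2 (minpoly.aeval ℤ x⁻¹)
  obtain ⟨q, hq⟩ := h1
  have h2 := congrArg (fun p => p.coeff 0) hq
  simp only [coeff_zero_reverse, mul_coeff_zero] at h2
  rw [(minpoly.monic hx').leadingCoeff] at h2
  exact IsUnit.of_mul_eq_one _ h2.symm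

variable [NumberField K]

/-- By Dirichlet's unit theorem, since a field of degree at least three has at least two infinite
places. -/
theorem exists_unit_of_infinite_order (h : 3 ≤ Module.finrank ℚ K) :
    ∃ a : K, a ≠ 0 ∧ IsIntegral ℤ a ∧ IsIntegral ℤ a⁻¹ ∧ ∀ N : ℕ, 0 < N → a ^ N ≠ 1 := by
  have hrank : 0 < NumberField.Units.rank K := by
    have h1 := NumberField.InfinitePlace.card_add_two_mul_card_eq_rank K
    have h2 := NumberField.InfinitePlace.card_eq_nrRealPlaces_add_nrComplexPlaces K
    rw [NumberField.Units.rank]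
    omega
  let u := NumberField.Units.fundSystem K ⟨0, hrank⟩
  have hu : ∀ N : ℕ, 0 < N → u ^ N ≠ 1 := by
    intro N hN hpow
    have h1 : u ∈ NumberField.Units.torsion K :=
      (CommGroup.mem_torsion _).2 (isOfFinOrder_iff_pow_eq_one.2 ⟨N, hN, hpow⟩)
    have h2 := NumberField.Units.logEmbedding_fundSystem K ⟨0, hrank⟩
    rw [NumberField.Units.dirichletUnitTheorem.logEmbedding_eq_zero_iff.2 h1] at h2
    exact (NumberField.Units.basisUnitLattice K).ne_zero ⟨0, hrank⟩ (Subtype.ext h2.symm)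
  refine ⟨(u : NumberField.RingOfIntegers K), ?_, NumberField.RingOfIntegers.isIntegral_coe _, ?_, ?_⟩
  · exact NumberField.Units.coe_ne_zero u
  · have h1 : ((u : NumberField.RingOfIntegers K) : K)⁻¹ = ((u⁻¹ : (NumberField.RingOfIntegers K)ˣ) :
        NumberField.RingOfIntegers K) := by simp
    rw [h1]
    exact NumberField.RingOfIntegers.isIntegral_coe _
  · intro N hN hpow
    refine hu N hN (Units.ext (NumberField.RingOfIntegers.ext ?_))
    simpa using hpow

/-- A Galois extension of `ℚ` of odd degree is totally real, so that its only elements of absolute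
value one are `1` and `-1`. -/
theorem sq_eq_one_of_norm_eq_one [IsGalois ℚ K] (hodd : Odd (Module.finrank ℚ K)) {x : K}
    (hx : IsIntegral ℤ x) {μ : ℂ} (hμ : ((minpoly ℤ x).map (Int.castRingHom ℂ)).IsRoot μ)
    (hnorm : ‖μ‖ = 1) : x ^ 2 = 1 := by
  obtain ⟨τ, rfl⟩ : ∃ τ : K →+* ℂ, τ x = μ := by
    have h1 : μ ∈ (minpoly ℚ x).rootSet ℂ := by
      rw [mem_rootSet, minpoly.isIntegrallyClosed_eq_field_fractions' ℚ hx]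
      refine ⟨((minpoly.monic hx).map _).ne_zero, ?_⟩
      rw [aeval_def, eval₂_map]
      rw [IsRoot, eval_map] at hμ
      exact hμ
    rw [← NumberField.Embeddings.range_eval_eq_rootSet_minpoly K ℂ x] at h1
    exact h1
  obtain ⟨s, hs⟩ := NumberField.ComplexEmbedding.exists_comp_symm_eq_of_comp_eq (k := ℚ) τ
    ((starRingEnd ℂ).comp τ) (Subsingleton.elim _ _)
  have hs1 : ∀ y, τ (s.symm y) = starRingEnd ℂ (τ y) := fun y => RingHom.congr_fun hs y
  have hs2 : s.symm ^ 2 = 1 := by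
    ext y
    apply τ.injective
    rw [pow_two, AlgEquiv.mul_apply, hs1, hs1, Complex.conj_conj, AlgEquiv.one_apply]
  have hs3 : s.symm = 1 := by
    have h1 : s.symm ^ Module.finrank ℚ K = 1 := by
      rw [← IsGalois.card_aut_eq_finrank ℚ K]
      exact pow_card_eq_one'
    have h2 : orderOf s.symm ∣ 1 := by
      rw [← (Nat.coprime_two_left.2 hodd)]
      exact Nat.dvd_gcd (orderOf_dvd_of_pow_eq_one hs2) (orderOf_dvd_of_pow_eq_one h1)
    exact orderOf_eq_one_iff.1 (Nat.dvd_one.1 h2)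
  have hreal : starRingEnd ℂ (τ x) = τ x := by rw [← hs1, hs3, AlgEquiv.one_apply]
  apply τ.injective
  have h1 := Complex.mul_conj (τ x)
  rw [hreal, Complex.normSq_eq_norm_sq, hnorm] at h1
  rw [map_pow, map_one, pow_two, h1]
  simp

end Units

/-! ### Rational automorphisms that are diagonal in a cyclic frame -/

section Diagonal

open LieModule

variable {n r : ℕ} {K : Type*} [Field K] [Algebra ℚ K]

theorem galAct_induction {σ : K ≃ₐ[ℚ] K} (hσ : ∀ g : K ≃ₐ[ℚ] K, g ∈ Submonoid.powers σ)
    {x : FreeNil K n r} (hx : galAct σ x = x) (g : K ≃ₐ[ℚ] K) : galAct g x = x := by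
  obtain ⟨m, rfl⟩ := hσ g
  simp only
  induction m with
  | zero => rw [pow_zero, galAct_one]
  | succ m ih => rw [galAct_pow, ih, hx]

/-- The diagonal endomorphism commutes with the Galois group, so it descends to `ℚ`. -/
theorem exists_diagonal_lieHom [FiniteDimensional ℚ K] [IsGalois ℚ K] {z : Fin n → FreeNil K n r}
    (hli : LinearIndependent K z) (hspan : Submodule.span K (Set.range z) = stepOne K n r)
    {σ : K ≃ₐ[ℚ] K} (hσ : ∀ g : K ≃ₐ[ℚ] K, g ∈ Submonoid.powers σ)
    (hz : ∀ j, galAct σ (z j) = z (finRotate n j)) {α : Fin n → K}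
    (hα : ∀ j, σ (α j) = α (finRotate n j)) :
    ∃ g : FreeNilQ n r →ₗ⁅ℚ⁆ FreeNilQ n r, ∀ j, lieBaseChange K g (z j) = α j • z j := by
  obtain ⟨D, hD⟩ := LinearMap.exists_extend
    ((Module.Basis.span hli).constr K fun j => α j • z j)
  have hDz : ∀ j, D (z j) = α j • z j := by
    intro j
    have h1 := LinearMap.congr_fun hD (Module.Basis.span hli j)
    rw [Module.Basis.constr_basis, LinearMap.comp_apply, Submodule.subtype_apply] at h1
    rwa [Module.Basis.span_apply] at h1
  have hcomm : ∀ x ∈ Submodule.span K (Set.range z), galAct σ (D x) = D (galAct σ x) := by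
    intro x hx
    induction hx using Submodule.span_induction with
    | mem x hx =>
      obtain ⟨j, rfl⟩ := hx
      rw [hDz, galAct_smul, hz, hα, hDz]
    | zero => simp
    | add x y _ _ hx hy => rw [map_add, map_add, map_add, map_add, hx, hy]
    | smul c x _ hx => rw [map_smul, galAct_smul, galAct_smul, map_smul, hx]
  have hgen : ∀ j, ∃ v : FreeNilQ n r, (1 : K) ⊗ₜ[ℚ] v = D (gen K n r j) := by
    intro j
    refine exists_one_tmul_of_galAct_fixed (galAct_induction hσ ?_)
    rw [hcomm _ (hspan ▸ Submodule.subset_span ⟨j, rfl⟩), galAct_gen]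
  choose v hv using hgen
  refine ⟨freeNilLift lcs_freeNilQ v, fun j => ?_⟩
  rw [← hDz]
  have h1 : Set.EqOn (lieBaseChange K (freeNilLift lcs_freeNilQ v) : FreeNil K n r →ₗ[K] FreeNil K n r)
      D (stepOne K n r) := by
    refine LinearMap.eqOn_span ?_
    rintro _ ⟨i, rfl⟩
    rw [← hv]
    change (lieBaseChange K (freeNilLift lcs_freeNilQ v)) ((1 : K) ⊗ₜ[ℚ] genQ n r i) = _
    rw [lieBaseChange_apply, LinearMap.baseChange_tmul]
    exact congrArg _ (freeNilLift_genQ lcs_freeNilQ v i)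
  exact h1 (show z j ∈ stepOne K n r from hspan ▸ Submodule.subset_span ⟨j, rfl⟩)

end Diagonal

/-! ### Anosov quotients for odd prime degree -/

section OddPrime

open LieModule

variable {n r : ℕ} {K : Type*} [Field K]

theorem aeval_apply_of_apply_eq_smul {V : Type*} [AddCommGroup V] [Module K V] {f : Module.End K V}
    {x : V} {μ : K} (h : f x = μ • x) (Q : ℤ[X]) : aeval f Q x = aeval μ Q • x := by
  induction Q using Polynomial.induction_on' with
  | add P Q hP hQ => rw [map_add, map_add, LinearMap.add_apply, hP, hQ, add_smul]
  | monomial k c =>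
    have hpow : (f ^ k) x = μ ^ k • x := by
      induction k with
      | zero => simp
      | succ k ih => rw [pow_succ', Module.End.mul_apply, ih, map_smul, h, smul_smul, pow_succ]
    rw [aeval_monomial, aeval_monomial, Module.End.mul_apply, hpow, Module.algebraMap_end_apply,
      mul_smul, algebraMap_int_eq, eq_intCast, Int.cast_smul_eq_zsmul]

theorem lieHom_bracketEval {L : Type*} [LieRing L] [LieAlgebra K L] {G : L →ₗ⁅K⁆ L} {z : Fin n → L}
    {α : Fin n → K} (hz : ∀ j, G (z j) = α j • z j) (t : FreeMagma (Fin n)) :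
    G (bracketEval z t) = (∏ j, α j ^ letterCount j t) • bracketEval z t := by
  rw [map_bracketEval, ← bracketEval_smul]
  congr 1
  funext j
  exact hz j

variable [Algebra ℚ K]

/-- Permuting the letters of an iterated bracket permutes its letter counts. -/
theorem exists_bracketEval_comp {L : Type*} [LieRing L] (z : Fin n → L) (π : Equiv.Perm (Fin n))
    (t : FreeMagma (Fin n)) : ∃ t', bracketEval (fun i => z (π i)) t = bracketEval z t' ∧
      ∀ j, letterCount (π j) t' = letterCount j t := by
  induction t with
  | ih1 i => exact ⟨FreeMagma.of (π i), rfl, fun j => by simp [letterCount_of]⟩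
  | ih2 s t hs ht =>
    obtain ⟨s', hs, hs'⟩ := hs
    obtain ⟨t', ht, ht'⟩ := ht
    refine ⟨s' * t', ?_, fun j => by rw [letterCount_mul, letterCount_mul, hs', ht']⟩
    change ⁅bracketEval _ s, bracketEval _ t⁆ = ⁅bracketEval z s', bracketEval z t'⁆
    rw [hs, ht]

theorem bracketEval_mem_jIdeal {z : Fin n → FreeNil K n r} {t : FreeMagma (Fin n)}
    (ht : ∃ k : ℕ, ∀ j, letterCount j t = k) : bracketEval z t ∈ jIdeal z :=
  LieSubmodule.subset_lieSpan ⟨t, ht, rfl⟩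

/-- A Galois automorphism that permutes the frame preserves `𝔧`. -/
theorem galAct_mem_jIdeal {z : Fin n → FreeNil K n r} {g : K ≃ₐ[ℚ] K} {π : Equiv.Perm (Fin n)}
    (hg : ∀ j, galAct g (z j) = z (π j)) {x : FreeNil K n r} (hx : x ∈ jIdeal z) :
    galAct g x ∈ jIdeal z := by
  let E : LieIdeal K (FreeNil K n r) :=
    { carrier := {x | galAct g x ∈ jIdeal z}
      add_mem' := fun {x y} hx hy => by
        change galAct g (x + y) ∈ jIdeal z
        rw [map_add]
        exact add_mem hx hy
      zero_mem' := by
        change galAct g 0 ∈ jIdeal z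
        rw [map_zero]
        exact zero_mem _
      smul_mem' := fun c x hx => by
        change galAct g (c • x) ∈ jIdeal z
        rw [galAct_smul]
        exact (jIdeal z).toSubmodule.smul_mem _ hx
      lie_mem := fun {y x} hx => by
        change galAct g ⁅y, x⁆ ∈ jIdeal z
        rw [galAct_lie]
        exact lie_mem_right K _ (jIdeal z) _ _ hx }
  have h1 : jIdeal z ≤ E := by
    rw [jIdeal, LieSubmodule.lieSpan_le]
    rintro _ ⟨t, ⟨k, hk⟩, rfl⟩
    change galAct g (bracketEval z t) ∈ jIdeal z
    have h2 : (fun i => galAct g (z i)) = fun i => z (π i) := funext hg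
    obtain ⟨t', ht', hcount⟩ := exists_bracketEval_comp z π t
    rw [galAct_bracketEval, h2, ht']
    refine bracketEval_mem_jIdeal ⟨k, fun j => ?_⟩
    rw [← π.apply_symm_apply j, hcount, hk]
  exact h1 hx

theorem exists_galAct_eq_perm {z : Fin n → FreeNil K n r} {σ : K ≃ₐ[ℚ] K} {π : Equiv.Perm (Fin n)}
    (hσ : ∀ g : K ≃ₐ[ℚ] K, g ∈ Submonoid.powers σ) (hz : ∀ j, galAct σ (z j) = z (π j))
    (g : K ≃ₐ[ℚ] K) : ∃ ρ : Equiv.Perm (Fin n), ∀ j, galAct g (z j) = z (ρ j) := by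
  obtain ⟨m, rfl⟩ := hσ g
  simp only
  induction m with
  | zero => exact ⟨1, fun j => by rw [pow_zero, galAct_one]; rfl⟩
  | succ m ih =>
    obtain ⟨ρ, hρ⟩ := ih
    exact ⟨π * ρ, fun j => by rw [galAct_pow, hρ, hz]; rfl⟩

theorem mem_powers_of_forall_mem_zpowers [FiniteDimensional ℚ K] {σ : K ≃ₐ[ℚ] K}
    (hσ : ∀ g : K ≃ₐ[ℚ] K, g ∈ Subgroup.zpowers σ) (g : K ≃ₐ[ℚ] K) : g ∈ Submonoid.powers σ := by
  have : Finite (K ≃ₐ[ℚ] K) := inferInstance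
  rw [mem_powers_iff_mem_zpowers]
  exact hσ g

/-- The ideal `𝔧` is rational, so that it lies in the complexification of every rational ideal that
contains its rational points. -/
theorem jIdeal_le_baseChange [FiniteDimensional ℚ K] [IsGalois ℚ K] {z : Fin n → FreeNil K n r}
    (hz : IsCyclicFrame z) {I : LieIdeal ℚ (FreeNilQ n r)}
    (hI : ratPart (jIdeal z).toSubmodule ≤ I.toSubmodule) :
    (jIdeal z).toSubmodule ≤ I.toSubmodule.baseChange K := by
  obtain ⟨σ, hσ, hσz⟩ := hz.cyclic
  have hrat : IsRational (jIdeal z).toSubmodule := isRational_of_galAct_mem fun g x hx => by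
    obtain ⟨ρ, hρ⟩ := exists_galAct_eq_perm (mem_powers_of_forall_mem_zpowers hσ) hσz g
    exact galAct_mem_jIdeal hρ hx
  rw [← (hrat : (ratPart (jIdeal z).toSubmodule).baseChange K = (jIdeal z).toSubmodule)]
  exact Submodule.baseChange_mono K hI

theorem one_tmul_aeval {V : Type*} [AddCommGroup V] [Module ℚ V] (f : Module.End ℚ V) (Q : ℤ[X])
    (v : V) : (1 : K) ⊗ₜ[ℚ] aeval f Q v =
      aeval (f.baseChange K : Module.End K (K ⊗[ℚ] V)) Q ((1 : K) ⊗ₜ v) := by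
  have h := aeval_algHom_apply ((Module.End.baseChangeHom ℚ K V).restrictScalars ℤ) f Q
  refine Eq.trans ?_ (LinearMap.congr_fun h.symm ((1 : K) ⊗ₜ v))
  rfl

theorem exists_finset_span_bracketEval {z : Fin n → FreeNil K n r}
    (hz : Submodule.span K (Set.range z) = stepOne K n r) :
    ∃ T : Finset (FreeMagma (Fin n)), Submodule.span K (bracketEval z '' (T : Set _)) = ⊤ := by
  classical
  have h1 : (Submodule.span K (Set.range (bracketEval z))).FG := by
    rw [span_bracketEval_freeNil hz]
    exact Module.Finite.fg_top
  obtain ⟨s, hs, hspan⟩ := (Submodule.fg_span_iff_fg_span_finset_subset _).1 h1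
  rw [← Set.image_univ] at hs
  obtain ⟨T, -, rfl⟩ := Finset.subset_set_image_iff.1 hs
  refine ⟨T, ?_⟩
  rw [← Finset.coe_image, ← hspan, span_bracketEval_freeNil hz]

/-- Weight vectors are eigenvectors of diagonal maps of determinant one. -/
theorem IsWeightVector.exists_eq_smul {L : FreeNil K n r →ₗ⁅K⁆ FreeNil K n r}
    {z : Fin n → FreeNil K n r} {α : Fin n → K} (hα0 : ∀ j, α j ≠ 0) (hα : ∏ j, α j = 1)
    (hz : ∀ j, L (z j) = α j • z j) {w : FreeNil K n r} (hw : IsWeightVector z w) :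
    ∃ c : K, L w = c • w := by
  obtain ⟨d, hd⟩ := hw
  refine ⟨∏ j, α j ^ d j, ?_⟩
  have h1 : Submodule.span K {u | ∃ t : FreeMagma (Fin n),
      (∃ k : ℤ, ∀ j, (letterCount j t : ℤ) = d j + k) ∧ u = bracketEval z t} ≤
      LinearMap.ker ((L : FreeNil K n r →ₗ[K] FreeNil K n r) - (∏ j, α j ^ d j) • LinearMap.id) := by
    refine Submodule.span_le.2 ?_
    rintro _ ⟨t, ⟨k, hk⟩, rfl⟩
    have h2 : ∏ j, α j ^ letterCount j t = ∏ j, α j ^ d j := by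
      have h3 : ∀ j, α j ^ letterCount j t = α j ^ d j * α j ^ k := fun j => by
        rw [← zpow_add₀ (hα0 j), ← hk, zpow_natCast]
      rw [Finset.prod_congr rfl fun j _ => h3 j, Finset.prod_mul_distrib, Finset.prod_zpow, hα,
        one_zpow, mul_one]
    have h4 := lieHom_bracketEval hz t
    rw [h2] at h4
    rw [SetLike.mem_coe, LinearMap.mem_ker, LinearMap.sub_apply]
    exact sub_eq_zero.2 h4
  exact sub_eq_zero.1 (h1 hd)

/-- The diagonal automorphism whose eigenvalues on the frame are the conjugates of the square of a
unit of infinite order has determinant one, so it preserves the ideal, and it is hyperbolic on the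
quotient because the only products of powers of the conjugates of absolute value one are those with
constant exponents, which belong to `𝔧`. -/
theorem isAnosov_of_odd (hn : n.Prime) (hn3 : 3 ≤ n) {z : Fin n → FreeNil K n r}
    (hz : IsCyclicFrame z) {W : Set (FreeNil K n r)} (hW : ∀ w ∈ W, IsWeightVector z w)
    (hj : ratPart (jIdeal z).toSubmodule ≤ (orbitIdeal W).toSubmodule) :
    IsAnosov (FreeNil ℝ n r ⧸ (orbitIdeal W).baseChange ℝ) := by
  rename_i instAlg
  -- The theory of number fields uses the default `ℚ`-algebra structure of a field.
  have hchar : CharZero K := algebraRat.charZero K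
  obtain rfl : instAlg = DivisionRing.toRatAlgebra := Subsingleton.elim _ _
  have hgal := hz.isGalois
  have hfin : FiniteDimensional ℚ K :=
    Module.finite_of_finrank_pos (by rw [hz.finrank_eq]; exact hn.pos)
  have hNF : NumberField K := { }
  obtain ⟨σ, hσ, hσz⟩ := hz.cyclic
  have hσpow := mem_powers_of_forall_mem_zpowers hσ
  have hσn : σ ^ n = 1 := by
    rw [← hz.finrank_eq, ← IsGalois.card_aut_eq_finrank ℚ K]
    exact pow_card_eq_one'
  obtain ⟨a, ha0, haint, haint', hator⟩ := exists_unit_of_infinite_order (K := K)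
    (by rw [hz.finrank_eq]; exact hn3)
  let β : Fin n → K := fun j => (σ ^ (j : ℕ)) a
  have hβ0 : ∀ j, β j ≠ 0 := fun j => (_root_.map_ne_zero _).2 ha0
  have hβint : ∀ j, IsIntegral ℤ (β j) := fun j => haint.map ((σ ^ (j : ℕ) : K ≃ₐ[ℚ] K) : K →ₐ[ℚ] K)
  have hβint' : ∀ j, IsIntegral ℤ (β j)⁻¹ := fun j => by
    rw [← map_inv₀]
    exact haint'.map ((σ ^ (j : ℕ) : K ≃ₐ[ℚ] K) : K →ₐ[ℚ] K)
  have hβ : ∀ j, σ (β j) = β (finRotate n j) := by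
    intro j
    refine Eq.trans ?_ (apply_finRotate (fun k => (σ ^ k) a) (by rw [hσn, pow_zero]) j).symm
    rw [pow_succ']
    rfl
  -- The norm of a unit is `1` or `-1`; squaring the unit makes the determinant equal to one.
  have hprod : (∏ j, β j) ^ 2 = 1 := by
    have hfix : σ (∏ j, β j) = ∏ j, β j := by
      rw [map_prod, Finset.prod_congr rfl fun j _ => hβ j]
      exact Equiv.prod_comp (finRotate n) β
    have hfix' : ∀ g : K ≃ₐ[ℚ] K, g (∏ j, β j) = ∏ j, β j := by
      intro g
      obtain ⟨m, rfl⟩ := hσpow g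
      simp only
      induction m with
      | zero => rfl
      | succ m ih => rw [pow_succ, AlgEquiv.mul_apply, hfix, ih]
    refine pow_eq_one_of_pow_eq_pow (fun _ : Fin n => ∏ j, β j)
      (fun _ => IsIntegral.prod _ fun j _ => hβint j)
      (fun _ => ?_) (fun _ => Finset.prod_ne_zero_iff.2 fun j _ => hβ0 j)
      (fun g j => ⟨j, hfix' g⟩) (N := 1) (fun _ _ => rfl) ⟨0, hn.pos⟩
    rw [← Finset.prod_inv_distrib]
    exact IsIntegral.prod _ fun j _ => hβint' j
  let α : Fin n → K := fun j => β j ^ 2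
  have hα0 : ∀ j, α j ≠ 0 := fun j => pow_ne_zero _ (hβ0 j)
  have hαint : ∀ j, IsIntegral ℤ (α j) := fun j => (hβint j).pow 2
  have hαint' : ∀ j, IsIntegral ℤ (α j)⁻¹ := fun j => by
    rw [← inv_pow]; exact (hβint' j).pow 2
  have hα : ∀ j, σ (α j) = α (finRotate n j) := fun j => by
    change σ (β j ^ 2) = β (finRotate n j) ^ 2
    rw [map_pow, hβ]
  have hα1 : ∏ j, α j = 1 := by rw [Finset.prod_pow, hprod]
  have hrel : RelationsTrivial α := by
    refine relationsTrivial_of_cyclic hn σ hσn hσ α hαint hαint' hα0 (fun j N hN h => ?_) hα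
    refine hator (2 * N) (by omega) ((σ ^ (j : ℕ)).injective ?_)
    rw [map_one, map_pow, pow_mul]
    exact h
  obtain ⟨g, hg⟩ := exists_diagonal_lieHom hz.linearIndependent hz.span_eq hσpow hσz hα
  let ev : FreeMagma (Fin n) → K := fun t => ∏ j, α j ^ letterCount j t
  have hev0 : ∀ t, ev t ≠ 0 := fun t => Finset.prod_ne_zero_iff.2 fun j _ => pow_ne_zero _ (hα0 j)
  have hevint : ∀ t, IsIntegral ℤ (ev t) := fun t => IsIntegral.prod _ fun j _ => (hαint j).pow _
  have hevint' : ∀ t, IsIntegral ℤ (ev t)⁻¹ := fun t => by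
    rw [← Finset.prod_inv_distrib]
    refine IsIntegral.prod _ fun j _ => ?_
    rw [← inv_pow]
    exact (hαint' j).pow _
  obtain ⟨T, hT⟩ := exists_finset_span_bracketEval hz.span_eq
  classical
  -- Brackets with constant letter counts lie in `𝔧`, so their eigenvalue `1` need not be a root.
  let T' := T.filter fun t => ¬ ∃ k : ℕ, ∀ j, letterCount j t = k
  let P : ℤ[X] := ∏ t ∈ T', minpoly ℤ (ev t)
  refine isAnosov_quotient g (map_mem_orbitIdeal g fun w hw =>
    (hW w hw).exists_eq_smul hα0 hα1 hg) (P := P) ?_ ?_ ?_ ?_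
  · exact monic_prod_of_monic _ _ fun t _ => minpoly.monic (hevint t)
  · rw [coeff_zero_eq_eval_zero, eval_prod]
    refine Finset.prod_induction _ IsUnit (fun _ _ => IsUnit.mul) isUnit_one fun t _ => ?_
    rw [← coeff_zero_eq_eval_zero]
    exact isUnit_coeff_zero_minpoly (hev0 t) (hevint t) (hevint' t)
  · intro x
    have hjK := jIdeal_le_baseChange hz hj
    have h1 : ∀ y : FreeNil K n r, aeval ((g : FreeNilQ n r →ₗ[ℚ] FreeNilQ n r).baseChange K :
        Module.End K (FreeNil K n r)) P y ∈ (orbitIdeal W).toSubmodule.baseChange K := by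
      have h2 : Submodule.span K (bracketEval z '' (T : Set _)) ≤
          ((orbitIdeal W).toSubmodule.baseChange K).comap
            (aeval ((g : FreeNilQ n r →ₗ[ℚ] FreeNilQ n r).baseChange K :
              Module.End K (FreeNil K n r)) P) := by
        refine Submodule.span_le.2 ?_
        rintro _ ⟨t, ht, rfl⟩
        have h0 := aeval_apply_of_apply_eq_smul
          (f := (g : FreeNilQ n r →ₗ[ℚ] FreeNilQ n r).baseChange K) (μ := ev t)
          (lieHom_bracketEval hg t) P
        rw [SetLike.mem_coe, Submodule.mem_comap, h0]
        by_cases hconst : ∃ k : ℕ, ∀ j, letterCount j t = k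
        · exact Submodule.smul_mem _ _ (hjK (bracketEval_mem_jIdeal hconst))
        · have h3 : aeval (ev t) P = 0 := by
            rw [map_prod]
            exact Finset.prod_eq_zero (i := t) (Finset.mem_filter.2 ⟨ht, hconst⟩)
              (minpoly.aeval ℤ _)
          rw [h3, zero_smul]
          exact Submodule.zero_mem _
      intro y
      exact h2 (hT ▸ Submodule.mem_top)
    have h4 := h1 ((1 : K) ⊗ₜ x)
    rw [← one_tmul_aeval, one_tmul_mem_baseChange] at h4
    exact h4
  · intro μ hμ hnorm
    rw [IsRoot, Polynomial.map_prod, eval_prod, Finset.prod_eq_zero_iff] at hμ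
    obtain ⟨t, ht, hμt⟩ := hμ
    have h1 : ev t ^ 2 = 1 := sq_eq_one_of_norm_eq_one
      (by rw [hz.finrank_eq]; exact hn.odd_of_ne_two (by omega)) (hevint t) hμt hnorm
    refine (Finset.mem_filter.1 ht).2 ⟨letterCount ⟨0, hn.pos⟩ t, fun j => ?_⟩
    have h2 : ∏ j, α j ^ ((2 * letterCount j t : ℕ) : ℤ) = 1 := by
      simp only [zpow_natCast]
      rw [← h1, ← Finset.prod_pow]
      refine Finset.prod_congr rfl fun j _ => ?_
      rw [mul_comm, pow_mul]
    have h3 := hrel _ h2 j ⟨0, hn.pos⟩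
    omega

end OddPrime

/-! ### Anosov quotients in degree two -/

section DegreeTwo

open LieModule

variable {n r : ℕ}

theorem aeval_eq_zero_of_apply_genQ {A : Matrix (Fin n) (Fin n) ℤ} {P : ℤ[X]}
    {I : LieIdeal ℚ (FreeNilQ n r)}
    (hI : (lowerCentralSeries ℚ (FreeNilQ n r) (FreeNilQ n r) 1).toSubmodule ≤ I.toSubmodule)
    (hA : ∀ i, aeval (matEndQ r A : Module.End ℚ (FreeNilQ n r)) P (genQ n r i) = 0)
    (hlcs : ∀ x ∈ (lowerCentralSeries ℚ (FreeNilQ n r) (FreeNilQ n r) 1).toSubmodule,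
      aeval (matEndQ r A : Module.End ℚ (FreeNilQ n r)) P x ∈
        (lowerCentralSeries ℚ (FreeNilQ n r) (FreeNilQ n r) 1).toSubmodule)
    (x : FreeNilQ n r) : aeval (matEndQ r A : Module.End ℚ (FreeNilQ n r)) P x ∈ I := by
  have h1 : (⊤ : Submodule ℚ (FreeNilQ n r)) ≤ I.toSubmodule.comap
      (aeval (matEndQ r A : Module.End ℚ (FreeNilQ n r)) P) := by
    rw [← span_genQ_sup, sup_le_iff, Submodule.span_le]
    refine ⟨?_, fun x hx => hI (hlcs x hx)⟩
    rintro _ ⟨i, rfl⟩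
    rw [SetLike.mem_coe, Submodule.mem_comap, hA]
    exact Submodule.zero_mem _
  exact h1 Submodule.mem_top

/-- The quotient by a rational ideal that is either the commutator ideal or everything is Anosov, if
there are two generators: the matrix with rows `(2, 1)`, `(1, 1)` acts hyperbolically. -/
theorem isAnosov_of_lcs_one_le {I : LieIdeal ℚ (FreeNilQ 2 r)}
    (hI : (lowerCentralSeries ℚ (FreeNilQ 2 r) (FreeNilQ 2 r) 1).toSubmodule ≤ I.toSubmodule)
    (h : I = ⊤ ∨ I.toSubmodule ≤
      (lowerCentralSeries ℚ (FreeNilQ 2 r) (FreeNilQ 2 r) 1).toSubmodule) :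
    IsAnosov (FreeNil ℝ 2 r ⧸ I.baseChange ℝ) := by
  let A : Matrix (Fin 2) (Fin 2) ℤ := !![2, 1; 1, 1]
  have hinv : ∀ x ∈ (lowerCentralSeries ℚ (FreeNilQ 2 r) (FreeNilQ 2 r) 1).toSubmodule,
      matEndQ r A x ∈ (lowerCentralSeries ℚ (FreeNilQ 2 r) (FreeNilQ 2 r) 1).toSubmodule :=
    lcs_invariant (matHomQ r A) 1
  have hP : aeval (matEndQ r A : Module.End ℚ (FreeNilQ 2 r)) (X ^ 2 - (X + X + X) + 1 : ℤ[X]) =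
      matEndQ r A * matEndQ r A - (matEndQ r A + matEndQ r A + matEndQ r A) + 1 := by
    simp [pow_two]
  have hmon : (X ^ 2 - (X + X + X) + 1 : ℤ[X]).Monic := by monicity!
  refine isAnosov_quotient (matHomQ r A) ?_ hmon (by simp) ?_ ?_
  · rcases h with rfl | h
    · exact fun _ _ => LieSubmodule.mem_top _
    · exact fun x hx => hI (hinv x (h hx))
  · refine aeval_eq_zero_of_apply_genQ hI (fun i => ?_) fun x hx => ?_
    · rw [hP]
      simp only [LinearMap.add_apply, LinearMap.sub_apply, Module.End.mul_apply,
        Module.End.one_apply]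
      fin_cases i <;>
      · simp only [Fin.zero_eta, Fin.mk_one, matEndQ_genQ, Fin.sum_univ_two, map_add, map_smul]
        simp only [A, Matrix.of_apply, Matrix.cons_val', Matrix.cons_val_zero, Matrix.cons_val_one,
          Matrix.cons_val_fin_one]
        push_cast
        module
    · rw [hP, LinearMap.add_apply, LinearMap.sub_apply]
      exact add_mem (sub_mem (hinv _ (hinv _ hx))
        (add_mem (add_mem (hinv _ hx) (hinv _ hx)) (hinv _ hx))) hx
  · intro μ hμ hnorm
    have h1 : μ ^ 2 - (μ + μ + μ) + 1 = 0 := by simpa [IsRoot] using hμ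
    have h2 : μ.re ^ 2 + μ.im ^ 2 = 1 := by
      rw [← one_pow 2, ← hnorm, ← Complex.normSq_eq_norm_sq, Complex.normSq_apply]
      ring
    have hre := congrArg Complex.re h1
    have him := congrArg Complex.im h1
    simp [pow_two] at hre him
    have h3 : μ.im * (2 * μ.re - 3) = 0 := by linarith
    rcases mul_eq_zero.1 h3 with h3 | h3
    · rw [h3] at hre h2
      nlinarith
    · nlinarith

variable {K : Type*} [Field K] [Algebra ℚ K]

/-- The two letters have different weights, so a weight vector involves, modulo commutators, at most
one of them. -/
theorem mem_span_sup_lcs_one {z : Fin 2 → FreeNil K 2 r} {w : FreeNil K 2 r}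
    (hw : IsWeightVector z w) : ∃ i, w ∈ Submodule.span K {z i} ⊔
      (lowerCentralSeries K (FreeNil K 2 r) (FreeNil K 2 r) 1).toSubmodule := by
  obtain ⟨d, hd⟩ := hw
  refine ⟨if d 0 - d 1 = 1 then 0 else 1, ?_⟩
  refine Submodule.span_le.2 ?_ hd
  rintro _ ⟨t, ⟨k, hk⟩, rfl⟩
  cases t with
  | of i =>
    have h0 := hk 0
    have h1 := hk 1
    rw [letterCount_of] at h0 h1
    have hi : (if d 0 - d 1 = 1 then 0 else 1) = i := by
      fin_cases i <;> simp at h0 h1 ⊢ <;> omega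
    rw [hi]
    exact Submodule.mem_sup_left (Submodule.mem_span_singleton_self _)
  | mul s t =>
    refine Submodule.mem_sup_right ?_
    change ⁅bracketEval z s, bracketEval z t⁆ ∈
      lowerCentralSeries K (FreeNil K 2 r) (FreeNil K 2 r) (0 + 1)
    rw [lowerCentralSeries_succ]
    exact LieSubmodule.lie_mem_lie (LieSubmodule.mem_top _) (LieSubmodule.mem_top _)

/-- The commutator ideal of a Lie algebra generated by `z 0` and `z 1` is generated by `⁅z 0, z 1⁆`. -/
theorem lcs_one_le_of_lie_mem {z : Fin 2 → FreeNil K 2 r}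
    (hz : Submodule.span K (Set.range z) = stepOne K 2 r) {J : LieIdeal K (FreeNil K 2 r)}
    (hJ : ⁅z 0, z 1⁆ ∈ J) :
    (lowerCentralSeries K (FreeNil K 2 r) (FreeNil K 2 r) 1).toSubmodule ≤ J.toSubmodule := by
  have h1 : ∀ k, normedSpan K z (k + 1) ≤ J.toSubmodule := by
    intro k
    induction k with
    | zero =>
      refine (normedSpan_one_le z).trans (Submodule.span_le.2 ?_)
      rintro _ ⟨⟨i, j⟩, rfl⟩
      change ⁅z i, z j⁆ ∈ J
      have h10 : ⁅z 1, z 0⁆ ∈ J := by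
        rw [← freeNil_lie_skew]
        exact neg_mem hJ
      fin_cases i <;> fin_cases j
      · exact (lie_self (z 0)).symm ▸ J.zero_mem
      · exact hJ
      · exact h10
      · exact (lie_self (z 1)).symm ▸ J.zero_mem
    | succ k ih =>
      refine iSup_le fun i => ?_
      rintro _ ⟨x, hx, rfl⟩
      exact lie_mem_right K _ J _ _ (ih hx)
  have h2 : ∀ d, (lowerCentralSeries K (FreeNil K 2 r) (FreeNil K 2 r) (r - d + 1)).toSubmodule ≤
      J.toSubmodule := by
    intro d
    induction d with
    | zero =>
      refine le_trans (antitone_lowerCentralSeries K _ _ (Nat.le_succ r)) ?_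
      rw [lcs_freeNil]
      exact bot_le
    | succ d ih =>
      by_cases hd : r ≤ d
      · rwa [Nat.sub_eq_zero_of_le hd, ← Nat.sub_eq_zero_of_le (hd.trans d.le_succ)] at ih
      · have h3 : r - d = r - (d + 1) + 1 := by omega
        rw [h3] at ih
        exact (lcs_le_normedSpan_sup (span_sup_lcs_one hz) _).trans (sup_le (h1 _) ih)
  simpa using h2 r

/-- The ideal contains `⁅z 0, z 1⁆`, hence the commutator ideal. If it contains more, then it contains
one of `z 0`, `z 1` modulo commutators, and by Galois conjugation both. -/
theorem isAnosov_of_two {z : Fin 2 → FreeNil K 2 r}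
    (hz : IsCyclicFrame z) {W : Set (FreeNil K 2 r)} (hW : ∀ w ∈ W, IsWeightVector z w)
    (hj : ratPart (jIdeal z).toSubmodule ≤ (orbitIdeal W).toSubmodule) :
    IsAnosov (FreeNil ℝ 2 r ⧸ (orbitIdeal W).baseChange ℝ) := by
  have hgal := hz.isGalois
  have hfin : FiniteDimensional ℚ K :=
    Module.finite_of_finrank_pos (by rw [hz.finrank_eq]; exact two_pos)
  let J : LieIdeal K (FreeNil K 2 r) := (orbitIdeal W).baseChange K
  have h0 : bracketEval z (.of 0 * .of 1) ∈ jIdeal z := bracketEval_mem_jIdeal ⟨1, fun j => by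
    rw [letterCount_mul, letterCount_of, letterCount_of]
    fin_cases j <;> rfl⟩
  have h1 : ⁅z 0, z 1⁆ ∈ J := jIdeal_le_baseChange hz hj h0
  have h2 := lcs_one_le_of_lie_mem hz.span_eq h1
  refine isAnosov_of_lcs_one_le ?_ ?_
  · rw [lcs_freeNil_eq] at h2
    exact baseChange_le_baseChange.1 h2
  by_cases hWl : ∀ w ∈ W, w ∈ (lowerCentralSeries K (FreeNil K 2 r) (FreeNil K 2 r) 1).toSubmodule
  · right
    have h3 : orbitIdeal W ≤ lowerCentralSeries ℚ (FreeNilQ 2 r) (FreeNilQ 2 r) 1 := by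
      rw [orbitIdeal, LieSubmodule.lieSpan_le]
      refine Set.iUnion₂_subset fun w hw v hv => ?_
      have h4 := hWl w hw
      rw [lcs_freeNil_eq] at h4
      have h5 := ratPart_mono (orbitSpan_le (fun g _ => galAct_mem_baseChange g) h4) hv
      rwa [ratPart_baseChange] at h5
    exact h3
  · left
    push Not at hWl
    obtain ⟨w, hw, hwl⟩ := hWl
    obtain ⟨i, hi⟩ := mem_span_sup_lcs_one (hW w hw)
    obtain ⟨y, hy, l, hl, rfl⟩ := Submodule.mem_sup.1 hi
    obtain ⟨c, rfl⟩ := Submodule.mem_span_singleton.1 hy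
    have hc : c ≠ 0 := by
      rintro rfl
      rw [zero_smul, zero_add] at hwl
      exact hwl hl
    have h3 : c • z i + l ∈ J.toSubmodule := by
      have h4 := Submodule.baseChange_mono K (ratPart_orbitSpan_le hw)
      rw [(isRational_orbitSpan _ : _ = _)] at h4
      exact h4 (mem_orbitSpan _)
    have h5 : z i ∈ J.toSubmodule := by
      have h6 := (Submodule.add_mem_iff_left _ (h2 hl)).1 h3
      exact (Submodule.smul_mem_iff _ hc).1 h6
    obtain ⟨σ, -, hσz⟩ := hz.cyclic
    have h7 : z (finRotate 2 i) ∈ J.toSubmodule := by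
      rw [← hσz]
      exact galAct_mem_baseChange σ h5
    have h8 : J.toSubmodule = ⊤ := by
      rw [eq_top_iff, ← span_sup_lcs_one hz.span_eq, sup_le_iff, Submodule.span_le]
      refine ⟨?_, h2⟩
      rintro _ ⟨j, rfl⟩
      have hij : ∀ i j : Fin 2, j = i ∨ j = finRotate 2 i := by decide
      rcases hij i j with rfl | rfl
      · exact h5
      · exact h7
    rw [← LieSubmodule.toSubmodule_eq_top, ← top_le_iff]
    refine baseChange_le_baseChange (K := K).1 ?_
    exact le_top.trans h8.ge

/-- Ideals of cyclic type in prime degree that contain `𝔧` have Anosov quotients. -/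
theorem isAnosov_of_isCyclicTypeIdealFor (hn : n.Prime)
    {φ : FreeNil ℝ n r ≃ₗ⁅ℝ⁆ FreeNil ℝ n r} {z : Fin n → FreeNil K n r}
    {I : LieIdeal ℝ (FreeNil ℝ n r)} (h : IsCyclicTypeIdealFor φ z I)
    (hj : ∀ x ∈ toReal (jIdeal z).toSubmodule, φ x ∈ I) : IsAnosov (FreeNil ℝ n r ⧸ I) := by
  obtain ⟨hz, W, hW, hI⟩ := h
  have hj' : ratPart (jIdeal z).toSubmodule ≤ (orbitIdeal W).toSubmodule := fun v hv => by
    have h1 := hj _ (Submodule.tmul_mem_baseChange_of_mem 1 hv)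
    rw [mem_orbitIdeal_iff hI] at h1
    exact one_tmul_mem_baseChange.1 h1
  obtain ⟨e⟩ := nonempty_quotient_orbitIdeal hI
  refine IsAnosov.of_equiv ?_ e.symm
  rcases hn.two_le.eq_or_lt with rfl | hn3
  · exact isAnosov_of_two hz hW hj'
  · exact isAnosov_of_odd hn hn3 hz hW hj'

end DegreeTwo

end AnosovLie

end

theorem theorem1p2 :
    (∀ (r : ℕ) (𝔫 : Type*) [LieRing 𝔫] [LieAlgebra ℝ 𝔫] [FiniteDimensional ℝ 𝔫]
        (f : 𝔫 ≃ₗ⁅ℝ⁆ 𝔫) (n : ℕ) (p : ℤ[X]),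
      AnosovLie.IsStepNilpotent 𝔫 r →
      AnosovLie.IsAnosovAut f →
      Module.End.IsSemisimple ((f : 𝔫 →ₗ⁅ℝ⁆ 𝔫) : 𝔫 →ₗ[ℝ] 𝔫) →
      AnosovLie.IsFirstPoly f p →
      p.natDegree = n →
      Irreducible p →
      -- prime degree and cyclic Galois group
      (n.Prime → IsCyclic (AnosovLie.ratPoly p).Gal →
        ∃ I : LieIdeal ℝ (AnosovLie.FreeNil ℝ n r), AnosovLie.IsCyclicTypeIdeal I ∧
          Nonempty (𝔫 ≃ₗ⁅ℝ⁆ (AnosovLie.FreeNil ℝ n r ⧸ I))) ∧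
      -- symmetric Galois group
      (Nonempty ((AnosovLie.ratPoly p).Gal ≃* Equiv.Perm (Fin n)) →
        (r = 2 → Nonempty (𝔫 ≃ₗ⁅ℝ⁆ AnosovLie.FreeNil ℝ n 2)) ∧
        (r = 3 →
          ∀ A : Matrix (Fin n) (Fin n) ℤ, A.charpoly = p →
          ∀ z : Fin n → AnosovLie.FreeNil (AnosovLie.ratPoly p).SplittingField n 3,
            AnosovLie.IsEigenFrame A z →
            ∃ I : LieIdeal ℝ (AnosovLie.FreeNil ℝ n 3),
              (I = ⊥ ∨
                I = AnosovLie.realIdeal (AnosovLie.F1 z) ∨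
                I = AnosovLie.realIdeal (AnosovLie.F2 z) ∨
                (∃ F2a, AnosovLie.IsF2a A z F2a ∧
                  I = AnosovLie.realIdeal (AnosovLie.F1 z ⊔ F2a)) ∨
                (∃ F2a, AnosovLie.IsF2a A z F2a ∧ I = AnosovLie.realIdeal F2a)) ∧
              Nonempty (𝔫 ≃ₗ⁅ℝ⁆ (AnosovLie.FreeNil ℝ n 3 ⧸ I))))) ∧
    -- the converse for prime `n`
    (∀ (n r : ℕ), n.Prime →
      ∀ (K : Type) [Field K] [Algebra ℚ K]
        (φ : AnosovLie.FreeNil ℝ n r ≃ₗ⁅ℝ⁆ AnosovLie.FreeNil ℝ n r)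
        (z : Fin n → AnosovLie.FreeNil K n r) (I : LieIdeal ℝ (AnosovLie.FreeNil ℝ n r)),
        AnosovLie.IsCyclicTypeIdealFor φ z I →
        (∀ x ∈ AnosovLie.toReal (AnosovLie.jIdeal z).toSubmodule, φ x ∈ I) →
        AnosovLie.IsAnosov (AnosovLie.FreeNil ℝ n r ⧸ I)) := by
  refine ⟨fun r 𝔫 _ _ _ f n p hr hf hss hp hn hirr => ⟨fun hprime hcyc =>
    AnosovLie.exists_cyclicType hr hf hss hp hn hirr hprime hcyc, fun hsym => ⟨?_, ?_⟩⟩,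
    fun n r hn K _ _ φ z I h hj => AnosovLie.isAnosov_of_isCyclicTypeIdealFor hn h hj⟩
  · rintro rfl
    exact AnosovLie.nonempty_equiv_freeNil hr hf hss hp hn hirr hsym
  · rintro rfl A hA z hz
    have := AnosovLie.isSplittingField_ratPoly p
    exact AnosovLie.exists_ideal_of_symmetric hr hf hss hp hn hirr hsym hA hz
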